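/- **Setting.** Consider $x_{k+1}=A(w_k)x_k+B(w_k)u_k$ with $A(w)=A_0+\sum_{i=1}^{n_w}w^{(i)}A_i$, $B(w)=B_0+\sum_{i=1}^{n_w}w^{(i)}B_i$, $x_k\in\mathbb R^{n_x}$, $u_k\in\mathbb R^{n_u}$, where the $w_k$ are i.i.d. square integrable random vectors with $\mathbb E[w]=0$, $\mathbb E[ww^\top]=\Sigma$. The cost is $\mathbb E[\sum_{k\ge0}x_k^\top Qx_k+u_k^\top Ru_k]$ with $Q\succ0$, $R\succ0$ and $x_0$ given; $J^\star(x_0)$ is its infimum over non-anticipative inputs and $\hat J(x_0)$ its value under $u_k=\hat Kx_k$. Let $\Sigma_0=\mathrm{diag}(1,\Sigma)$; let $\mathbf A,\mathbf B$ be the block columns of $A_0,\dots,A_{n_w}$ and $B_0,\dots,B_{n_w}$, and let $M^\#$ denote the block column of the transposed blocks of a block column $M$. For a symmetric matrix $S$ put $F_S(P)=\mathbf A^\top(S\otimes P)\mathbf A$, $G_S(P)=\mathbf B^\top(S\otimes P)\mathbf B$, $H_S(P)=\mathbf B^\top(S\otimes P)\mathbf A$. The Riccati equation for $S$ is $P-Q-F_S(P)+H_S(P)^\top(R+G_S(P))^{-1}H_S(P)=0$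 with $P\succeq0$. Let $P^\star$ be its solution for $\Sigma_0$ and $K^\star=-(R+G(P^\star))^{-1}H(P^\star)$, where the index $\Sigma_0$ is dropped. Let $\hat\Sigma_0=\Sigma_0+\Delta$, with $\Delta$ symmetric and $\underline\delta\,\Sigma_0\preceq\Delta\preceq\overline\delta\,\Sigma_0$ for some $-1\le\underline\delta\le0\le\overline\delta$. Let $\delta=\max\{|\underline\delta|,|\overline\delta|\}$, let $\hat P$ be the solution of the Riccati equation for $\hat\Sigma_0$, and $\hat K=-(R+G_{\hat\Sigma_0}(\hat P))^{-1}H_{\hat\Sigma_0}(\hat P)$ (the empirical controller). **Constants.** $\|\cdot\|$ is the spectral norm of matrices, the operator norm it induces for maps between spaces of symmetric matrices, and the Euclidean norm of vectors. Let $\mathbf L=\mathbf A+\mathbf BK^\star$, $\kappa_A=\|F\|$, $\eta_A=\|F(P^\star)\|$, $\kappa_B=\|G\|$, $\eta_B=\|G(P^\star)\|$, $\kappa_{AB}=\|\mathbf A\|\|\mathbf B\|\|\Sigma_0\|$, $\eta_{AB}=\kappa_{AB}\|P^\star\|$, $\kappa_S=\|\mathbf L\|^2\|\mathbf BR^{-1}\mathbf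 B^\top\|\|\Sigma_0\|^2$, $\eta_{BR}=\|G(P^\star)+R\|$, $\mu_P^\star=\min\sigma(P^\star)$, $\mu_R=\min\sigma(R)$, $\kappa_K=\kappa_B\|K^\star\|+\kappa_{AB}$, $\eta_K=\eta_B\|K^\star\|+\eta_{AB}$, $\kappa_B^\#=\|X\mapsto(\mathbf B^\#)^\top(\Sigma_0\otimes X)\mathbf B^\#\|$, $\eta_{LB}^\#=\|\mathbf L^\#\|\|\mathbf B^\#\|\|\Sigma_0\|$, $\eta_{Lyap}=\|\mathcal L^{-1}\|^{-1}$ and $\eta_{Lyap}^\#=\|(\mathcal L^\#)^{-1}\|^{-1}$, where $\mathcal L(X)=X-\mathbf L^\top(\Sigma_0\otimes X)\mathbf L$ and $\mathcal L^\#(X)=X-(\mathbf L^\#)^\top(\Sigma_0\otimes X)\mathbf L^\#$. Put $$\epsilon_P=\frac{\eta_{Lyap}-\kappa_A\delta-\sqrt{(\eta_{Lyap}-\kappa_A\delta)^2-4\eta_A\kappa_S\delta}}{2\kappa_S},\qquad \epsilon_K=\frac1{\mu_R}\big[(1+\delta)\epsilon_P\kappa_K+\delta\,\eta_K\big]$$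 (with $\epsilon_P:=0$ in the trivial case $\kappa_S=0$, in which $\hat K=K^\star=0$). **Theorem.** Suppose that $$\kappa_A^2\,\delta\le 2\eta_A\kappa_S+\kappa_A\eta_{Lyap}-2\sqrt{\eta_A\kappa_S(\eta_A\kappa_S+\kappa_A\eta_{Lyap})},\qquad \epsilon_P<\mu_P^\star,$$ and that the stability condition $$\epsilon_K<\frac{\eta_{Lyap}^\#}{\eta_{LB}^\#+\sqrt{(\eta_{LB}^\#)^2+\kappa_B^\#\eta_{Lyap}^\#}}$$ holds (the right-hand side being $+\infty$ if its denominator is $0$). Then $\hat K$ renders the true system mean-square stable, and even exponentially so. For every $x_0$ the costs $J^\star(x_0)$ and $\hat J(x_0)$ are finite, and, with $\bar n=\min(n_x,n_u)$, $$\hat J(x_0)-J^\star(x_0)\le \bar n\,\epsilon_K^2\,\eta_{BR}\|x_0\|^2\,\frac1{\eta_{Lyap}^\#}\left[1+\frac{2\eta_{LB}^\#\epsilon_K+\kappa_B^\#\epsilon_K^2}{\eta_{Lyap}^\#-2\eta_{LB}^\#\epsilon_K-\kappa_B^\#\epsilon_K^2}\right].$$ -/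

import Mathlib

open MeasureTheory Filter Topology
open scoped Matrix Kronecker ENNReal
open scoped Matrix.Norms.L2Operator

/- All matrix norms below are spectral norms (`Matrix.Norms.L2Operator`); a matrix operator between
spaces of symmetric matrices carries the operator norm that the spectral norms induce. -/

/-- Real symmetric `n × n` matrices, normed by the spectral norm. -/
abbrev Symm (n : ℕ) : Type := selfAdjoint (Matrix (Fin n) (Fin n) ℝ)

/-- The block column with blocks `M 0, …, M (m - 1)`. -/
def blockColumn {m p q : ℕ} (M : Fin m → Matrix (Fin p) (Fin q) ℝ) :
    Matrix (Fin m × Fin p) (Fin q) ℝ :=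
  Matrix.of fun ir c => M ir.1 ir.2 c

/-- The block transpose `M^#`: the block column of the transposed blocks of a block column `M`. -/
def blockTranspose {m p q : ℕ} (M : Matrix (Fin m × Fin p) (Fin q) ℝ) :
    Matrix (Fin m × Fin q) (Fin p) ℝ :=
  Matrix.of fun ir c => M (ir.1, c) ir.2

/-- The block diagonal matrix `diag(1, Σ)`. -/
def augment {n : ℕ} (Sg : Symm n) : Symm (n + 1) :=
  ⟨Matrix.of (Fin.cons (Fin.cons 1 0) fun i => Fin.cons 0 (Sg.1 i)), by
    have h : ∀ i j, Sg.1 j i = Sg.1 i j := fun i j => by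
      simpa [Matrix.star_eq_conjTranspose] using
        congrArg (fun M : Matrix (Fin n) (Fin n) ℝ => M i j) (selfAdjoint.mem_iff.1 Sg.2)
    rw [selfAdjoint.mem_iff, Matrix.star_eq_conjTranspose]
    ext i j
    refine Fin.cases ?_ (fun i => ?_) i <;> refine Fin.cases ?_ (fun j => ?_) j <;>
      simp [Matrix.conjTranspose_apply, h]⟩

instance {n : ℕ} : FiniteDimensional ℝ (Symm n) :=
  inferInstanceAs (FiniteDimensional ℝ
    (selfAdjoint.submodule ℝ (Matrix (Fin n) (Fin n) ℝ)))

/-- The operator `X ↦ Mᵀ (S ⊗ X) M` on symmetric matrices. -/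
noncomputable def kronCongr {m p q : ℕ} (S : Symm m) (M : Matrix (Fin m × Fin p) (Fin q) ℝ) :
    Symm p →L[ℝ] Symm q :=
  LinearMap.toContinuousLinearMap
    { toFun := fun X => ⟨Mᵀ * (S.1 ⊗ₖ X.1) * M, by
        have hS := selfAdjoint.mem_iff.1 S.2
        have hX := selfAdjoint.mem_iff.1 X.2
        rw [Matrix.star_eq_conjTranspose] at hS hX
        rw [selfAdjoint.mem_iff, Matrix.star_eq_conjTranspose]
        simp only [Matrix.conjTranspose_mul, Matrix.conjTranspose_kronecker, hS, hX,
          ← Matrix.conjTranspose_eq_transpose_of_trivial, Matrix.conjTranspose_conjTranspose,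
          Matrix.mul_assoc]⟩
      map_add' := fun X Y => by
        ext1
        simp [Matrix.kronecker_add, Matrix.mul_add, Matrix.add_mul]
      map_smul' := fun c X => by
        ext1
        simp [Matrix.kronecker_smul] }

/-- Data of a linear quadratic problem with multiplicative noise:
`x_{k+1} = A(w_k) x_k + B(w_k) u_k` with stage cost `xᵀ Q x + uᵀ R u`, where
`A(w) = A 0 + ∑ w i • A (i + 1)` and `B(w) = B 0 + ∑ w i • B (i + 1)`. -/
structure LQRSystem (nx nu nw : ℕ) where
  A : Fin (nw + 1) → Matrix (Fin nx) (Fin nx) ℝ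
  B : Fin (nw + 1) → Matrix (Fin nx) (Fin nu) ℝ
  Q : Matrix (Fin nx) (Fin nx) ℝ
  R : Matrix (Fin nu) (Fin nu) ℝ

/-- `w 0, w 1, …` are i.i.d. copies of a square integrable random vector with mean zero and
second moment matrix `Sg`. -/
structure IsNoise {Ω : Type*} [MeasurableSpace Ω] (μ : Measure Ω) {nw : ℕ}
    (w : ℕ → Ω → Fin nw → ℝ) (Sg : Symm nw) : Prop where
  measurable : ∀ k, Measurable (w k)
  indep : ProbabilityTheory.iIndepFun w μ
  identDistrib : ∀ k, ProbabilityTheory.IdentDistrib (w k) (w 0) μ μ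
  memLp : ∀ i, MemLp (fun ω => w 0 ω i) 2 μ
  mean : ∀ i, ∫ ω, w 0 ω i ∂μ = 0
  secondMoment : ∀ i j, ∫ ω, w 0 ω i * w 0 ω j ∂μ = Sg.1 i j

namespace LQRSystem

variable {nx nu nw : ℕ} (sys : LQRSystem nx nu nw)

/-! ### Dynamics, costs, stability -/

/-- `A(w)`. -/
noncomputable def Aw (v : Fin nw → ℝ) : Matrix (Fin nx) (Fin nx) ℝ :=
  sys.A 0 + ∑ i, v i • sys.A i.succ

/-- `B(w)`. -/
noncomputable def Bw (v : Fin nw → ℝ) : Matrix (Fin nx) (Fin nu) ℝ :=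
  sys.B 0 + ∑ i, v i • sys.B i.succ

/-- The state process driven by the noise `w` and the input process `u` from `x₀`. -/
noncomputable def state {Ω : Type*} (w : ℕ → Ω → Fin nw → ℝ) (u : ℕ → Ω → Fin nu → ℝ)
    (x₀ : Fin nx → ℝ) : ℕ → Ω → Fin nx → ℝ
  | 0, _ => x₀
  | k + 1, ω => sys.Aw (w k ω) *ᵥ state w u x₀ k ω + sys.Bw (w k ω) *ᵥ u k ω

/-- The closed-loop state process `x_{k+1} = (A(w_k) + B(w_k) K) x_k` from `x₀`. -/
noncomputable def closedLoop {Ω : Type*} (w : ℕ → Ω → Fin nw → ℝ)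
    (K : Matrix (Fin nu) (Fin nx) ℝ) (x₀ : Fin nx → ℝ) : ℕ → Ω → Fin nx → ℝ
  | 0, _ => x₀
  | k + 1, ω => (sys.Aw (w k ω) + sys.Bw (w k ω) * K) *ᵥ closedLoop w K x₀ k ω

/-- The expected total cost `E [∑ xₖᵀ Q xₖ + uₖᵀ R uₖ]`, possibly infinite. -/
noncomputable def totalCost {Ω : Type*} [MeasurableSpace Ω] (μ : Measure Ω)
    (x : ℕ → Ω → Fin nx → ℝ) (u : ℕ → Ω → Fin nu → ℝ) : ℝ≥0∞ :=
  ∫⁻ ω, ∑' k, ENNReal.ofReal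
    (x k ω ⬝ᵥ (sys.Q *ᵥ x k ω) + u k ω ⬝ᵥ (sys.R *ᵥ u k ω)) ∂μ

/-- Non-anticipative input processes: `uₖ` is a measurable function of `w₀, …, w_{k-1}`. -/
def Admissible {Ω : Type*} (w : ℕ → Ω → Fin nw → ℝ) (u : ℕ → Ω → Fin nu → ℝ) : Prop :=
  ∀ k, Measurable[⨆ j : Fin k, MeasurableSpace.comap (w j) inferInstance] (u k)

/-- The optimal cost from `x₀`: the infimum over all non-anticipative input processes. -/
noncomputable def optimalCost {Ω : Type*} [MeasurableSpace Ω] (μ : Measure Ω)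
    (w : ℕ → Ω → Fin nw → ℝ) (x₀ : Fin nx → ℝ) : ℝ≥0∞ :=
  ⨅ (u : ℕ → Ω → Fin nu → ℝ) (_ : Admissible w u), sys.totalCost μ (sys.state w u x₀) u

/-- The cost from `x₀` of the state feedback `uₖ = K xₖ`. -/
noncomputable def feedbackCost {Ω : Type*} [MeasurableSpace Ω] (μ : Measure Ω)
    (w : ℕ → Ω → Fin nw → ℝ) (K : Matrix (Fin nu) (Fin nx) ℝ) (x₀ : Fin nx → ℝ) : ℝ≥0∞ :=
  sys.totalCost μ (sys.closedLoop w K x₀) fun k ω => K *ᵥ sys.closedLoop w K x₀ k ω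

/-- `E ‖xₖ‖²` (Euclidean norm) for the closed loop under `uₖ = K xₖ`. -/
noncomputable def meanSquare {Ω : Type*} [MeasurableSpace Ω] (μ : Measure Ω)
    (w : ℕ → Ω → Fin nw → ℝ) (K : Matrix (Fin nu) (Fin nx) ℝ) (x₀ : Fin nx → ℝ) (k : ℕ) : ℝ≥0∞ :=
  ∫⁻ ω, ENNReal.ofReal (‖WithLp.toLp 2 (sys.closedLoop w K x₀ k ω)‖ ^ 2) ∂μ

/-- The feedback `K` renders the system mean-square stable. -/
def MeanSquareStable {Ω : Type*} [MeasurableSpace Ω] (μ : Measure Ω)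
    (w : ℕ → Ω → Fin nw → ℝ) (K : Matrix (Fin nu) (Fin nx) ℝ) : Prop :=
  ∀ x₀, Tendsto (sys.meanSquare μ w K x₀) atTop (𝓝 0)

/-- The feedback `K` renders the system exponentially mean-square stable. -/
def ExpMeanSquareStable {Ω : Type*} [MeasurableSpace Ω] (μ : Measure Ω)
    (w : ℕ → Ω → Fin nw → ℝ) (K : Matrix (Fin nu) (Fin nx) ℝ) : Prop :=
  ∃ c ρ : ℝ, 0 < c ∧ 0 < ρ ∧ ρ < 1 ∧ ∀ x₀ k,
    sys.meanSquare μ w K x₀ k ≤ ENNReal.ofReal (c * ρ ^ k * ‖WithLp.toLp 2 x₀‖ ^ 2)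

/-! ### Riccati equation and gain; `S` plays the role of `diag(1, Σ)` or of an estimate of it -/

/-- `𝐀`. -/
def bA : Matrix (Fin (nw + 1) × Fin nx) (Fin nx) ℝ := blockColumn sys.A

/-- `𝐁`. -/
def bB : Matrix (Fin (nw + 1) × Fin nx) (Fin nu) ℝ := blockColumn sys.B

/-- `F(P) = 𝐀ᵀ (S ⊗ P) 𝐀`. -/
noncomputable def F (S : Symm (nw + 1)) : Symm nx →L[ℝ] Symm nx := kronCongr S sys.bA

/-- `G(P) = 𝐁ᵀ (S ⊗ P) 𝐁`. -/
noncomputable def G (S : Symm (nw + 1)) : Symm nx →L[ℝ] Symm nu := kronCongr S sys.bB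

/-- `H(P) = 𝐁ᵀ (S ⊗ P) 𝐀`. -/
noncomputable def H (S : Symm (nw + 1)) (P : Symm nx) : Matrix (Fin nu) (Fin nx) ℝ :=
  sys.bBᵀ * (S.1 ⊗ₖ P.1) * sys.bA

/-- `P` is the (positive semidefinite) solution of the Riccati equation
`P - Q - F(P) + H(P)ᵀ (R + G(P))⁻¹ H(P) = 0`. -/
def IsRiccatiSolution (S : Symm (nw + 1)) (P : Symm nx) : Prop :=
  P.1.PosSemidef ∧
    P.1 - sys.Q - (sys.F S P).1 +
      (sys.H S P)ᵀ * (sys.R + (sys.G S P).1)⁻¹ * sys.H S P = 0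

/-- The gain `K = -(R + G(P))⁻¹ H(P)`. -/
noncomputable def gain (S : Symm (nw + 1)) (P : Symm nx) : Matrix (Fin nu) (Fin nx) ℝ :=
  -((sys.R + (sys.G S P).1)⁻¹ * sys.H S P)

/-! ### Constants; `S = diag(1, Σ)` and `P` is the corresponding Riccati solution -/

/-- `𝐋 = 𝐀 + 𝐁 K`. -/
noncomputable def bL (S : Symm (nw + 1)) (P : Symm nx) :
    Matrix (Fin (nw + 1) × Fin nx) (Fin nx) ℝ :=
  sys.bA + sys.bB * sys.gain S P

/-- The Lyapunov operator `X ↦ X - 𝐋ᵀ (S ⊗ X) 𝐋`. -/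
noncomputable def lyap (S : Symm (nw + 1)) (P : Symm nx) : Symm nx →L[ℝ] Symm nx :=
  ContinuousLinearMap.id ℝ (Symm nx) - kronCongr S (sys.bL S P)

/-- The adjoint Lyapunov operator `X ↦ X - (𝐋^#)ᵀ (S ⊗ X) 𝐋^#`. -/
noncomputable def lyapAdj (S : Symm (nw + 1)) (P : Symm nx) : Symm nx →L[ℝ] Symm nx :=
  ContinuousLinearMap.id ℝ (Symm nx) - kronCongr S (blockTranspose (sys.bL S P))

noncomputable def kappaA (S : Symm (nw + 1)) : ℝ := ‖sys.F S‖

noncomputable def etaA (S : Symm (nw + 1)) (P : Symm nx) : ℝ := ‖sys.F S P‖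

noncomputable def kappaB (S : Symm (nw + 1)) : ℝ := ‖sys.G S‖

noncomputable def etaB (S : Symm (nw + 1)) (P : Symm nx) : ℝ := ‖sys.G S P‖

noncomputable def kappaAB (S : Symm (nw + 1)) : ℝ := ‖sys.bA‖ * ‖sys.bB‖ * ‖S‖

noncomputable def etaAB (S : Symm (nw + 1)) (P : Symm nx) : ℝ :=
  ‖sys.bA‖ * ‖sys.bB‖ * ‖S‖ * ‖P‖

noncomputable def etaLyap (S : Symm (nw + 1)) (P : Symm nx) : ℝ :=
  ‖(sys.lyap S P).inverse‖⁻¹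

noncomputable def etaLyapAdj (S : Symm (nw + 1)) (P : Symm nx) : ℝ :=
  ‖(sys.lyapAdj S P).inverse‖⁻¹

/-- The norm of `X ↦ (𝐁^#)ᵀ (S ⊗ X) 𝐁^#`. -/
noncomputable def kappaBAdj (S : Symm (nw + 1)) : ℝ :=
  ‖kronCongr S (blockTranspose sys.bB)‖

noncomputable def etaLBAdj (S : Symm (nw + 1)) (P : Symm nx) : ℝ :=
  ‖blockTranspose (sys.bL S P)‖ * ‖blockTranspose sys.bB‖ * ‖S‖

noncomputable def kappaS (S : Symm (nw + 1)) (P : Symm nx) : ℝ :=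
  ‖sys.bL S P‖ ^ 2 * ‖sys.bB * sys.R⁻¹ * sys.bBᵀ‖ * ‖S‖ ^ 2

noncomputable def etaBR (S : Symm (nw + 1)) (P : Symm nx) : ℝ :=
  ‖(sys.G S P).1 + sys.R‖

/-- `min σ(P)`. -/
noncomputable def muP (P : Symm nx) : ℝ := sInf (spectrum ℝ P.1)

/-- `min σ(R)`. -/
noncomputable def muR : ℝ := sInf (spectrum ℝ sys.R)

noncomputable def kappaK (S : Symm (nw + 1)) (P : Symm nx) : ℝ :=
  sys.kappaB S * ‖sys.gain S P‖ + sys.kappaAB S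

noncomputable def etaK (S : Symm (nw + 1)) (P : Symm nx) : ℝ :=
  sys.etaB S P * ‖sys.gain S P‖ + sys.etaAB S P

/-- The bound on the Riccati perturbation at relative covariance error `s`. -/
noncomputable def epsP (S : Symm (nw + 1)) (P : Symm nx) (s : ℝ) : ℝ :=
  (sys.etaLyap S P - sys.kappaA S * s -
      √((sys.etaLyap S P - sys.kappaA S * s) ^ 2 - 4 * sys.etaA S P * sys.kappaS S P * s)) /
    (2 * sys.kappaS S P)

/-- The bound on the controller perturbation at relative covariance error `s`. -/
noncomputable def epsK (S : Symm (nw + 1)) (P : Symm nx) (s : ℝ) : ℝ :=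
  1 / sys.muR * ((1 + s) * sys.epsP S P s * sys.kappaK S P + s * sys.etaK S P)

end LQRSystem

/-! The central object is the dynamic programming operator `V ↦ stepValue A B Q R (S ⊗ₖ V)`, the
minimum over the input of stage cost plus expected cost-to-go. A Riccati solution is a fixed point
of it (`IsRiccatiSolution.stepValue_eq`), and value iteration converges to that fixed point from
every positive semidefinite start (`tendsto_valueIteration`).

Riccati perturbation (`norm_riccati_sub_le`). Let `Y` solve `Y - Lᵀ(S ⊗ Y)L = 1`; it is positive
because the optimal closed loop contracts `P`. Value iteration for the perturbed covariance, started
at `P`, never leaves the order interval `P ± η ε Y`, where `η = etaLyap`. Indeed, an error `X` in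
this interval produces a first-order term `Lᵀ(S ⊗ X)L`, which lies within `± η ε (Y - 1)`. The
margin `η ε · 1` so gained pays for the quadratic remainder `kappaS · ε²` and for the covariance
error `δ (etaA + kappaA · ε)`. `epsP` is the smaller root of the equation saying that the payment is
exact. In the limit, `‖P' - P‖ ≤ ε`. Comparing the stationarity conditions of the two gains turns
this into the bound `epsK` on the gain error `D` (`norm_stepGain_sub_le`).

Stability. Second moments of the closed loop evolve by the operator built on the block transpose of
`𝐀 + 𝐁K` (`momentMatrix_closedLoop_succ`). Let now `Y` solve the adjoint Lyapunov equation with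
right-hand side `1`, and put `η = etaLyapAdj`, `π = 2 · etaLBAdj · ε + kappaBAdj · ε²` with `ε =
epsK`. Changing the gain by `D` costs at most `π ‖Y‖`, and `η ‖Y‖ ≤ 1`, so `Y` still decreases by
`(1 - π/η) · 1` (`exists_adjoint_certificate`). The stability condition says that `π < η`. Hence the
moments decay geometrically and their sum has norm at most `‖x₀‖² / (η - π)`.

Cost. Completing the square telescopes the expected cost into `x₀ᵀ P x₀` plus the summed deviations
from the optimal feedback, minus a terminal term (`sum_integral_stage_eq`). For arbitrary inputs of
finite cost the terminal term vanishes in the limit, so `x₀ᵀ P x₀` bounds the optimal cost below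
(`le_totalCost`). For the empirical controller the deviations form the trace of `Dᵀ (R + G(P)) D`
against the summed moments (`feedbackCost_le`). -/

/-! ### Quadratic forms and spectral norms -/

/-- The quadratic form `vᵀ M v`. -/
def qf {n : Type*} [Fintype n] (M : Matrix n n ℝ) (v : n → ℝ) : ℝ := v ⬝ᵥ M *ᵥ v

/-- The Euclidean norm of a vector. -/
noncomputable def enorm₂ {n : Type*} [Fintype n] (v : n → ℝ) : ℝ := ‖WithLp.toLp 2 v‖

section QuadraticForm

variable {n m : Type*} [Fintype n] [Fintype m]

@[simp] lemma qf_zero_left (v : n → ℝ) : qf (0 : Matrix n n ℝ) v = 0 := by simp [qf]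

lemma qf_add (M N : Matrix n n ℝ) (v : n → ℝ) : qf (M + N) v = qf M v + qf N v := by
  simp [qf, Matrix.add_mulVec, dotProduct_add]

lemma qf_sub (M N : Matrix n n ℝ) (v : n → ℝ) : qf (M - N) v = qf M v - qf N v := by
  simp [qf, Matrix.sub_mulVec, dotProduct_sub]

lemma qf_neg (M : Matrix n n ℝ) (v : n → ℝ) : qf (-M) v = -qf M v := by
  simp [qf, Matrix.neg_mulVec]

lemma qf_smul (c : ℝ) (M : Matrix n n ℝ) (v : n → ℝ) : qf (c • M) v = c * qf M v := by
  simp [qf, Matrix.smul_mulVec]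

lemma qf_one [DecidableEq n] (v : n → ℝ) : qf (1 : Matrix n n ℝ) v = v ⬝ᵥ v := by simp [qf]

lemma dotProduct_transpose_mul_mulVec (C : Matrix m n ℝ) (x : n → ℝ) (z : m → ℝ) :
    x ⬝ᵥ Cᵀ *ᵥ z = (C *ᵥ x) ⬝ᵥ z := by
  rw [Matrix.dotProduct_mulVec, Matrix.vecMul_transpose]

lemma qf_congr (M : Matrix m m ℝ) (C : Matrix m n ℝ) (v : n → ℝ) :
    qf (Cᵀ * M * C) v = qf M (C *ᵥ v) := by
  rw [qf, ← Matrix.mulVec_mulVec, ← Matrix.mulVec_mulVec, dotProduct_transpose_mul_mulVec, qf]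

lemma dotProduct_mulVec_comm {M : Matrix n n ℝ} (hM : Mᵀ = M) (x y : n → ℝ) :
    x ⬝ᵥ M *ᵥ y = y ⬝ᵥ M *ᵥ x := by
  rw [Matrix.dotProduct_mulVec, ← Matrix.mulVec_transpose, hM, dotProduct_comm]

lemma qf_add_vec {M : Matrix n n ℝ} (hM : Mᵀ = M) (x y : n → ℝ) :
    qf M (x + y) = qf M x + 2 * (x ⬝ᵥ M *ᵥ y) + qf M y := by
  simp only [qf, Matrix.mulVec_add, add_dotProduct, dotProduct_add, dotProduct_mulVec_comm hM y x]
  ring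

lemma qf_sub_vec {M : Matrix n n ℝ} (hM : Mᵀ = M) (x y : n → ℝ) :
    qf M (x - y) = qf M x - 2 * (x ⬝ᵥ M *ᵥ y) + qf M y := by
  simp only [qf, Matrix.mulVec_sub, sub_dotProduct, dotProduct_sub, dotProduct_mulVec_comm hM y x]
  ring

omit [Fintype n] in
lemma Matrix.PosSemidef.transpose_eq {M : Matrix n n ℝ} (hM : M.PosSemidef) : Mᵀ = M := by
  rw [← Matrix.conjTranspose_eq_transpose_of_trivial]
  exact hM.isHermitian

lemma Matrix.PosSemidef.qf_nonneg {M : Matrix n n ℝ} (hM : M.PosSemidef) (v : n → ℝ) :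
    0 ≤ qf M v := by
  simpa [qf] using hM.dotProduct_mulVec_nonneg v

lemma Matrix.PosSemidef.of_qf {M : Matrix n n ℝ} (hM : Mᵀ = M) (h : ∀ v, 0 ≤ qf M v) :
    M.PosSemidef :=
  .of_dotProduct_mulVec_nonneg (by simpa [Matrix.IsHermitian] using hM)
    fun v => by simpa [qf] using h v

lemma enorm₂_nonneg (v : n → ℝ) : 0 ≤ enorm₂ v := norm_nonneg _

lemma enorm₂_sq (v : n → ℝ) : enorm₂ v ^ 2 = v ⬝ᵥ v := by
  rw [enorm₂, EuclideanSpace.norm_sq_eq]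
  simp [dotProduct, sq]

lemma dotProduct_le_enorm₂ (x y : n → ℝ) : |x ⬝ᵥ y| ≤ enorm₂ x * enorm₂ y := by
  have := abs_real_inner_le_norm (WithLp.toLp 2 x) (WithLp.toLp 2 y)
  simpa [enorm₂, PiLp.inner_apply, dotProduct, mul_comm] using this

lemma enorm₂_mulVec_le [DecidableEq n] (M : Matrix m n ℝ) (v : n → ℝ) :
    enorm₂ (M *ᵥ v) ≤ ‖M‖ * enorm₂ v :=
  Matrix.l2_opNorm_mulVec M (WithLp.toLp 2 v)

lemma norm_le_of_enorm₂ [DecidableEq n] {M : Matrix m n ℝ} {c : ℝ} (hc : 0 ≤ c)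
    (h : ∀ v, enorm₂ (M *ᵥ v) ≤ c * enorm₂ v) : ‖M‖ ≤ c := by
  rw [Matrix.l2_opNorm_def]
  exact ContinuousLinearMap.opNorm_le_bound _ hc fun x => h x.ofLp

lemma abs_qf_le [DecidableEq n] (M : Matrix n n ℝ) (v : n → ℝ) : |qf M v| ≤ ‖M‖ * enorm₂ v ^ 2 := by
  have h1 := dotProduct_le_enorm₂ v (M *ᵥ v)
  have h2 := enorm₂_mulVec_le M v
  have h3 := enorm₂_nonneg v
  rw [qf]
  nlinarith [mul_le_mul_of_nonneg_left h2 h3]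

lemma qf_le [DecidableEq n] (M : Matrix n n ℝ) (v : n → ℝ) : qf M v ≤ ‖M‖ * enorm₂ v ^ 2 :=
  (le_abs_self _).trans (abs_qf_le M v)

/-- Polarization bounds `2 xᵀ M y` by `c (|x|² + |y|²)`; testing with `x` parallel to `M y` and of
the length of `y` gives the operator bound. -/
lemma norm_le_of_abs_qf [DecidableEq n] {M : Matrix n n ℝ} (hM : Mᵀ = M) {c : ℝ} (hc : 0 ≤ c)
    (h : ∀ v, |qf M v| ≤ c * enorm₂ v ^ 2) : ‖M‖ ≤ c := by
  have key : ∀ x y : n → ℝ, 2 * (x ⬝ᵥ M *ᵥ y) ≤ c * (enorm₂ x ^ 2 + enorm₂ y ^ 2) := fun x y => by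
    have h1 := (abs_le.1 (h (x + y))).2
    have h2 := (abs_le.1 (h (x - y))).1
    rw [qf_add_vec hM, enorm₂_sq] at h1
    rw [qf_sub_vec hM, enorm₂_sq] at h2
    rw [enorm₂_sq, enorm₂_sq]
    simp only [add_dotProduct, dotProduct_add, sub_dotProduct, dotProduct_sub,
      dotProduct_comm y x] at h1 h2
    nlinarith
  refine norm_le_of_enorm₂ hc fun y => ?_
  set a := enorm₂ (M *ᵥ y) with ha
  set b := enorm₂ y with hb
  have ha0 : 0 ≤ a := enorm₂_nonneg _
  have hb0 : 0 ≤ b := enorm₂_nonneg _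
  by_contra! hlt
  have hapos : 0 < a := lt_of_le_of_lt (by positivity) hlt
  -- The factor `b / a` gives the test vector length `b`, so the estimate becomes `2 a b ≤ 2 c b²`.
  have h1 := key ((b / a) • (M *ᵥ y)) y
  rw [smul_dotProduct, ← enorm₂_sq (M *ᵥ y), ← ha, ← hb, smul_eq_mul] at h1
  have h2 : enorm₂ ((b / a) • (M *ᵥ y)) ^ 2 = b ^ 2 := by
    rw [enorm₂_sq, smul_dotProduct, dotProduct_smul, ← enorm₂_sq, ← ha, smul_eq_mul, smul_eq_mul]
    field_simp
  rw [h2] at h1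
  have h3 : b / a * a ^ 2 = a * b := by field_simp
  rw [h3] at h1
  rcases hb0.eq_or_lt with h0 | h0
  · have hy : y = 0 := by
      have := enorm₂_sq y
      rw [← hb, ← h0] at this
      exact dotProduct_self_eq_zero.1 (by linarith)
    rw [ha, hy, Matrix.mulVec_zero] at hapos
    simp [enorm₂] at hapos
  · nlinarith

lemma eq_zero_of_qf {M : Matrix n n ℝ} (hM : Mᵀ = M) (h : ∀ v, qf M v = 0) : M = 0 := by
  classical
  have : ‖M‖ ≤ 0 := norm_le_of_abs_qf hM le_rfl fun v => by simp [h v]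
  exact norm_eq_zero.1 (le_antisymm this (norm_nonneg _))

lemma norm_transpose_eq [DecidableEq n] [DecidableEq m] (M : Matrix m n ℝ) : ‖Mᵀ‖ = ‖M‖ := by
  rw [← Matrix.conjTranspose_eq_transpose_of_trivial, Matrix.l2_opNorm_conjTranspose]

lemma norm_one_matrix_le [DecidableEq n] : ‖(1 : Matrix n n ℝ)‖ ≤ 1 :=
  norm_le_of_enorm₂ zero_le_one fun v => by simp

lemma enorm₂_sq_prod (z : n × m → ℝ) :
    enorm₂ z ^ 2 = ∑ j, enorm₂ (fun i => z (i, j)) ^ 2 := by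
  simp only [enorm₂_sq, dotProduct]
  rw [Fintype.sum_prod_type, Finset.sum_comm]

lemma enorm₂_sq_prod' (z : n × m → ℝ) :
    enorm₂ z ^ 2 = ∑ i, enorm₂ (fun j => z (i, j)) ^ 2 := by
  simp only [enorm₂_sq, dotProduct]
  rw [Fintype.sum_prod_type]

lemma norm_le_of_enorm₂_sq [DecidableEq n] {M : Matrix m n ℝ} {c : ℝ} (hc : 0 ≤ c)
    (h : ∀ v, enorm₂ (M *ᵥ v) ^ 2 ≤ c ^ 2 * enorm₂ v ^ 2) : ‖M‖ ≤ c :=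
  norm_le_of_enorm₂ hc fun v => by
    have := h v
    rw [← mul_pow] at this
    exact (pow_le_pow_iff_left₀ (enorm₂_nonneg _) (mul_nonneg hc (enorm₂_nonneg _)) two_ne_zero).1
      this

/-! ### Norms of Kronecker products -/

lemma norm_kronecker_one_le {p : Type*} [Fintype p] [DecidableEq n] [DecidableEq p]
    (S : Matrix m n ℝ) : ‖S ⊗ₖ (1 : Matrix p p ℝ)‖ ≤ ‖S‖ := by
  refine norm_le_of_enorm₂_sq (norm_nonneg _) fun z => ?_
  rw [enorm₂_sq_prod, enorm₂_sq_prod, Finset.mul_sum]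
  refine Finset.sum_le_sum fun j _ => ?_
  have h : (fun i => ((S ⊗ₖ (1 : Matrix p p ℝ)) *ᵥ z) (i, j)) = S *ᵥ fun i => z (i, j) := by
    ext i
    simp [Matrix.mulVec, dotProduct, Fintype.sum_prod_type, Matrix.one_apply]
  rw [h, ← mul_pow]
  exact pow_le_pow_left₀ (enorm₂_nonneg _) (enorm₂_mulVec_le _ _) 2

lemma norm_one_kronecker_le {p : Type*} [Fintype p] [DecidableEq n] [DecidableEq p]
    (X : Matrix m n ℝ) : ‖(1 : Matrix p p ℝ) ⊗ₖ X‖ ≤ ‖X‖ := by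
  refine norm_le_of_enorm₂_sq (norm_nonneg _) fun z => ?_
  rw [enorm₂_sq_prod', enorm₂_sq_prod', Finset.mul_sum]
  refine Finset.sum_le_sum fun j _ => ?_
  have h : (fun i => (((1 : Matrix p p ℝ) ⊗ₖ X) *ᵥ z) (j, i)) = X *ᵥ fun i => z (j, i) := by
    ext i
    simp [Matrix.mulVec, dotProduct, Fintype.sum_prod_type, Matrix.one_apply, ite_mul,
      Finset.sum_ite_irrel]
  rw [h, ← mul_pow]
  exact pow_le_pow_left₀ (enorm₂_nonneg _) (enorm₂_mulVec_le _ _) 2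

/-- Factor through `S ⊗ 1` and `1 ⊗ X`, each of which acts slice by slice on a vector indexed by
pairs. -/
lemma norm_kronecker_le [DecidableEq n] [DecidableEq m] (S : Matrix m m ℝ) (X : Matrix n n ℝ) :
    ‖S ⊗ₖ X‖ ≤ ‖S‖ * ‖X‖ := by
  have h : S ⊗ₖ X = (S ⊗ₖ (1 : Matrix n n ℝ)) * ((1 : Matrix m m ℝ) ⊗ₖ X) := by
    rw [← Matrix.mul_kronecker_mul, Matrix.mul_one, Matrix.one_mul]
  rw [h]
  exact (Matrix.l2_opNorm_mul _ _).trans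
    (mul_le_mul (norm_kronecker_one_le _) (norm_one_kronecker_le _) (norm_nonneg _) (norm_nonneg _))

lemma norm_trace_le [DecidableEq n] (C : Matrix n n ℝ) : C.trace ≤ Fintype.card n * ‖C‖ := by
  have h : ∀ i, C i i ≤ ‖C‖ := fun i => by
    have := qf_le C (Pi.single i 1)
    simpa [qf, enorm₂_sq] using this
  calc C.trace = ∑ i, C i i := rfl
    _ ≤ ∑ _i : n, ‖C‖ := Finset.sum_le_sum fun i _ => h i
    _ = _ := by simp

/-! ### Smallest eigenvalues and positive definite forms -/

lemma sInf_spectrum_nonneg [DecidableEq n] {M : Matrix n n ℝ} (hM : M.PosDef) :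
    0 ≤ sInf (spectrum ℝ M) := by
  rw [hM.isHermitian.spectrum_real_eq_range_eigenvalues]
  refine Real.sInf_nonneg ?_
  rintro _ ⟨i, rfl⟩
  exact (hM.eigenvalues_pos i).le

lemma sInf_spectrum_pos [DecidableEq n] [Nonempty n] {M : Matrix n n ℝ} (hM : M.PosDef) :
    0 < sInf (spectrum ℝ M) := by
  rw [hM.isHermitian.spectrum_real_eq_range_eigenvalues]
  obtain ⟨i, hi⟩ := (Set.range_nonempty hM.isHermitian.eigenvalues).csInf_mem (Set.finite_range _)
  rw [← hi]
  exact hM.eigenvalues_pos i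

lemma sInf_spectrum_mul_le_qf [DecidableEq n] {M : Matrix n n ℝ} (hM : M.IsHermitian)
    (v : n → ℝ) : sInf (spectrum ℝ M) * enorm₂ v ^ 2 ≤ qf M v := by
  set c := sInf (spectrum ℝ M)
  have hMc : (M - c • (1 : Matrix n n ℝ)).PosSemidef := by
    rw [Matrix.posSemidef_iff_isHermitian_and_spectrum_nonneg]
    refine ⟨hM.sub (by simp [Matrix.IsHermitian]), fun x hx => ?_⟩
    have hx' : x + c ∈ spectrum ℝ M := by
      have := spectrum.add_mem_add_iff (a := M - c • (1 : Matrix n n ℝ)) (r := x) (s := c)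
      rw [Algebra.algebraMap_eq_smul_one, add_sub_cancel] at this
      rw [add_comm]
      rwa [add_comm, this]
    have hb : BddBelow (spectrum ℝ M) := by
      rw [hM.spectrum_real_eq_range_eigenvalues]
      exact (Set.finite_range _).bddBelow
    have := csInf_le hb hx'
    show (0 : ℝ) ≤ x
    change c ≤ x + c at this
    linarith
  have := hMc.qf_nonneg v
  rw [qf_sub, qf_smul, qf_one, ← enorm₂_sq] at this
  linarith

lemma exists_pos_mul_le_qf {M : Matrix n n ℝ} (hM : M.PosDef) :
    ∃ c, 0 < c ∧ c ≤ 1 ∧ ∀ v, c * enorm₂ v ^ 2 ≤ qf M v := by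
  classical
  rcases isEmpty_or_nonempty n with h | h
  · exact ⟨1, one_pos, le_rfl, fun v => by simp [qf, enorm₂_sq, dotProduct]⟩
  · refine ⟨min 1 (sInf (spectrum ℝ M)), lt_min one_pos (sInf_spectrum_pos hM), min_le_left _ _,
      fun v => (mul_le_mul_of_nonneg_right (min_le_right _ _) (sq_nonneg _)).trans
        (sInf_spectrum_mul_le_qf hM.isHermitian v)⟩

end QuadraticForm

/-! ### The one-step dynamic programming problem

The cost-to-go matrix `M` acts on the stacked successor state `A v + B u`. -/

section OneStep

variable {ι n u : Type*} [Fintype ι] [Fintype n] [Fintype u] [DecidableEq u]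

/-- The minimizer `u = K v` of `vᵀ Q v + uᵀ R u + (A v + B u)ᵀ M (A v + B u)`. -/
noncomputable def stepGain (A : Matrix ι n ℝ) (B : Matrix ι u ℝ) (R : Matrix u u ℝ)
    (M : Matrix ι ι ℝ) : Matrix u n ℝ :=
  -((R + Bᵀ * M * B)⁻¹ * (Bᵀ * M * A))

/-- The matrix of the minimum of `vᵀ Q v + uᵀ R u + (A v + B u)ᵀ M (A v + B u)` over `u`. -/
noncomputable def stepValue (A : Matrix ι n ℝ) (B : Matrix ι u ℝ) (Q : Matrix n n ℝ)
    (R : Matrix u u ℝ) (M : Matrix ι ι ℝ) : Matrix n n ℝ :=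
  Q + Aᵀ * M * A - (Bᵀ * M * A)ᵀ * (R + Bᵀ * M * B)⁻¹ * (Bᵀ * M * A)

variable {A : Matrix ι n ℝ} {B : Matrix ι u ℝ} {Q : Matrix n n ℝ} {R : Matrix u u ℝ}
  {M M' : Matrix ι ι ℝ}

omit [DecidableEq u] in
lemma posDef_add_congr (hR : R.PosDef) (hM : M.PosSemidef) : (R + Bᵀ * M * B).PosDef := by
  refine hR.add_posSemidef ?_
  simpa using hM.conjTranspose_mul_mul_same B

omit [Fintype n] in
lemma mul_stepGain (hR : R.PosDef) (hM : M.PosSemidef) :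
    (R + Bᵀ * M * B) * stepGain A B R M = -(Bᵀ * M * A) := by
  have hN := posDef_add_congr (B := B) hR hM
  rw [stepGain, Matrix.mul_neg, Matrix.mul_nonsing_inv_cancel_left _ _
    ((Matrix.isUnit_iff_isUnit_det _).1 hN.isUnit)]

/-- The first-order optimality condition. It expresses `R K` without an inverse, which is what
comparisons of two gains need. -/
lemma stepGain_stationary (hR : R.PosDef) (hM : M.PosSemidef) :
    R * stepGain A B R M + Bᵀ * M * (A + B * stepGain A B R M) = 0 := by
  have h := mul_stepGain (A := A) (B := B) hR hM
  rw [Matrix.add_mul] at h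
  rw [Matrix.mul_add, ← Matrix.mul_assoc (Bᵀ * M) B, add_left_comm, h, add_neg_cancel]

omit [Fintype n] in
lemma transpose_stepValue (hQ : Qᵀ = Q) (hR : R.PosDef) (hM : M.PosSemidef) :
    (stepValue A B Q R M)ᵀ = stepValue A B Q R M := by
  simp only [stepValue, Matrix.transpose_sub, Matrix.transpose_add, Matrix.transpose_mul,
    Matrix.transpose_transpose, hQ, hM.transpose_eq, Matrix.transpose_nonsing_inv,
    hR.posSemidef.transpose_eq,
    Matrix.mul_assoc]

/-- Completion of the square in `w` around the minimizer: `N K v = -h` cancels the terms linear in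
`w`. The remainder is the exact price of a deviation from the optimal input. -/
lemma step_completion (hR : R.PosDef) (hM : M.PosSemidef) (v : n → ℝ) (w : u → ℝ) :
    qf Q v + qf R w + qf M (A *ᵥ v + B *ᵥ w) =
      qf (stepValue A B Q R M) v + qf (R + Bᵀ * M * B) (w - stepGain A B R M *ᵥ v) := by
  have hN := posDef_add_congr (B := B) hR hM
  set N := R + Bᵀ * M * B with hNdef
  set K := stepGain A B R M with hK
  set h := (Bᵀ * M * A) *ᵥ v with hh
  have hNK : N *ᵥ (K *ᵥ v) = -h := by
    rw [Matrix.mulVec_mulVec, hK, hNdef, mul_stepGain hR hM, Matrix.neg_mulVec]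
  have hKv : K *ᵥ v = -(N⁻¹ *ᵥ h) := by
    rw [hK, stepGain, Matrix.neg_mulVec, ← Matrix.mulVec_mulVec]
  have h1 : qf (stepValue A B Q R M) v = qf Q v + qf M (A *ᵥ v) - h ⬝ᵥ N⁻¹ *ᵥ h := by
    rw [stepValue, qf_sub, qf_add, qf_congr, qf_congr]
    rfl
  have h2 : qf N w = qf R w + qf M (B *ᵥ w) := by rw [hNdef, qf_add, qf_congr]
  have h3 : (A *ᵥ v) ⬝ᵥ M *ᵥ (B *ᵥ w) = w ⬝ᵥ h := by
    rw [dotProduct_mulVec_comm hM.transpose_eq, hh, ← dotProduct_transpose_mul_mulVec]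
    simp [Matrix.mulVec_mulVec, Matrix.mul_assoc]
  rw [qf_add_vec hM.transpose_eq, qf_sub_vec hN.posSemidef.transpose_eq, h1, h2, h3, hNK,
    qf, qf, qf, qf, qf, hNK, hKv]
  simp only [dotProduct_neg, neg_dotProduct, dotProduct_comm h]
  ring

lemma stepValue_le (hR : R.PosDef) (hM : M.PosSemidef) (v : n → ℝ) (w : u → ℝ) :
    qf (stepValue A B Q R M) v ≤ qf Q v + qf R w + qf M (A *ᵥ v + B *ᵥ w) := by
  rw [step_completion hR hM]
  linarith [(posDef_add_congr (B := B) hR hM).posSemidef.qf_nonneg (w - stepGain A B R M *ᵥ v)]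

lemma exists_stepValue_eq (Q : Matrix n n ℝ) (hR : R.PosDef) (hM : M.PosSemidef) (v : n → ℝ) :
    ∃ w, qf (stepValue A B Q R M) v = qf Q v + qf R w + qf M (A *ᵥ v + B *ᵥ w) :=
  ⟨stepGain A B R M *ᵥ v, by rw [step_completion hR hM, sub_self]; simp [qf]⟩

lemma le_stepValue (hR : R.PosDef) (hM : M.PosSemidef) (v : n → ℝ) :
    qf Q v ≤ qf (stepValue A B Q R M) v := by
  obtain ⟨w, hw⟩ := exists_stepValue_eq (A := A) (B := B) Q hR hM v
  linarith [hR.posSemidef.qf_nonneg w, hM.qf_nonneg (A *ᵥ v + B *ᵥ w)]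

lemma stepValue_le_congr (hR : R.PosDef) (hM : M.PosSemidef) (v : n → ℝ) :
    qf (stepValue A B Q R M) v ≤ qf Q v + qf M (A *ᵥ v) := by
  have := stepValue_le (A := A) (B := B) (Q := Q) hR hM v 0
  simpa [qf] using this

lemma stepValue_mono (hR : R.PosDef) (hM : M.PosSemidef) (hM' : M'.PosSemidef)
    (h : ∀ z, qf M z ≤ qf M' z) (v : n → ℝ) :
    qf (stepValue A B Q R M) v ≤ qf (stepValue A B Q R M') v := by
  obtain ⟨w, hw⟩ := exists_stepValue_eq (A := A) (B := B) Q hR hM' v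
  have := stepValue_le (A := A) (B := B) (Q := Q) hR hM v w
  linarith [h (A *ᵥ v + B *ᵥ w)]

/-- The minimizer for `M` is a competitor for `c • M`, and enlarging its input cost by the factor `c
≥ 1` only weakens the bound. -/
lemma stepValue_smul_le (hR : R.PosDef) (hM : M.PosSemidef) {c : ℝ} (hc : 1 ≤ c) (v : n → ℝ) :
    qf (stepValue A B Q R (c • M)) v ≤
      qf Q v + c * (qf (stepValue A B Q R M) v - qf Q v) := by
  obtain ⟨w, hw⟩ := exists_stepValue_eq (A := A) (B := B) Q hR hM v
  have := stepValue_le (A := A) (B := B) (Q := Q) hR (hM.smul (by linarith : (0 : ℝ) ≤ c)) v w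
  rw [qf_smul] at this
  nlinarith [hR.posSemidef.qf_nonneg w]

lemma le_stepValue_smul (hR : R.PosDef) (hM : M.PosSemidef) {c : ℝ} (hc : 0 ≤ c) (hc1 : c ≤ 1)
    (v : n → ℝ) :
    qf Q v + c * (qf (stepValue A B Q R M) v - qf Q v) ≤
      qf (stepValue A B Q R (c • M)) v := by
  obtain ⟨w, hw⟩ := exists_stepValue_eq (A := A) (B := B) Q hR (hM.smul hc) v
  have := stepValue_le (A := A) (B := B) (Q := Q) hR hM v w
  rw [qf_smul] at hw
  have h2 := mul_le_mul_of_nonneg_left this hc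
  nlinarith [hR.posSemidef.qf_nonneg w]

/-- A relative perturbation of `M` perturbs the value at most by the same multiple of `Aᵀ M A`. -/
lemma abs_stepValue_sub_le (hR : R.PosDef) (hM : M.PosSemidef) (hM' : M'.PosSemidef)
    {lb ub : ℝ} (hlb : -1 ≤ lb) (hlb0 : lb ≤ 0) (hub : 0 ≤ ub)
    (hl : ∀ z, (1 + lb) * qf M z ≤ qf M' z) (hu : ∀ z, qf M' z ≤ (1 + ub) * qf M z) (v : n → ℝ) :
    |qf (stepValue A B Q R M') v - qf (stepValue A B Q R M) v| ≤
      max |lb| |ub| * qf M (A *ᵥ v) := by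
  have hl0 : (0 : ℝ) ≤ 1 + lb := by linarith
  have hu0 : (0 : ℝ) ≤ 1 + ub := by linarith
  have h1 := stepValue_mono (A := A) (B := B) (Q := Q) hR (hM.smul hl0) hM'
    (fun z => by rw [qf_smul]; exact hl z) v
  have h2 := stepValue_mono (A := A) (B := B) (Q := Q) hR hM' (hM.smul hu0)
    (fun z => by rw [qf_smul]; exact hu z) v
  have h3 := stepValue_smul_le (A := A) (B := B) (Q := Q) hR hM (by linarith : 1 ≤ 1 + ub) v
  have h4 := le_stepValue_smul (A := A) (B := B) (Q := Q) hR hM hl0 (by linarith) v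
  have h5 := stepValue_le_congr (A := A) (B := B) (Q := Q) hR hM v
  have h6 := le_stepValue (A := A) (B := B) (Q := Q) hR hM v
  have h7 := hM.qf_nonneg (A *ᵥ v)
  have h8 : -lb ≤ max |lb| |ub| := (neg_le_abs lb).trans (le_max_left _ _)
  have h9 : ub ≤ max |lb| |ub| := (le_abs_self ub).trans (le_max_right _ _)
  rw [abs_le]
  constructor <;> nlinarith

/-- The old gain is a competitor for the new problem: as a minimum of functions affine in `M`, the
value lies below its tangent. -/
lemma stepValue_le_add (hR : R.PosDef) (hM : M.PosSemidef) (hM' : M'.PosSemidef) (v : n → ℝ) :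
    qf (stepValue A B Q R M') v ≤
      qf (stepValue A B Q R M) v + qf (M' - M) ((A + B * stepGain A B R M) *ᵥ v) := by
  have h1 := stepValue_le (A := A) (B := B) (Q := Q) hR hM' v (stepGain A B R M *ᵥ v)
  have h2 := step_completion (A := A) (B := B) (Q := Q) hR hM v (stepGain A B R M *ᵥ v)
  have h3 : (A + B * stepGain A B R M) *ᵥ v = A *ᵥ v + B *ᵥ (stepGain A B R M *ᵥ v) := by
    rw [Matrix.add_mulVec, Matrix.mulVec_mulVec]
  rw [sub_self, show qf (R + Bᵀ * M * B) (0 : u → ℝ) = 0 by simp [qf]] at h2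
  rw [h3, qf_sub]
  linarith

/-- Expand `0 ≤ qf R (d - R⁻¹ e)` and use `qf R d ≤ qf N d = d ⬝ᵥ e`; this is `N⁻¹ ≤ R⁻¹` without
inverting `N`. -/
lemma qf_le_inv_of_mulVec_eq {N : Matrix u u ℝ} (hR : R.PosDef) (h : ∀ z, qf R z ≤ qf N z)
    {d e : u → ℝ} (hd : N *ᵥ d = e) : qf N d ≤ qf R⁻¹ e := by
  set f := R⁻¹ *ᵥ e with hf
  have hRf : R *ᵥ f = e := by
    rw [hf, Matrix.mulVec_mulVec, Matrix.mul_nonsing_inv _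
      ((Matrix.isUnit_iff_isUnit_det _).1 hR.isUnit), Matrix.one_mulVec]
  have h1 := hR.posSemidef.qf_nonneg (d - f)
  rw [qf_sub_vec hR.posSemidef.transpose_eq, hRf] at h1
  have h2 := h d
  have h3 : qf R f = qf R⁻¹ e := by rw [qf, hRf, qf, dotProduct_comm]
  have h4 : qf N d = d ⬝ᵥ e := by rw [qf, hd]
  linarith

/-- The gap to the tangent is the price, in the new problem, of keeping the old gain. The gain
difference solves a linear system with right-hand side `Bᵀ (M' - M) L v`, so the gap is quadratic in
`M' - M`, and bounding `N⁻¹` by `R⁻¹` makes its constant independent of `M'`. -/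
lemma le_stepValue_add (hR : R.PosDef) (hM : M.PosSemidef) (hM' : M'.PosSemidef) (v : n → ℝ) :
    qf (stepValue A B Q R M) v + qf (M' - M) ((A + B * stepGain A B R M) *ᵥ v) -
        qf (B * R⁻¹ * Bᵀ) ((M' - M) *ᵥ ((A + B * stepGain A B R M) *ᵥ v)) ≤
      qf (stepValue A B Q R M') v := by
  set K := stepGain A B R M with hK
  set L := A + B * K with hL
  have h1 := step_completion (A := A) (B := B) (Q := Q) hR hM' v (K *ᵥ v)
  have h2 := step_completion (A := A) (B := B) (Q := Q) hR hM v (K *ᵥ v)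
  have h3 : L *ᵥ v = A *ᵥ v + B *ᵥ (K *ᵥ v) := by
    rw [hL, Matrix.add_mulVec, Matrix.mulVec_mulVec]
  rw [sub_self, show qf (R + Bᵀ * M * B) (0 : u → ℝ) = 0 by simp [qf]] at h2
  have h4 : (R + Bᵀ * M' * B) *ᵥ (K *ᵥ v - stepGain A B R M' *ᵥ v) =
      Bᵀ *ᵥ ((M' - M) *ᵥ (L *ᵥ v)) := by
    rw [Matrix.mulVec_sub, Matrix.mulVec_mulVec, Matrix.mulVec_mulVec, mul_stepGain hR hM',
      Matrix.mulVec_mulVec, Matrix.mulVec_mulVec, ← Matrix.sub_mulVec]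
    congr 1
    have h5 := stepGain_stationary (A := A) (B := B) hR hM
    rw [← hK, ← hL] at h5
    have h6 : R * K = -(Bᵀ * M * L) := eq_neg_of_add_eq_zero_left h5
    rw [Matrix.add_mul, h6, Matrix.mul_sub, Matrix.sub_mul, hL]
    simp only [Matrix.mul_add, Matrix.mul_assoc]
    abel
  have h5 : qf (R + Bᵀ * M' * B) (K *ᵥ v - stepGain A B R M' *ᵥ v) ≤
      qf (B * R⁻¹ * Bᵀ) ((M' - M) *ᵥ (L *ᵥ v)) := by
    refine (qf_le_inv_of_mulVec_eq hR (fun z => ?_) h4).trans_eq ?_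
    · rw [qf_add, qf_congr]
      linarith [hM'.qf_nonneg (B *ᵥ z)]
    · rw [← qf_congr, Matrix.transpose_transpose]
  rw [h3] at h5
  rw [h3, qf_sub]
  linarith

end OneStep

/-! ### Symmetric matrices and positive operators -/

lemma kronecker_sub' {m n : Type*} (S : Matrix m m ℝ) (X Y : Matrix n n ℝ) :
    S ⊗ₖ (X - Y) = S ⊗ₖ X - S ⊗ₖ Y := by
  ext i j
  simp [mul_sub]

lemma sub_kronecker' {m n : Type*} (S T : Matrix m m ℝ) (X : Matrix n n ℝ) :
    (S - T) ⊗ₖ X = S ⊗ₖ X - T ⊗ₖ X := by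
  ext i j
  simp [sub_mul]

section Symmetric

variable {m p q n : ℕ}

lemma Symm.transpose_eq (X : Symm n) : X.1ᵀ = X.1 := by
  rw [← Matrix.conjTranspose_eq_transpose_of_trivial]
  exact selfAdjoint.mem_iff.1 X.2

lemma Symm.norm_coe (X : Symm n) : ‖X.1‖ = ‖X‖ := rfl

/-- A symmetric matrix as an element of `Symm n`. -/
def Symm.mk' (M : Matrix (Fin n) (Fin n) ℝ) (hM : Mᵀ = M) : Symm n :=
  ⟨M, by
    rw [selfAdjoint.mem_iff, Matrix.star_eq_conjTranspose,
      Matrix.conjTranspose_eq_transpose_of_trivial, hM]⟩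

@[simp] lemma Symm.coe_mk' (M : Matrix (Fin n) (Fin n) ℝ) (hM : Mᵀ = M) :
    (Symm.mk' M hM).1 = M := rfl

lemma Symm.coe_sub (X Y : Symm n) : (X - Y).1 = X.1 - Y.1 := rfl

lemma Symm.coe_add (X Y : Symm n) : (X + Y).1 = X.1 + Y.1 := rfl

lemma Symm.coe_smul (c : ℝ) (X : Symm n) : (c • X).1 = c • X.1 := rfl

lemma Symm.abs_qf_le (X : Symm n) (v : Fin n → ℝ) : |qf X.1 v| ≤ ‖X‖ * enorm₂ v ^ 2 :=
  _root_.abs_qf_le X.1 v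

lemma Symm.norm_le_of_abs_qf {X : Symm n} {c : ℝ} (hc : 0 ≤ c)
    (h : ∀ v, |qf X.1 v| ≤ c * enorm₂ v ^ 2) : ‖X‖ ≤ c :=
  _root_.norm_le_of_abs_qf X.transpose_eq hc h

lemma Symm.posSemidef {X : Symm n} (h : ∀ v, 0 ≤ qf X.1 v) : X.1.PosSemidef :=
  .of_qf X.transpose_eq h

lemma Symm.norm_one_le : ‖(1 : Symm n)‖ ≤ 1 := norm_one_matrix_le

lemma Symm.qf_one (v : Fin n → ℝ) : qf (1 : Symm n).1 v = enorm₂ v ^ 2 := by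
  rw [enorm₂_sq]; exact _root_.qf_one v

lemma kronCongr_coe (S : Symm m) (M : Matrix (Fin m × Fin p) (Fin q) ℝ) (X : Symm p) :
    (kronCongr S M X).1 = Mᵀ * (S.1 ⊗ₖ X.1) * M := rfl

lemma qf_kronCongr (S : Symm m) (M : Matrix (Fin m × Fin p) (Fin q) ℝ) (X : Symm p)
    (v : Fin q → ℝ) : qf (kronCongr S M X).1 v = qf (S.1 ⊗ₖ X.1) (M *ᵥ v) := by
  rw [kronCongr_coe, qf_congr]

lemma qf_kronecker_mono_right {S : Matrix (Fin m) (Fin m) ℝ} (hS : S.PosSemidef) {X Y : Symm p}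
    (h : ∀ v, qf X.1 v ≤ qf Y.1 v) (z : Fin m × Fin p → ℝ) :
    qf (S ⊗ₖ X.1) z ≤ qf (S ⊗ₖ Y.1) z := by
  have h1 : (Y - X).1.PosSemidef := Symm.posSemidef fun v => by
    rw [Symm.coe_sub, qf_sub]; linarith [h v]
  have h2 := (hS.kronecker h1).qf_nonneg z
  rw [Symm.coe_sub, kronecker_sub', qf_sub] at h2
  linarith

lemma qf_kronecker_mono_left {S T : Matrix (Fin m) (Fin m) ℝ} (hST : (T - S).PosSemidef)
    {X : Matrix (Fin p) (Fin p) ℝ} (hX : X.PosSemidef) (z : Fin m × Fin p → ℝ) :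
    qf (S ⊗ₖ X) z ≤ qf (T ⊗ₖ X) z := by
  have h2 := (hST.kronecker hX).qf_nonneg z
  rw [sub_kronecker', qf_sub] at h2
  linarith

lemma qf_kronCongr_mono {S : Symm m} (hS : S.1.PosSemidef)
    (M : Matrix (Fin m × Fin p) (Fin q) ℝ) {X Y : Symm p}
    (h : ∀ v, qf X.1 v ≤ qf Y.1 v) (v : Fin q → ℝ) :
    qf (kronCongr S M X).1 v ≤ qf (kronCongr S M Y).1 v := by
  rw [qf_kronCongr, qf_kronCongr]
  exact qf_kronecker_mono_right hS h _

/-- If a monotone operator strictly contracts a positive definite matrix, then `Λ X ≤ X` forces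
`0 ≤ X`. -/
lemma nonneg_of_apply_le {Λ : Symm n →L[ℝ] Symm n}
    (hΛ : ∀ X Y : Symm n, (∀ v, qf X.1 v ≤ qf Y.1 v) → ∀ v, qf (Λ X).1 v ≤ qf (Λ Y).1 v)
    {P : Symm n} {c r : ℝ} (hc : 0 < c) (hP : ∀ v, c * enorm₂ v ^ 2 ≤ qf P.1 v)
    (hr : 0 ≤ r) (hr1 : r < 1) (hΛP : ∀ v, qf (Λ P).1 v ≤ r * qf P.1 v)
    {X : Symm n} (hX : ∀ v, qf (Λ X).1 v ≤ qf X.1 v) (v : Fin n → ℝ) : 0 ≤ qf X.1 v := by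
  -- Applying `Λ` to a lower bound by a multiple of `P` shrinks that multiple by `r`, and `Λ X ≤ X`
  -- passes the improved bound back to `X`.
  have key : ∀ k : ℕ, ∀ v, -(‖X‖ / c * r ^ k) * qf P.1 v ≤ qf X.1 v := by
    intro k
    induction k with
    | zero =>
      intro v
      have h1 := (abs_le.1 (X.abs_qf_le v)).1
      have h2 := mul_le_mul_of_nonneg_left (hP v) (div_nonneg (norm_nonneg X) hc.le)
      have h3 : ‖X‖ / c * (c * enorm₂ v ^ 2) = ‖X‖ * enorm₂ v ^ 2 := by field_simp
      rw [pow_zero, mul_one]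
      linarith
    | succ k ih =>
      intro v
      have h1 := hΛ ((-(‖X‖ / c * r ^ k)) • P) X (fun v => by
        rw [Symm.coe_smul, qf_smul]; exact ih v) v
      rw [map_smul, Symm.coe_smul, qf_smul] at h1
      have h2 := mul_le_mul_of_nonneg_left (hΛP v)
        (by positivity : 0 ≤ ‖X‖ / c * r ^ k)
      have h3 := hX v
      rw [pow_succ]
      nlinarith
  have hlim : Tendsto (fun k : ℕ => -(‖X‖ / c * r ^ k) * qf P.1 v) atTop (𝓝 0) := by
    have := ((tendsto_pow_atTop_nhds_zero_of_lt_one hr hr1).const_mul (‖X‖ / c)).neg.mul_const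
      (qf P.1 v)
    simpa using this
  exact le_of_tendsto' hlim fun k => key k v

lemma isInvertible_of_injective {T : Symm n →L[ℝ] Symm n} (hT : Function.Injective T) :
    T.IsInvertible :=
  ⟨(LinearEquiv.ofInjectiveEndo T.toLinearMap hT).toContinuousLinearEquiv, by ext1 x; rfl⟩

/-- A kernel element satisfies `X = Λ X`, so positivity applies to both `X` and `-X`; in finite
dimension injectivity suffices. -/
lemma isInvertible_id_sub {Λ : Symm n →L[ℝ] Symm n}
    (hΛ : ∀ X Y : Symm n, (∀ v, qf X.1 v ≤ qf Y.1 v) → ∀ v, qf (Λ X).1 v ≤ qf (Λ Y).1 v)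
    {P : Symm n} {c r : ℝ} (hc : 0 < c) (hP : ∀ v, c * enorm₂ v ^ 2 ≤ qf P.1 v)
    (hr : 0 ≤ r) (hr1 : r < 1) (hΛP : ∀ v, qf (Λ P).1 v ≤ r * qf P.1 v) :
    (ContinuousLinearMap.id ℝ (Symm n) - Λ).IsInvertible := by
  refine isInvertible_of_injective ((injective_iff_map_eq_zero _).2 fun X hX => ?_)
  have hX' : X = Λ X := by simpa [sub_eq_zero] using hX
  have h1 := nonneg_of_apply_le hΛ hc hP hr hr1 hΛP (X := X) fun v => by rw [← hX']
  have h2 := nonneg_of_apply_le hΛ hc hP hr hr1 hΛP (X := -X) fun v => by rw [map_neg, ← hX']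
  refine Subtype.ext (eq_zero_of_qf X.transpose_eq fun v => le_antisymm ?_ (h1 v))
  have := h2 v
  rw [show (-X).1 = -X.1 from rfl, qf_neg] at this
  linarith

/-- The pairing `∑ X a b * Y a b`. -/
def frob (X Y : Matrix (Fin n) (Fin n) ℝ) : ℝ := ∑ a, ∑ b, X a b * Y a b

lemma frob_sub_left (X Y Z : Matrix (Fin n) (Fin n) ℝ) :
    frob (X - Y) Z = frob X Z - frob Y Z := by
  simp [frob, sub_mul, Finset.sum_sub_distrib]

lemma frob_sub_right (X Y Z : Matrix (Fin n) (Fin n) ℝ) :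
    frob X (Y - Z) = frob X Y - frob X Z := by
  simp [frob, mul_sub, Finset.sum_sub_distrib]

lemma frob_vecMulVec (X : Matrix (Fin n) (Fin n) ℝ) (v : Fin n → ℝ) :
    frob X (Matrix.vecMulVec v v) = qf X v := by
  simp only [frob, qf, dotProduct, Matrix.mulVec, Matrix.vecMulVec_apply, Finset.mul_sum]
  exact Finset.sum_congr rfl fun a _ => Finset.sum_congr rfl fun b _ => by ring

lemma frob_one_left (X : Matrix (Fin n) (Fin n) ℝ) : frob 1 X = X.trace := by
  simp [frob, Matrix.one_apply, Matrix.trace]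

lemma kronCongr_apply_apply (S : Symm m) (M : Matrix (Fin m × Fin p) (Fin q) ℝ) (X : Symm p)
    (c d : Fin q) : (kronCongr S M X).1 c d =
      ∑ i, ∑ j, ∑ a, ∑ b, S.1 i j * X.1 a b * M (i, a) c * M (j, b) d := by
  rw [kronCongr_coe]
  simp only [Matrix.mul_apply, Fintype.sum_prod_type, Matrix.transpose_apply,
    Matrix.kroneckerMap_apply, Finset.sum_mul]
  calc _ = ∑ j, ∑ i, ∑ b, ∑ a, M (i, a) c * (S.1 i j * X.1 a b) * M (j, b) d :=
        Finset.sum_congr rfl fun j _ => Finset.sum_comm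
    _ = ∑ i, ∑ j, ∑ b, ∑ a, M (i, a) c * (S.1 i j * X.1 a b) * M (j, b) d := Finset.sum_comm
    _ = _ := Finset.sum_congr rfl fun i _ => Finset.sum_congr rfl fun j _ => by
      rw [Finset.sum_comm]
      exact Finset.sum_congr rfl fun a _ => Finset.sum_congr rfl fun b _ => by ring

/-- Block transposition of `M` transposes the operator `X ↦ Mᵀ (S ⊗ X) M`. -/
lemma frob_kronCongr (S : Symm m) (M : Matrix (Fin m × Fin p) (Fin q) ℝ) (X : Symm p)
    (Y : Symm q) :
    frob Y.1 (kronCongr S M X).1 = frob (kronCongr S (blockTranspose M) Y).1 X.1 := by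
  simp only [frob, kronCongr_apply_apply, blockTranspose, Matrix.of_apply, Finset.mul_sum,
    Finset.sum_mul]
  -- Pure reordering of six finite sums: indices are bundled into product types so that whole groups
  -- can be exchanged.
  have hswap : ∀ f : Fin q → Fin q → Fin m → Fin m → Fin p → Fin p → ℝ,
      ∑ c, ∑ d, ∑ i, ∑ j, ∑ a, ∑ b, f c d i j a b =
        ∑ a, ∑ b, ∑ i, ∑ j, ∑ c, ∑ d, f c d i j a b := fun f => by
    have h1 : ∀ g : Fin q → Fin q → Fin m × Fin m × Fin p × Fin p → ℝ,
        ∑ c, ∑ d, ∑ x, g c d x = ∑ x, ∑ c, ∑ d, g c d x := fun g => by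
      rw [Finset.sum_comm]
      simp_rw [Finset.sum_comm (s := (Finset.univ : Finset (Fin q)))
        (t := (Finset.univ : Finset (Fin m × Fin m × Fin p × Fin p)))]
      exact Finset.sum_congr rfl fun _ _ => Finset.sum_comm
    have h2 := h1 fun c d x => f c d x.1 x.2.1 x.2.2.1 x.2.2.2
    simp only [Fintype.sum_prod_type] at h2
    rw [h2]
    have h3 : ∀ g : Fin m → Fin m → Fin p × Fin p → ℝ,
        ∑ i, ∑ j, ∑ x, g i j x = ∑ x, ∑ i, ∑ j, g i j x := fun g => by
      simp_rw [Finset.sum_comm (s := (Finset.univ : Finset (Fin m)))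
        (t := (Finset.univ : Finset (Fin p × Fin p)))]
    have h4 := h3 fun i j x => ∑ c, ∑ d, f c d i j x.1 x.2
    simp only [Fintype.sum_prod_type] at h4
    exact h4
  rw [hswap]
  refine Finset.sum_congr rfl fun a _ => Finset.sum_congr rfl fun b _ =>
    Finset.sum_congr rfl fun i _ => Finset.sum_congr rfl fun j _ =>
    Finset.sum_congr rfl fun c _ => Finset.sum_congr rfl fun d _ => by ring

end Symmetric

/-! ### Value iteration and the perturbation of the Riccati solution -/

section Riccati

/-- The constant `q` sets the rate in later contraction arguments: losing `Q` in one step means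
losing at least the fraction `q` of `P`. The `+ 1` in the witness covers `P = 0`. -/
lemma exists_pos_mul_qf_le {n : Type*} [Fintype n] {Q : Matrix n n ℝ} (hQ : Q.PosDef)
    (P : Matrix n n ℝ) : ∃ q, 0 < q ∧ q ≤ 1 ∧ ∀ v, q * qf P v ≤ qf Q v := by
  classical
  obtain ⟨c, hc, hc1, h⟩ := exists_pos_mul_le_qf hQ
  have hP := norm_nonneg P
  refine ⟨c / (‖P‖ + 1), by positivity, (div_le_one (by positivity)).2 (by linarith), fun v => ?_⟩
  refine le_trans ?_ (h v)
  rw [div_mul_eq_mul_div, div_le_iff₀ (by positivity)]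
  nlinarith [mul_le_mul_of_nonneg_left (qf_le P v) hc.le, mul_nonneg hc.le (sq_nonneg (enorm₂ v))]

variable {m n nu : ℕ} {A : Matrix (Fin m × Fin n) (Fin n) ℝ}
  {B : Matrix (Fin m × Fin n) (Fin nu) ℝ} {Q : Matrix (Fin n) (Fin n) ℝ}
  {R : Matrix (Fin nu) (Fin nu) ℝ} {S T : Matrix (Fin m) (Fin m) ℝ}

lemma stepValue_posSemidef (hQ : Q.PosDef) (hR : R.PosDef) (hS : S.PosSemidef)
    {V : Matrix (Fin n) (Fin n) ℝ} (hV : V.PosSemidef) :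
    (stepValue A B Q R (S ⊗ₖ V)).PosSemidef :=
  .of_qf (transpose_stepValue hQ.posSemidef.transpose_eq hR (hS.kronecker hV)) fun v =>
    (hQ.posSemidef.qf_nonneg v).trans (le_stepValue hR (hS.kronecker hV) v)

lemma valueIteration_posSemidef (hQ : Q.PosDef) (hR : R.PosDef) (hS : S.PosSemidef)
    {V : Matrix (Fin n) (Fin n) ℝ} (hV : V.PosSemidef) (k : ℕ) :
    ((fun V => stepValue A B Q R (S ⊗ₖ V))^[k] V).PosSemidef := by
  induction k with
  | zero => exact hV
  | succ k ih =>
    rw [Function.iterate_succ_apply']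
    exact stepValue_posSemidef hQ hR hS ih

/-- Value iteration from any positive semidefinite matrix converges to the Riccati solution. -/
lemma tendsto_valueIteration (hQ : Q.PosDef) (hR : R.PosDef) (hS : S.PosSemidef)
    {V P : Matrix (Fin n) (Fin n) ℝ} (hV : V.PosSemidef) (hP : P.PosSemidef)
    (hfix : stepValue A B Q R (S ⊗ₖ P) = P) (v : Fin n → ℝ) :
    Tendsto (fun k => qf ((fun V => stepValue A B Q R (S ⊗ₖ V))^[k] V) v) atTop (𝓝 (qf P v)) := by
  obtain ⟨q, hq, hq1, hqP⟩ := exists_pos_mul_qf_le hQ P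
  obtain ⟨c, hc, -, hcV⟩ := exists_pos_mul_qf_le hQ V
  have hQP : ∀ v, qf Q v ≤ qf P v := fun v => by
    have := le_stepValue (A := A) (B := B) (Q := Q) hR (hS.kronecker hP) v
    rwa [hfix] at this
  have hSP := hS.kronecker hP
  have h1q : 0 ≤ 1 - q := by linarith
  have hpow : ∀ k : ℕ, 0 ≤ (1 - q) ^ k ∧ (1 - q) ^ k ≤ 1 := fun k =>
    ⟨pow_nonneg h1q k, pow_le_one₀ h1q (by linarith)⟩
  -- If `V ≤ t P` with `t ≥ 1`, one step gives at most `t P - (t - 1) Q ≤ (t - (t - 1) q) P`, so the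
  -- excess of `t` over `1` shrinks by `1 - q`; the lower bound is symmetric. The initial excess
  -- `c⁻¹` comes from `c V ≤ Q ≤ P`.
  have key : ∀ k : ℕ, ∀ v,
      (1 - (1 - q) ^ k) * qf P v ≤ qf ((fun V => stepValue A B Q R (S ⊗ₖ V))^[k] V) v ∧
      qf ((fun V => stepValue A B Q R (S ⊗ₖ V))^[k] V) v ≤
        (1 + c⁻¹ * (1 - q) ^ k) * qf P v := by
    intro k
    induction k with
    | zero =>
      intro v
      have h1 := hV.qf_nonneg v
      have h2 := hP.qf_nonneg v
      have h3 : qf V v ≤ c⁻¹ * qf P v := by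
        rw [inv_mul_eq_div, le_div_iff₀ hc, mul_comm]
        exact (hcV v).trans (hQP v)
      simp only [pow_zero, Function.iterate_zero, id]
      constructor <;> linarith
    | succ k ih =>
      intro v
      rw [Function.iterate_succ_apply']
      set W := (fun V => stepValue A B Q R (S ⊗ₖ V))^[k] V with hW
      have hWp : W.PosSemidef := valueIteration_posSemidef hQ hR hS hV k
      obtain ⟨hk0, hk1⟩ := hpow k
      have hc0 : 0 ≤ c⁻¹ * (1 - q) ^ k := mul_nonneg (inv_nonneg.2 hc.le) hk0
      have hqv := hqP v
      have hmono : ∀ {X Y : Matrix (Fin n) (Fin n) ℝ}, X.PosSemidef → Y.PosSemidef →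
          (∀ v, qf X v ≤ qf Y v) → ∀ z, qf (S ⊗ₖ X) z ≤ qf (S ⊗ₖ Y) z := fun hX hY h z =>
        qf_kronecker_mono_right hS (X := Symm.mk' _ hX.transpose_eq)
          (Y := Symm.mk' _ hY.transpose_eq) h z
      constructor
      · have hp : ((1 - (1 - q) ^ k) • P).PosSemidef := hP.smul (by linarith)
        have h1 := stepValue_mono (A := A) (B := B) (Q := Q) hR (hS.kronecker hp)
          (hS.kronecker hWp) (hmono hp hWp fun v => by rw [qf_smul]; exact (ih v).1) v
        rw [Matrix.kronecker_smul] at h1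
        have h2 := le_stepValue_smul (A := A) (B := B) (Q := Q) hR hSP
          (by linarith : 0 ≤ 1 - (1 - q) ^ k) (by linarith) v
        rw [hfix] at h2
        rw [pow_succ]
        nlinarith [mul_le_mul_of_nonneg_left hqv hk0]
      · have hp : ((1 + c⁻¹ * (1 - q) ^ k) • P).PosSemidef := hP.smul (by linarith)
        have h1 := stepValue_mono (A := A) (B := B) (Q := Q) hR (hS.kronecker hWp)
          (hS.kronecker hp) (hmono hWp hp fun v => by rw [qf_smul]; exact (ih v).2) v
        rw [Matrix.kronecker_smul] at h1
        have h2 := stepValue_smul_le (A := A) (B := B) (Q := Q) hR hSP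
          (by linarith : 1 ≤ 1 + c⁻¹ * (1 - q) ^ k) v
        rw [hfix] at h2
        rw [pow_succ]
        nlinarith [mul_le_mul_of_nonneg_left hqv hc0]
  have hlim := tendsto_pow_atTop_nhds_zero_of_lt_one h1q (by linarith : 1 - q < 1)
  refine tendsto_of_tendsto_of_tendsto_of_le_of_le (g := fun k : ℕ => (1 - (1 - q) ^ k) * qf P v)
    (h := fun k : ℕ => (1 + c⁻¹ * (1 - q) ^ k) * qf P v) ?_ ?_ (fun k => (key k v).1)
    fun k => (key k v).2
  · simpa using (hlim.const_sub 1).mul_const (qf P v)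
  · simpa using ((hlim.const_mul c⁻¹).const_add 1).mul_const (qf P v)

lemma qf_riccati_closedLoop (hR : R.PosDef) (hS : S.PosSemidef) {P : Matrix (Fin n) (Fin n) ℝ}
    (hP : P.PosSemidef) (hfix : stepValue A B Q R (S ⊗ₖ P) = P) (v : Fin n → ℝ) :
    qf P v = qf Q v + qf R (stepGain A B R (S ⊗ₖ P) *ᵥ v) +
      qf (S ⊗ₖ P) ((A + B * stepGain A B R (S ⊗ₖ P)) *ᵥ v) := by
  have h := step_completion (A := A) (B := B) (Q := Q) hR (hS.kronecker hP) v
    (stepGain A B R (S ⊗ₖ P) *ᵥ v)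
  rw [hfix, sub_self] at h
  rw [Matrix.add_mulVec, ← Matrix.mulVec_mulVec, h]
  simp [qf]

/-- Relative perturbation bounds for `S` carry over to `S ⊗ X`. -/
lemma qf_kronecker_perturb {Δ : Matrix (Fin m) (Fin m) ℝ} {lb ub : ℝ}
    (hl : (Δ - lb • S).PosSemidef) (hu : (ub • S - Δ).PosSemidef)
    {X : Matrix (Fin n) (Fin n) ℝ} (hX : X.PosSemidef) (z : Fin m × Fin n → ℝ) :
    lb * qf (S ⊗ₖ X) z ≤ qf (Δ ⊗ₖ X) z ∧ qf (Δ ⊗ₖ X) z ≤ ub * qf (S ⊗ₖ X) z := by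
  have h1 := qf_kronecker_mono_left hl hX z
  have h2 := qf_kronecker_mono_left hu hX z
  rw [Matrix.smul_kronecker, qf_smul] at h1 h2
  exact ⟨h1, h2⟩

lemma posSemidef_add_perturb {Δ : Matrix (Fin m) (Fin m) ℝ} {lb : ℝ} (hlb : -1 ≤ lb)
    (hS : S.PosSemidef) (hl : (Δ - lb • S).PosSemidef) : (S + Δ).PosSemidef := by
  have h := (hS.smul (by linarith : 0 ≤ 1 + lb)).add hl
  have h2 : (1 + lb) • S + (Δ - lb • S) = S + Δ := by rw [add_smul, one_smul]; abel
  rwa [h2] at h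

/-- The Riccati perturbation bound: the order interval `P ± η ε Y` is invariant under value
iteration for the perturbed equation. -/
lemma norm_riccati_sub_le (hQ : Q.PosDef) (hR : R.PosDef) {S Δ : Symm m} (hS : S.1.PosSemidef)
    {lb ub : ℝ} (hlb : -1 ≤ lb) (hlb0 : lb ≤ 0) (hub : 0 ≤ ub)
    (hl : (Δ.1 - lb • S.1).PosSemidef) (hu : (ub • S.1 - Δ.1).PosSemidef)
    {P P' : Symm n} (hP : P.1.PosSemidef) (hP' : P'.1.PosSemidef)
    (hfix : stepValue A B Q R (S.1 ⊗ₖ P.1) = P.1)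
    (hfix' : stepValue A B Q R ((S + Δ).1 ⊗ₖ P'.1) = P'.1)
    {L : Matrix (Fin m × Fin n) (Fin n) ℝ} (hL : L = A + B * stepGain A B R (S.1 ⊗ₖ P.1))
    {Y : Symm n} (hY : Y - kronCongr S L Y = 1) (hY0 : ∀ v, 0 ≤ qf Y.1 v)
    {η ε : ℝ} (hη : 0 ≤ η) (hηY : η * ‖Y‖ ≤ 1) (hε : 0 ≤ ε)
    (hquad : max |lb| |ub| * (‖kronCongr S A P‖ + ‖kronCongr S A‖ * ε) +
      ‖L‖ ^ 2 * ‖B * R⁻¹ * Bᵀ‖ * ‖S‖ ^ 2 * ε ^ 2 ≤ η * ε) :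
    ‖P' - P‖ ≤ ε := by
  have hηε : 0 ≤ η * ε := mul_nonneg hη hε
  -- Membership in the order interval implies the norm bound, since `η Y ≤ 1`.
  have hbound : ∀ X : Symm n, (∀ v, |qf X.1 v| ≤ η * ε * qf Y.1 v) → ‖X‖ ≤ ε := fun X hX =>
    Symm.norm_le_of_abs_qf hε fun v => (hX v).trans <| by
      have h1 := (abs_le.1 (Y.abs_qf_le v)).2
      have h2 := mul_le_mul_of_nonneg_left h1 hηε
      have h3 := mul_le_mul_of_nonneg_right hηY (mul_nonneg hε (sq_nonneg (enorm₂ v)))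
      linarith
  have hS' : (S + Δ).1.PosSemidef := posSemidef_add_perturb hlb hS hl
  have hΛY : ∀ v, qf (kronCongr S L Y).1 v = qf Y.1 v - enorm₂ v ^ 2 := fun v => by
    rw [← Symm.qf_one, ← hY, Symm.coe_sub, qf_sub]; ring
  have key : ∀ k : ℕ, ∀ v,
      |qf ((fun V => stepValue A B Q R ((S + Δ).1 ⊗ₖ V))^[k] P.1) v - qf P.1 v| ≤
        η * ε * qf Y.1 v := by
    intro k
    induction k with
    | zero => intro v; simpa using mul_nonneg hηε (hY0 v)
    | succ k ih =>
      intro v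
      rw [Function.iterate_succ_apply']
      set V := (fun V => stepValue A B Q R ((S + Δ).1 ⊗ₖ V))^[k] P.1 with hV
      have hVp : V.PosSemidef := valueIteration_posSemidef hQ hR hS' hP k
      set X : Symm n := Symm.mk' V hVp.transpose_eq - P with hX
      have hXV : X.1 = V - P.1 := rfl
      have hXn : ‖X‖ ≤ ε := hbound X fun v => by rw [hXV, qf_sub]; exact ih v
      have hv := sq_nonneg (enorm₂ v)
      -- the effect of perturbing the covariance
      have h1 : |qf (stepValue A B Q R ((S + Δ).1 ⊗ₖ V)) v -
          qf (stepValue A B Q R (S.1 ⊗ₖ V)) v| ≤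
          max |lb| |ub| * (‖kronCongr S A P‖ + ‖kronCongr S A‖ * ε) * enorm₂ v ^ 2 := by
        refine (abs_stepValue_sub_le hR (hS.kronecker hVp) (hS'.kronecker hVp) hlb hlb0 hub
          (fun z => ?_) (fun z => ?_) v).trans ?_
        · have := (qf_kronecker_perturb hl hu hVp z).1
          rw [Symm.coe_add, Matrix.add_kronecker, qf_add]
          linarith
        · have := (qf_kronecker_perturb hl hu hVp z).2
          rw [Symm.coe_add, Matrix.add_kronecker, qf_add]
          linarith
        · rw [mul_assoc]
          refine mul_le_mul_of_nonneg_left ?_ (le_max_of_le_left (abs_nonneg _))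
          have e1 : qf (S.1 ⊗ₖ V) (A *ᵥ v) =
              qf (kronCongr S A P).1 v + qf (kronCongr S A X).1 v := by
            rw [qf_kronCongr, qf_kronCongr, hXV, kronecker_sub', qf_sub]; ring
          have e2 := (abs_le.1 ((kronCongr S A P).abs_qf_le v)).2
          have e3 := (abs_le.1 ((kronCongr S A X).abs_qf_le v)).2
          have e4 := ((kronCongr S A).le_opNorm X).trans
            (mul_le_mul_of_nonneg_left hXn (ContinuousLinearMap.opNorm_nonneg _))
          have e5 := mul_le_mul_of_nonneg_right e4 hv
          rw [e1]
          linarith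
      -- the effect of perturbing the cost-to-go
      have hkr : S.1 ⊗ₖ V - S.1 ⊗ₖ P.1 = S.1 ⊗ₖ X.1 := by rw [hXV, kronecker_sub']
      have h2 := stepValue_le_add (A := A) (B := B) (Q := Q) hR (hS.kronecker hP)
        (hS.kronecker hVp) v
      have h3 := le_stepValue_add (A := A) (B := B) (Q := Q) hR (hS.kronecker hP)
        (hS.kronecker hVp) v
      rw [hfix, hkr, ← hL, ← qf_kronCongr] at h2 h3
      have h4 : qf (B * R⁻¹ * Bᵀ) ((S.1 ⊗ₖ X.1) *ᵥ (L *ᵥ v)) ≤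
          ‖L‖ ^ 2 * ‖B * R⁻¹ * Bᵀ‖ * ‖S‖ ^ 2 * ε ^ 2 * enorm₂ v ^ 2 := by
        have f1 : enorm₂ ((S.1 ⊗ₖ X.1) *ᵥ (L *ᵥ v)) ≤ ‖S‖ * ε * (‖L‖ * enorm₂ v) := by
          refine (enorm₂_mulVec_le _ _).trans (mul_le_mul ?_ (enorm₂_mulVec_le _ _)
            (enorm₂_nonneg _) (mul_nonneg (norm_nonneg _) hε))
          exact (norm_kronecker_le _ _).trans
            (mul_le_mul_of_nonneg_left hXn (norm_nonneg _))
        have f2 := pow_le_pow_left₀ (enorm₂_nonneg _) f1 2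
        refine (qf_le _ _).trans ((mul_le_mul_of_nonneg_left f2 (norm_nonneg _)).trans_eq ?_)
        ring
      -- Monotonicity pushes the order interval through the closed-loop operator, and the Lyapunov
      -- equation returns `Y - 1`. The freed `η ε |v|²` is what `hquad` spends on the other two
      -- errors.
      have h5 : |qf (kronCongr S L X).1 v| ≤ η * ε * (qf Y.1 v - enorm₂ v ^ 2) := by
        rw [← hΛY, abs_le]
        have g1 := qf_kronCongr_mono hS L (X := X) (Y := (η * ε) • Y) (fun v => by
          rw [hXV, qf_sub, Symm.coe_smul, qf_smul]; exact (abs_le.1 (ih v)).2) v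
        have g2 := qf_kronCongr_mono hS L (X := (-(η * ε)) • Y) (Y := X) (fun v => by
          rw [hXV, qf_sub, Symm.coe_smul, qf_smul, neg_mul]; exact (abs_le.1 (ih v)).1) v
        rw [map_smul, Symm.coe_smul, qf_smul] at g1 g2
        exact ⟨by linarith, g1⟩
      have h6 := mul_le_mul_of_nonneg_right hquad hv
      have h7 := mul_nonneg (mul_nonneg (mul_nonneg (mul_nonneg (sq_nonneg ‖L‖)
        (norm_nonneg (B * R⁻¹ * Bᵀ))) (sq_nonneg ‖S‖)) (sq_nonneg ε)) hv
      rw [abs_le] at h1 h5 ⊢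
      constructor <;> nlinarith [h1.1, h1.2, h5.1, h5.2]
  refine hbound _ fun v => ?_
  have hlim := tendsto_valueIteration hQ hR hS' hP hP' hfix' v
  rw [Symm.coe_sub, qf_sub]
  exact le_of_tendsto' ((hlim.sub_const _).abs) fun k => key k v

end Riccati

/-! ### Perturbation of the gain -/

section Gain

variable {m n nu : ℕ} {A : Matrix (Fin m × Fin n) (Fin n) ℝ}
  {B : Matrix (Fin m × Fin n) (Fin nu) ℝ} {R : Matrix (Fin nu) (Fin nu) ℝ}

lemma norm_le_of_relative_bounds {S Δ : Symm m} (hS : S.1.PosSemidef) {lb ub : ℝ}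
    (hl : (Δ.1 - lb • S.1).PosSemidef) (hu : (ub • S.1 - Δ.1).PosSemidef) :
    ‖Δ‖ ≤ max |lb| |ub| * ‖S‖ := by
  refine Symm.norm_le_of_abs_qf (mul_nonneg (le_max_of_le_left (abs_nonneg _)) (norm_nonneg _))
    fun v => ?_
  have h1 := hl.qf_nonneg v
  have h2 := hu.qf_nonneg v
  rw [qf_sub, qf_smul] at h1 h2
  have h3 := hS.qf_nonneg v
  have h4 := (abs_le.1 (S.abs_qf_le v)).2
  have h8 : -lb ≤ max |lb| |ub| := (neg_le_abs lb).trans (le_max_left _ _)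
  have h9 : ub ≤ max |lb| |ub| := (le_abs_self ub).trans (le_max_right _ _)
  have h10 := mul_le_mul_of_nonneg_left h4 (le_max_of_le_left (abs_nonneg lb) : 0 ≤ max |lb| |ub|)
  rw [abs_le]
  constructor <;> nlinarith

lemma norm_kronCongr_relative_le {S Δ : Symm m} (hS : S.1.PosSemidef) {lb ub : ℝ}
    (hl : (Δ.1 - lb • S.1).PosSemidef) (hu : (ub • S.1 - Δ.1).PosSemidef)
    {P : Symm n} (hP : P.1.PosSemidef) :
    ‖kronCongr Δ B P‖ ≤ max |lb| |ub| * ‖kronCongr S B P‖ := by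
  refine Symm.norm_le_of_abs_qf (mul_nonneg (le_max_of_le_left (abs_nonneg _)) (norm_nonneg _))
    fun v => ?_
  have h1 := qf_kronecker_perturb hl hu hP (B *ᵥ v)
  have h3 := (hS.kronecker hP).qf_nonneg (B *ᵥ v)
  have h4 := (abs_le.1 ((kronCongr S B P).abs_qf_le v)).2
  have h8 : -lb ≤ max |lb| |ub| := (neg_le_abs lb).trans (le_max_left _ _)
  have h9 : ub ≤ max |lb| |ub| := (le_abs_self ub).trans (le_max_right _ _)
  have h10 := mul_le_mul_of_nonneg_left h4 (le_max_of_le_left (abs_nonneg lb) : 0 ≤ max |lb| |ub|)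
  rw [qf_kronCongr] at h10 ⊢
  rw [abs_le]
  constructor <;> nlinarith [h1.1, h1.2]

/-- The operator is monotone and `X` lies between `± ‖X‖ · 1`, so only its value at the identity
matters, and there the relative bound on `Δ` applies. -/
lemma norm_kronCongr_add_relative_le {S Δ : Symm m} (hS : S.1.PosSemidef) {lb ub : ℝ}
    (hlb : -1 ≤ lb)
    (hl : (Δ.1 - lb • S.1).PosSemidef) (hu : (ub • S.1 - Δ.1).PosSemidef) (X : Symm n) :
    ‖kronCongr (S + Δ) B X‖ ≤ (1 + max |lb| |ub|) * ‖kronCongr S B‖ * ‖X‖ := by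
  have hδ : 0 ≤ max |lb| |ub| := le_max_of_le_left (abs_nonneg lb)
  have hS' : (S + Δ).1.PosSemidef := posSemidef_add_perturb hlb hS hl
  have hX := norm_nonneg X
  have hκ : 0 ≤ ‖kronCongr S B‖ := ContinuousLinearMap.opNorm_nonneg _
  refine Symm.norm_le_of_abs_qf (by positivity) fun v => ?_
  have h1 : ∀ w, qf X.1 w ≤ qf (‖X‖ • (1 : Symm n)).1 w := fun w => by
    rw [Symm.coe_smul, qf_smul, Symm.qf_one]
    exact (abs_le.1 (X.abs_qf_le w)).2
  have h2 : ∀ w, qf ((-‖X‖) • (1 : Symm n)).1 w ≤ qf X.1 w := fun w => by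
    rw [Symm.coe_smul, qf_smul, Symm.qf_one, neg_mul]
    exact (abs_le.1 (X.abs_qf_le w)).1
  have h3 := qf_kronCongr_mono hS' B h1 v
  have h4 := qf_kronCongr_mono hS' B h2 v
  rw [map_smul, Symm.coe_smul, qf_smul] at h3 h4
  have h1p : (1 : Symm n).1.PosSemidef := Symm.posSemidef fun w => by
    rw [Symm.qf_one]; positivity
  have h5 : qf (kronCongr (S + Δ) B 1).1 v ≤
      (1 + max |lb| |ub|) * ‖kronCongr S B‖ * enorm₂ v ^ 2 := by
    have e1 := (qf_kronecker_perturb hl hu h1p (B *ᵥ v)).2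
    have e2 := (abs_le.1 ((kronCongr S B 1).abs_qf_le v)).2
    have e3 := ((kronCongr S B).le_opNorm 1).trans
      (mul_le_mul_of_nonneg_left Symm.norm_one_le hκ)
    have e4 := mul_le_mul_of_nonneg_right e3 (sq_nonneg (enorm₂ v))
    have e5 := (hS.kronecker h1p).qf_nonneg (B *ᵥ v)
    have e6 : ub ≤ max |lb| |ub| := (le_abs_self ub).trans (le_max_right _ _)
    rw [qf_kronCongr] at e2
    rw [qf_kronCongr, Symm.coe_add, Matrix.add_kronecker, qf_add]
    nlinarith
  have h6 := mul_le_mul_of_nonneg_left h5 hX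
  rw [abs_le]
  constructor <;> nlinarith

/-- With `d = D v`, the chain `μ |d|² ≤ d ⬝ᵥ N d ≤ |d| |N d|` can be divided by `|d|`. This avoids
bounding `N⁻¹`. -/
lemma sInf_spectrum_mul_norm_le {k : ℕ} {N : Matrix (Fin nu) (Fin nu) ℝ} (hR : R.PosDef)
    (h : ∀ z, qf R z ≤ qf N z) (D : Matrix (Fin nu) (Fin k) ℝ) :
    sInf (spectrum ℝ R) * ‖D‖ ≤ ‖N * D‖ := by
  rcases (sInf_spectrum_nonneg hR).eq_or_lt with h0 | h0
  · rw [← h0, zero_mul]; exact norm_nonneg _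
  · rw [← le_div_iff₀' h0]
    refine norm_le_of_enorm₂ (by positivity) fun v => ?_
    set d := D *ᵥ v with hd
    rw [div_mul_eq_mul_div, le_div_iff₀ h0]
    have h1 := sInf_spectrum_mul_le_qf hR.isHermitian d
    have h2 := h d
    have h3 := (le_abs_self _).trans (dotProduct_le_enorm₂ d (N *ᵥ d))
    have h4 : enorm₂ (N *ᵥ d) ≤ ‖N * D‖ * enorm₂ v := by
      rw [hd, Matrix.mulVec_mulVec]; exact enorm₂_mulVec_le _ _
    have h5 := enorm₂_nonneg d
    rw [← qf] at h3
    rcases h5.eq_or_lt with h6 | h6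
    · rw [← h6, zero_mul]; exact mul_nonneg (norm_nonneg _) (enorm₂_nonneg _)
    · have h7 : enorm₂ d * (enorm₂ d * sInf (spectrum ℝ R)) ≤
          enorm₂ d * (‖N * D‖ * enorm₂ v) := by
        nlinarith [mul_le_mul_of_nonneg_left h4 h5]
      exact le_of_mul_le_mul_left h7 h6

lemma norm_stepGain_sub_le (hR : R.PosDef) {S Δ : Symm m} (hS : S.1.PosSemidef)
    {lb ub : ℝ} (hlb : -1 ≤ lb)
    (hl : (Δ.1 - lb • S.1).PosSemidef) (hu : (ub • S.1 - Δ.1).PosSemidef)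
    {P P' : Symm n} (hP : P.1.PosSemidef) (hP' : P'.1.PosSemidef) {ε : ℝ} (hε : ‖P' - P‖ ≤ ε) :
    sInf (spectrum ℝ R) *
      ‖stepGain A B R ((S + Δ).1 ⊗ₖ P'.1) - stepGain A B R (S.1 ⊗ₖ P.1)‖ ≤
    (1 + max |lb| |ub|) * ε *
        (‖kronCongr S B‖ * ‖stepGain A B R (S.1 ⊗ₖ P.1)‖ + ‖A‖ * ‖B‖ * ‖S‖) +
      max |lb| |ub| * (‖kronCongr S B P‖ * ‖stepGain A B R (S.1 ⊗ₖ P.1)‖ +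
        ‖A‖ * ‖B‖ * ‖S‖ * ‖P‖) := by
  have hδ : 0 ≤ max |lb| |ub| := le_max_of_le_left (abs_nonneg lb)
  have hS' : (S + Δ).1.PosSemidef := posSemidef_add_perturb hlb hS hl
  have hM := hS.kronecker hP
  have hM' := hS'.kronecker hP'
  set K := stepGain A B R (S.1 ⊗ₖ P.1) with hK
  set K' := stepGain A B R ((S + Δ).1 ⊗ₖ P'.1) with hK'
  set X := P' - P with hX
  set Z := (S + Δ).1 ⊗ₖ P'.1 - S.1 ⊗ₖ P.1 with hZ
  have hZX : Z = (S + Δ).1 ⊗ₖ X.1 + Δ.1 ⊗ₖ P.1 := by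
    rw [hZ, hX, Symm.coe_sub, kronecker_sub', Symm.coe_add, Matrix.add_kronecker,
      Matrix.add_kronecker]
    abel
  refine (sInf_spectrum_mul_norm_le hR (N := R + Bᵀ * ((S + Δ).1 ⊗ₖ P'.1) * B) (fun z => ?_)
    _).trans ?_
  · rw [qf_add, qf_congr]
    linarith [hM'.qf_nonneg (B *ᵥ z)]
  -- Multiplying by the new matrix `N` removes its inverse; the stationarity of the old gain then
  -- leaves only terms containing the change `Z` of the cost-to-go.
  have hND : (R + Bᵀ * ((S + Δ).1 ⊗ₖ P'.1) * B) * (K' - K) =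
      -(Bᵀ * Z * A) - (kronCongr (S + Δ) B X + kronCongr Δ B P).1 * K := by
    have h1 : (kronCongr (S + Δ) B X + kronCongr Δ B P).1 = Bᵀ * Z * B := by
      rw [Symm.coe_add, kronCongr_coe, kronCongr_coe, ← Matrix.add_mul, ← Matrix.mul_add, ← hZX]
    have h2 : R * K = -(Bᵀ * (S.1 ⊗ₖ P.1) * (A + B * K)) :=
      eq_neg_of_add_eq_zero_left (stepGain_stationary (A := A) (B := B) hR hM)
    rw [Matrix.mul_sub, mul_stepGain hR hM', Matrix.add_mul, h2, h1, hZ]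
    simp only [Matrix.mul_sub, Matrix.sub_mul, Matrix.mul_add, Matrix.mul_assoc]
    abel
  rw [hND]
  have hε0 : 0 ≤ ε := (norm_nonneg _).trans hε
  have hΔ := norm_le_of_relative_bounds hS hl hu
  have hκ : 0 ≤ ‖kronCongr S B‖ := ContinuousLinearMap.opNorm_nonneg _
  have hSΔ : ‖S + Δ‖ ≤ (1 + max |lb| |ub|) * ‖S‖ := (norm_add_le _ _).trans (by linarith)
  have hZn : ‖Z‖ ≤ (1 + max |lb| |ub|) * ‖S‖ * ε + max |lb| |ub| * ‖S‖ * ‖P‖ := by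
    rw [hZX]
    refine (norm_add_le _ _).trans (add_le_add ?_ ?_)
    · exact (norm_kronecker_le _ _).trans (mul_le_mul hSΔ hε (norm_nonneg _) (by positivity))
    · exact (norm_kronecker_le _ _).trans (mul_le_mul_of_nonneg_right hΔ (norm_nonneg _))
  have h1 : ‖Bᵀ * Z * A‖ ≤ ‖B‖ *
      ((1 + max |lb| |ub|) * ‖S‖ * ε + max |lb| |ub| * ‖S‖ * ‖P‖) * ‖A‖ := by
    refine (Matrix.l2_opNorm_mul _ _).trans (mul_le_mul_of_nonneg_right ?_ (norm_nonneg _))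
    refine (Matrix.l2_opNorm_mul _ _).trans ?_
    rw [norm_transpose_eq]
    exact mul_le_mul_of_nonneg_left hZn (norm_nonneg _)
  have h2 : ‖(kronCongr (S + Δ) B X + kronCongr Δ B P).1 * K‖ ≤
      ((1 + max |lb| |ub|) * ‖kronCongr S B‖ * ε + max |lb| |ub| * ‖kronCongr S B P‖) * ‖K‖ := by
    refine (Matrix.l2_opNorm_mul _ _).trans (mul_le_mul_of_nonneg_right ?_ (norm_nonneg _))
    refine (norm_add_le (kronCongr (S + Δ) B X) (kronCongr Δ B P)).trans (add_le_add ?_ ?_)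
    · exact (norm_kronCongr_add_relative_le hS hlb hl hu X).trans
        (mul_le_mul_of_nonneg_left hε (by positivity))
    · exact norm_kronCongr_relative_le hS hl hu hP
  refine (norm_sub_le _ _).trans ?_
  rw [norm_neg]
  linarith

end Gain

/-! ### Lyapunov operators and their adjoints -/

section Lyapunov

variable {m n nu : ℕ}

lemma vecMulVec_transpose (x : Fin n → ℝ) :
    (Matrix.vecMulVec x x)ᵀ = Matrix.vecMulVec x x := by
  ext i j; simp [Matrix.vecMulVec_apply, mul_comm]

lemma qf_vecMulVec (x y v : Fin n → ℝ) :
    qf (Matrix.vecMulVec x y) v = (x ⬝ᵥ v) * (y ⬝ᵥ v) := by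
  rw [qf, Matrix.vecMulVec_mulVec, dotProduct_comm v]
  simp [smul_dotProduct, mul_comm]

lemma qf_vecMulVec_le (x v : Fin n → ℝ) :
    qf (Matrix.vecMulVec x x) v ≤ enorm₂ x ^ 2 * enorm₂ v ^ 2 := by
  rw [qf_vecMulVec, ← sq, ← mul_pow, ← sq_abs]
  exact pow_le_pow_left₀ (abs_nonneg _) (dotProduct_le_enorm₂ x v) 2

/-- `inverse` is zero on non-invertible maps, so a positive reciprocal norm carries invertibility
with it. -/
lemma isInvertible_of_inverse_norm_pos {T : Symm n →L[ℝ] Symm n} (h : 0 < ‖T.inverse‖⁻¹) :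
    T.IsInvertible := by
  by_contra hT
  rw [ContinuousLinearMap.inverse_of_not_isInvertible hT,
    ContinuousLinearMap.opNorm_zero, inv_zero] at h
  exact lt_irrefl _ h

lemma inv_norm_inverse_mul_le (T : Symm n →L[ℝ] Symm n) :
    ‖T.inverse‖⁻¹ * ‖T.inverse 1‖ ≤ 1 := by
  have h0 : 0 ≤ ‖T.inverse‖ := ContinuousLinearMap.opNorm_nonneg _
  have h : ‖T.inverse 1‖ ≤ ‖T.inverse‖ :=
    (T.inverse.le_opNorm 1).trans (mul_le_of_le_one_right h0 Symm.norm_one_le)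
  exact (mul_le_mul_of_nonneg_left h (inv_nonneg.2 h0)).trans inv_mul_le_one

lemma nonneg_of_id_sub_nonneg {Λ : Symm n →L[ℝ] Symm n}
    (hΛ : ∀ X Y : Symm n, (∀ v, qf X.1 v ≤ qf Y.1 v) → ∀ v, qf (Λ X).1 v ≤ qf (Λ Y).1 v)
    {P : Symm n} {c r : ℝ} (hc : 0 < c) (hP : ∀ v, c * enorm₂ v ^ 2 ≤ qf P.1 v)
    (hr : 0 ≤ r) (hr1 : r < 1) (hΛP : ∀ v, qf (Λ P).1 v ≤ r * qf P.1 v)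
    {X : Symm n} (hX : ∀ v, 0 ≤ qf (X - Λ X).1 v) (v : Fin n → ℝ) : 0 ≤ qf X.1 v :=
  nonneg_of_apply_le hΛ hc hP hr hr1 hΛP (fun v => by
    have := hX v
    rw [Symm.coe_sub, qf_sub] at this
    linarith) v

/-- Positivity passes from the resolvent of `X ↦ Lᵀ (S ⊗ X) L` to that of its adjoint. -/
lemma nonneg_of_adjoint_lyapunov {S : Symm m} {L : Matrix (Fin m × Fin n) (Fin n) ℝ}
    (hinv : (ContinuousLinearMap.id ℝ (Symm n) - kronCongr S L).IsInvertible)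
    (hpos : ∀ X : Symm n, (∀ v, 0 ≤ qf (X - kronCongr S L X).1 v) → ∀ v, 0 ≤ qf X.1 v)
    {Y : Symm n} (hY : Y - kronCongr S (blockTranspose L) Y = 1) (v : Fin n → ℝ) :
    0 ≤ qf Y.1 v := by
  -- Duality: with `W` solving the primal equation for `v vᵀ`, moving the operator across the
  -- pairing gives `vᵀ Y v = tr W`, and `W` is positive by the primal result.
  set Z : Symm n := Symm.mk' (Matrix.vecMulVec v v) (vecMulVec_transpose v) with hZ
  obtain ⟨W, hW⟩ := hinv.surjective Z
  have hW' : W - kronCongr S L W = Z := by simpa using hW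
  have hZp : ∀ w, 0 ≤ qf Z.1 w := fun w => by
    rw [hZ, Symm.coe_mk', qf_vecMulVec]; exact mul_self_nonneg _
  have hWp := hpos W fun w => by rw [hW']; exact hZp w
  have h1 : qf Y.1 v = W.1.trace := by
    rw [← frob_vecMulVec, ← frob_one_left]
    change frob Y.1 Z.1 = frob (1 : Symm n).1 W.1
    rw [← hW', ← hY, Symm.coe_sub, Symm.coe_sub, frob_sub_left, frob_sub_right, frob_kronCongr]
  rw [h1]
  exact (Symm.posSemidef hWp).trace_nonneg

/-- Transposing blockwise turns right multiplication of all blocks by `D` into left multiplication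
by `Dᵀ`, that is, by `1 ⊗ Dᵀ`. -/
lemma blockTranspose_add_mul (L : Matrix (Fin m × Fin n) (Fin n) ℝ)
    (B : Matrix (Fin m × Fin n) (Fin nu) ℝ) (D : Matrix (Fin nu) (Fin n) ℝ) :
    blockTranspose (L + B * D) =
      blockTranspose L + ((1 : Matrix (Fin m) (Fin m) ℝ) ⊗ₖ Dᵀ) * blockTranspose B := by
  ext ⟨i, a⟩ b
  simp [blockTranspose, Matrix.mul_apply, Fintype.sum_prod_type, Matrix.one_apply, mul_comm,
    Finset.sum_ite_irrel]

lemma transpose_kronecker_symm (S : Symm m) (X : Symm n) : (S.1 ⊗ₖ X.1)ᵀ = S.1 ⊗ₖ X.1 := by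
  ext i j
  have h1 := congrFun (congrFun S.transpose_eq i.1) j.1
  have h2 := congrFun (congrFun X.transpose_eq i.2) j.2
  rw [Matrix.transpose_apply] at h1 h2
  simp [h1, h2]

/-- The effect of a change `D` of the gain on the adjoint Lyapunov operator. -/
lemma qf_adjoint_perturb_le (S : Symm m) (L : Matrix (Fin m × Fin n) (Fin n) ℝ)
    (B : Matrix (Fin m × Fin n) (Fin nu) ℝ) (D : Matrix (Fin nu) (Fin n) ℝ) {ε : ℝ}
    (hD : ‖D‖ ≤ ε) (Y : Symm n) (v : Fin n → ℝ) :
    qf (kronCongr S (blockTranspose (L + B * D)) Y).1 v ≤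
      qf (kronCongr S (blockTranspose L) Y).1 v +
        (2 * (‖blockTranspose L‖ * ‖blockTranspose B‖ * ‖S‖) * ε +
          ‖kronCongr S (blockTranspose B)‖ * ε ^ 2) * ‖Y‖ * enorm₂ v ^ 2 := by
  have hε : 0 ≤ ε := (norm_nonneg _).trans hD
  have hκ : 0 ≤ ‖kronCongr S (blockTranspose B)‖ := ContinuousLinearMap.opNorm_nonneg _
  set I := (1 : Matrix (Fin m) (Fin m) ℝ) ⊗ₖ Dᵀ with hI
  have hIn : ‖I‖ ≤ ε := (norm_one_kronecker_le _).trans (by rwa [norm_transpose_eq])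
  rw [blockTranspose_add_mul, qf_kronCongr, Matrix.add_mulVec,
    qf_add_vec (transpose_kronecker_symm S Y), ← qf_kronCongr]
  set a := blockTranspose L *ᵥ v with ha
  set b := blockTranspose B *ᵥ v with hb
  have ha' : enorm₂ a ≤ ‖blockTranspose L‖ * enorm₂ v := enorm₂_mulVec_le _ _
  have hb' : enorm₂ b ≤ ‖blockTranspose B‖ * enorm₂ v := enorm₂_mulVec_le _ _
  have hIb : enorm₂ (I *ᵥ b) ≤ ε * (‖blockTranspose B‖ * enorm₂ v) :=
    (enorm₂_mulVec_le _ _).trans (mul_le_mul hIn hb' (enorm₂_nonneg _) hε)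
  rw [← Matrix.mulVec_mulVec, ← hb]
  have hv := enorm₂_nonneg v
  have h1 : a ⬝ᵥ (S.1 ⊗ₖ Y.1) *ᵥ (I *ᵥ b) ≤ (‖blockTranspose L‖ * enorm₂ v) *
      (‖S‖ * ‖Y‖ * (ε * (‖blockTranspose B‖ * enorm₂ v))) := by
    refine (le_abs_self _).trans ((dotProduct_le_enorm₂ _ _).trans ?_)
    refine mul_le_mul ha' ?_ (enorm₂_nonneg _) (by positivity)
    exact (enorm₂_mulVec_le _ _).trans (mul_le_mul (norm_kronecker_le _ _) hIb
      (enorm₂_nonneg _) (mul_nonneg (norm_nonneg _) (norm_nonneg _)))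
  -- Absorbing `D` into the argument leaves the operator of `𝐁^#` applied to `D Y Dᵀ`, so the
  -- quadratic term gets that operator's norm instead of a product of matrix norms.
  set E : Symm nu := Symm.mk' (D * Y.1 * Dᵀ) (by
    simp [Matrix.transpose_mul, Y.transpose_eq, Matrix.mul_assoc]) with hE
  have hEn : ‖E‖ ≤ ε ^ 2 * ‖Y‖ := by
    change ‖D * Y.1 * Dᵀ‖ ≤ _
    refine (Matrix.l2_opNorm_mul _ _).trans ?_
    rw [norm_transpose_eq]
    have e1 : ‖D * Y.1‖ ≤ ε * ‖Y‖ := (Matrix.l2_opNorm_mul _ _).trans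
      (mul_le_mul_of_nonneg_right hD (norm_nonneg _))
    exact (mul_le_mul e1 hD (norm_nonneg _) (mul_nonneg hε (norm_nonneg _))).trans_eq (by ring)
  have h2 : qf (S.1 ⊗ₖ Y.1) (I *ᵥ b) = qf (kronCongr S (blockTranspose B) E).1 v := by
    rw [qf_kronCongr, ← hb, ← qf_congr, hE, Symm.coe_mk', hI, ← Matrix.kroneckerMap_transpose,
      Matrix.transpose_transpose, Matrix.transpose_one, ← Matrix.mul_kronecker_mul,
      ← Matrix.mul_kronecker_mul, Matrix.one_mul, Matrix.mul_one]
  have h3 : qf (kronCongr S (blockTranspose B) E).1 v ≤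
      ‖kronCongr S (blockTranspose B)‖ * (ε ^ 2 * ‖Y‖) * enorm₂ v ^ 2 := by
    refine (abs_le.1 ((kronCongr S (blockTranspose B) E).abs_qf_le v)).2.trans
      (mul_le_mul_of_nonneg_right ?_ (sq_nonneg _))
    exact ((kronCongr S (blockTranspose B)).le_opNorm E).trans (mul_le_mul_of_nonneg_left hEn hκ)
  rw [h2]
  linarith

/-! ### Moment sequences dominated by a Lyapunov certificate -/

section Moments

variable {Λ : Symm n →L[ℝ] Symm n}
  (hΛ : ∀ X Y : Symm n, (∀ v, qf X.1 v ≤ qf Y.1 v) → ∀ v, qf (Λ X).1 v ≤ qf (Λ Y).1 v)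
  {M : ℕ → Symm n} (hM : ∀ k, M (k + 1) = Λ (M k)) {Y : Symm n} {a c : ℝ}

include hΛ hM

lemma qf_moment_sum_le (h0 : ∀ v, c * qf (M 0).1 v + a * qf (Λ Y).1 v ≤ a * qf Y.1 v)
    (hY : ∀ v, 0 ≤ a * qf Y.1 v) (N : ℕ) (v : Fin n → ℝ) :
    c * qf (∑ k ∈ Finset.range N, M k).1 v ≤ a * qf Y.1 v := by
  induction N generalizing v with
  | zero => simpa using hY v
  | succ N ih =>
    -- Partial sums satisfy `S_{N+1} = Λ S_N + M 0`, so a supersolution of this recursion dominates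
    -- all of them.
    have h1 : ∑ k ∈ Finset.range (N + 1), M k = Λ (∑ k ∈ Finset.range N, M k) + M 0 := by
      rw [Finset.sum_range_succ', map_sum]
      simp only [hM]
    have h2 := hΛ (c • ∑ k ∈ Finset.range N, M k) (a • Y) (fun w => by
      rw [Symm.coe_smul, Symm.coe_smul, qf_smul, qf_smul]; exact ih w) v
    rw [map_smul, map_smul, Symm.coe_smul, Symm.coe_smul, qf_smul, qf_smul] at h2
    rw [h1, Symm.coe_add, qf_add]
    linarith [h0 v]

lemma qf_moment_le {r : ℝ} (hr : 0 ≤ r) (ha : 0 ≤ a) (h0 : ∀ v, qf (M 0).1 v ≤ a * qf Y.1 v)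
    (hΛY : ∀ v, qf (Λ Y).1 v ≤ r * qf Y.1 v) (k : ℕ) (v : Fin n → ℝ) :
    qf (M k).1 v ≤ a * r ^ k * qf Y.1 v := by
  induction k generalizing v with
  | zero => simpa using h0 v
  | succ k ih =>
    have h2 := hΛ (M k) ((a * r ^ k) • Y) (fun w => by
      rw [Symm.coe_smul, qf_smul]; exact ih w) v
    rw [map_smul, Symm.coe_smul, qf_smul] at h2
    rw [hM, pow_succ]
    refine h2.trans ((mul_le_mul_of_nonneg_left (hΛY v) (by positivity)).trans_eq (by ring))

end Moments

lemma trace_congr_mul_le (N : Matrix (Fin nu) (Fin nu) ℝ) (D : Matrix (Fin nu) (Fin n) ℝ)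
    (X : Matrix (Fin n) (Fin n) ℝ) :
    (Dᵀ * N * D * X).trace ≤ (min n nu : ℕ) * (‖D‖ ^ 2 * ‖N‖ * ‖X‖) := by
  have hb : 0 ≤ ‖D‖ ^ 2 * ‖N‖ * ‖X‖ := by positivity
  have mul3 : ∀ {a b c d e : ℕ} (A : Matrix (Fin a) (Fin b) ℝ) (B : Matrix (Fin b) (Fin c) ℝ)
      (C : Matrix (Fin c) (Fin d) ℝ) (E : Matrix (Fin d) (Fin e) ℝ),
      ‖A * B * C * E‖ ≤ ‖A‖ * ‖B‖ * ‖C‖ * ‖E‖ := fun A B C E =>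
    (Matrix.l2_opNorm_mul _ _).trans <| mul_le_mul_of_nonneg_right
      ((Matrix.l2_opNorm_mul _ _).trans <| mul_le_mul_of_nonneg_right
        (Matrix.l2_opNorm_mul _ _) (norm_nonneg _)) (norm_nonneg _)
  rcases le_total n nu with h | h
  · rw [min_eq_left h]
    refine (norm_trace_le _).trans ?_
    rw [Fintype.card_fin]
    refine mul_le_mul_of_nonneg_left ((mul3 _ _ _ _).trans_eq ?_) (Nat.cast_nonneg _)
    rw [norm_transpose_eq]; ring
  -- The trace is cyclic, so it can be taken in the smaller of the two dimensions.
  · rw [min_eq_right h, Matrix.mul_assoc, Matrix.mul_assoc, Matrix.trace_mul_comm,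
      ← Matrix.mul_assoc]
    refine (norm_trace_le _).trans ?_
    rw [Fintype.card_fin]
    refine mul_le_mul_of_nonneg_left ((mul3 _ _ _ _).trans_eq ?_) (Nat.cast_nonneg _)
    rw [norm_transpose_eq]; ring

end Lyapunov

/-! ### Second moments along the noisy dynamics -/

section Noise

open ProbabilityTheory

variable {Ω : Type*} [mΩ : MeasurableSpace Ω] {μ : Measure Ω}

/-- The vector `(1, w)`. -/
def extendOne {nw : ℕ} (v : Fin nw → ℝ) : Fin (nw + 1) → ℝ := Fin.cons 1 v

/-- The information available before time `k`. -/
@[reducible] def pastNoise {nw : ℕ} (w : ℕ → Ω → Fin nw → ℝ) (k : ℕ) : MeasurableSpace Ω :=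
  ⨆ j : Fin k, MeasurableSpace.comap (w j) inferInstance

/-- All components are square integrable. -/
def SquareIntegrable {ι : Type*} (μ : Measure Ω) (f : Ω → ι → ℝ) : Prop :=
  ∀ a, MemLp (fun ω => f ω a) 2 μ

/-- The second moment matrix `E [f fᵀ]`. -/
noncomputable def momentMatrix {ι : Type*} (μ : Measure Ω) (f : Ω → ι → ℝ) : Matrix ι ι ℝ :=
  Matrix.of fun a b => ∫ ω, f ω a * f ω b ∂μ

lemma SquareIntegrable.integrable_mul {ι : Type*} {f : Ω → ι → ℝ} (hf : SquareIntegrable μ f)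
    (a b : ι) : Integrable (fun ω => f ω a * f ω b) μ :=
  (hf a).integrable_mul (hf b)

lemma SquareIntegrable.mulVec {ι κ : Type*} [Fintype ι] {f : Ω → ι → ℝ}
    (hf : SquareIntegrable μ f) (C : Matrix κ ι ℝ) : SquareIntegrable μ fun ω => C *ᵥ f ω :=
  fun a => by
    simp only [Matrix.mulVec, dotProduct]
    exact memLp_finsetSum _ fun i _ => (hf i).const_mul (C a i)

lemma SquareIntegrable.add {ι : Type*} {f g : Ω → ι → ℝ} (hf : SquareIntegrable μ f)
    (hg : SquareIntegrable μ g) : SquareIntegrable μ fun ω => f ω + g ω :=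
  fun a => (hf a).add (hg a)

lemma SquareIntegrable.sub {ι : Type*} {f g : Ω → ι → ℝ} (hf : SquareIntegrable μ f)
    (hg : SquareIntegrable μ g) : SquareIntegrable μ fun ω => f ω - g ω :=
  fun a => (hf a).sub (hg a)

lemma qf_eq_sum {ι : Type*} [Fintype ι] (C : Matrix ι ι ℝ) (v : ι → ℝ) :
    qf C v = ∑ a, ∑ b, C a b * (v a * v b) := by
  simp only [qf, dotProduct, Matrix.mulVec, Finset.mul_sum]
  exact Finset.sum_congr rfl fun a _ => Finset.sum_congr rfl fun b _ => by ring

lemma SquareIntegrable.integrable_qf {ι : Type*} [Fintype ι] {f : Ω → ι → ℝ}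
    (hf : SquareIntegrable μ f) (C : Matrix ι ι ℝ) : Integrable (fun ω => qf C (f ω)) μ := by
  simp only [qf_eq_sum]
  exact integrable_finsetSum _ fun a _ => integrable_finsetSum _ fun b _ =>
    (hf.integrable_mul a b).const_mul _

lemma SquareIntegrable.integral_qf {ι : Type*} [Fintype ι] {f : Ω → ι → ℝ}
    (hf : SquareIntegrable μ f) (C : Matrix ι ι ℝ) :
    ∫ ω, qf C (f ω) ∂μ = ∑ a, ∑ b, C a b * momentMatrix μ f a b := by
  have h : ∀ a b, Integrable (fun ω => C a b * (f ω a * f ω b)) μ := fun a b =>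
    (hf.integrable_mul a b).const_mul _
  simp only [qf_eq_sum]
  rw [integral_finsetSum _ fun a _ => integrable_finsetSum _ fun b _ => h a b]
  refine Finset.sum_congr rfl fun a _ => ?_
  rw [integral_finsetSum _ fun b _ => h a b]
  refine Finset.sum_congr rfl fun b _ => ?_
  rw [integral_const_mul]
  rfl

variable {nw : ℕ} {w : ℕ → Ω → Fin nw → ℝ} {Sg : Symm nw}

omit mΩ in
lemma pastNoise_mono (w : ℕ → Ω → Fin nw → ℝ) {j k : ℕ} (h : j ≤ k) :
    pastNoise w j ≤ pastNoise w k :=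
  iSup_le fun i => le_iSup (fun i : Fin k => MeasurableSpace.comap (w i) inferInstance)
    (Fin.castLE h i)

omit mΩ in
lemma comap_le_pastNoise (w : ℕ → Ω → Fin nw → ℝ) (k : ℕ) :
    MeasurableSpace.comap (w k) inferInstance ≤ pastNoise w (k + 1) :=
  le_iSup (fun i : Fin (k + 1) => MeasurableSpace.comap (w i) inferInstance) (Fin.last k)

namespace IsNoise

variable (hw : IsNoise μ w Sg)

include hw

lemma pastNoise_le (k : ℕ) : pastNoise w k ≤ mΩ :=
  iSup_le fun j => (hw.measurable j).comap_le

lemma indep_past (k : ℕ) :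
    Indep (MeasurableSpace.comap (w k) inferInstance) (pastNoise w k) μ := by
  -- The index sets `{k}` and `{j | j < k}` are disjoint, so the present noise is independent of its
  -- strict past.
  have h := indep_iSup_of_disjoint (μ := μ)
    (m := fun j => MeasurableSpace.comap (w j) inferInstance)
    (fun j => (hw.measurable j).comap_le) hw.indep (S := {k}) (T := {j | j < k})
    (by simp)
  refine indep_of_indep_of_le_left (indep_of_indep_of_le_right h ?_) ?_
  · exact iSup_le fun j => le_iSup₂_of_le (j : ℕ) j.2 le_rfl
  · exact le_iSup₂_of_le k rfl le_rfl

lemma indepFun_past {k : ℕ} {g : (Fin nw → ℝ) → ℝ} (hg : Measurable g) {f : Ω → ℝ}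
    (hf : Measurable[pastNoise w k] f) : IndepFun (fun ω => g (w k ω)) f μ := by
  rw [IndepFun_iff_Indep]
  refine indep_of_indep_of_le_left (indep_of_indep_of_le_right (hw.indep_past k) hf.comap_le) ?_
  rw [show (fun ω => g (w k ω)) = g ∘ w k from rfl, ← MeasurableSpace.comap_comp]
  exact MeasurableSpace.comap_mono hg.comap_le

lemma memLp_all (k : ℕ) (i : Fin nw) : MemLp (fun ω => w k ω i) 2 μ :=
  ((hw.identDistrib k).comp (measurable_pi_apply i)).memLp_iff.2 (hw.memLp i)

lemma memLp_extendOne [IsProbabilityMeasure μ] (k : ℕ) (i : Fin (nw + 1)) :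
    MemLp (fun ω => extendOne (w k ω) i) 2 μ := by
  refine Fin.cases ?_ (fun i => ?_) i
  · exact memLp_const 1
  · exact hw.memLp_all k i

lemma integral_extendOne_mul [IsProbabilityMeasure μ] (k : ℕ) (i j : Fin (nw + 1)) :
    ∫ ω, extendOne (w k ω) i * extendOne (w k ω) j ∂μ = (augment Sg).1 i j := by
  have hmean : ∀ i, ∫ ω, w k ω i ∂μ = 0 := fun i => by
    rw [← hw.mean i]
    exact ((hw.identDistrib k).comp (measurable_pi_apply i)).integral_eq
  have hsq : ∀ i j, ∫ ω, w k ω i * w k ω j ∂μ = Sg.1 i j := fun i j => by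
    rw [← hw.secondMoment i j]
    exact ((hw.identDistrib k).comp
      ((measurable_pi_apply i).mul (measurable_pi_apply j))).integral_eq
  refine Fin.cases ?_ (fun i => ?_) i <;> refine Fin.cases ?_ (fun j => ?_) j
  · simp [extendOne, augment]
  · simp [extendOne, augment, hmean]
  · simp [extendOne, augment, hmean]
  · simpa [extendOne, augment] using hsq i j

omit hw in
lemma measurable_extendOne (i : Fin (nw + 1)) :
    Measurable fun v : Fin nw → ℝ => extendOne v i := by
  refine Fin.cases ?_ (fun i => ?_) i
  · exact measurable_const
  · exact measurable_pi_apply i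

/-- The noise at time `k` is independent of the past, so the integral factors. Independence also
supplies integrability: a product of four square integrable functions need not be integrable. -/
lemma integrable_and_integral_term [IsProbabilityMeasure μ] {k : ℕ} {f g : Ω → ℝ}
    (hf : Measurable[pastNoise w k] f) (hg : Measurable[pastNoise w k] g)
    (hf2 : MemLp f 2 μ) (hg2 : MemLp g 2 μ) (i j : Fin (nw + 1)) :
    Integrable (fun ω => extendOne (w k ω) i * f ω * (extendOne (w k ω) j * g ω)) μ ∧
    ∫ ω, extendOne (w k ω) i * f ω * (extendOne (w k ω) j * g ω) ∂μ =
      (augment Sg).1 i j * ∫ ω, f ω * g ω ∂μ := by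
  have hrw : (fun ω => extendOne (w k ω) i * f ω * (extendOne (w k ω) j * g ω)) =
      (fun ω => extendOne (w k ω) i * extendOne (w k ω) j) * fun ω => f ω * g ω := by
    ext ω; simp only [Pi.mul_apply]; ring
  have hind : IndepFun (fun ω => extendOne (w k ω) i * extendOne (w k ω) j)
      (fun ω => f ω * g ω) μ :=
    hw.indepFun_past ((measurable_extendOne i).mul (measurable_extendOne j)) (hf.mul hg)
  have h1 : Integrable (fun ω => extendOne (w k ω) i * extendOne (w k ω) j) μ :=
    (hw.memLp_extendOne k i).integrable_mul (hw.memLp_extendOne k j)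
  have h2 : Integrable (fun ω => f ω * g ω) μ := hf2.integrable_mul hg2
  rw [hrw]
  refine ⟨hind.integrable_mul h1 h2, ?_⟩
  rw [hind.integral_mul_eq_mul_integral h1.aestronglyMeasurable h2.aestronglyMeasurable,
    hw.integral_extendOne_mul]

variable [IsProbabilityMeasure μ] {n k : ℕ} {z : Ω → Fin (nw + 1) × Fin n → ℝ}
  (hz : ∀ c, Measurable[pastNoise w k] fun ω => z ω c) (hz2 : SquareIntegrable μ z)

include hz hz2

lemma integrable_and_integral_step (a b : Fin n) :
    Integrable (fun ω => (∑ i, extendOne (w k ω) i * z ω (i, a)) *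
      ∑ j, extendOne (w k ω) j * z ω (j, b)) μ ∧
    ∫ ω, (∑ i, extendOne (w k ω) i * z ω (i, a)) *
      ∑ j, extendOne (w k ω) j * z ω (j, b) ∂μ =
      ∑ i, ∑ j, (augment Sg).1 i j * momentMatrix μ z (i, a) (j, b) := by
  have h := fun i j => hw.integrable_and_integral_term (hz (i, a)) (hz (j, b)) (hz2 _) (hz2 _) i j
  simp only [Finset.sum_mul_sum]
  refine ⟨integrable_finsetSum _ fun i _ => integrable_finsetSum _ fun j _ => (h i j).1, ?_⟩
  rw [integral_finsetSum _ fun i _ => integrable_finsetSum _ fun j _ => (h i j).1]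
  refine Finset.sum_congr rfl fun i _ => ?_
  rw [integral_finsetSum _ fun j _ => (h i j).1]
  exact Finset.sum_congr rfl fun j _ => (h i j).2

lemma squareIntegrable_step :
    SquareIntegrable μ fun ω (a : Fin n) => ∑ i, extendOne (w k ω) i * z ω (i, a) := fun a => by
  refine (memLp_two_iff_integrable_sq ?_).2 ?_
  · refine Measurable.aestronglyMeasurable (Finset.measurable_sum _ fun i _ => ?_)
    exact ((measurable_extendOne i).comp (hw.measurable k)).mul
      ((hz (i, a)).mono (hw.pastNoise_le k) le_rfl)
  · simpa only [sq] using (hw.integrable_and_integral_step hz hz2 a a).1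

lemma momentMatrix_step (a b : Fin n) :
    momentMatrix μ (fun ω (a : Fin n) => ∑ i, extendOne (w k ω) i * z ω (i, a)) a b =
      ∑ i, ∑ j, (augment Sg).1 i j * momentMatrix μ z (i, a) (j, b) :=
  (hw.integrable_and_integral_step hz hz2 a b).2

/-- The expected quadratic form of the successor state. -/
lemma integral_qf_step (P : Matrix (Fin n) (Fin n) ℝ) :
    ∫ ω, qf P (fun a => ∑ i, extendOne (w k ω) i * z ω (i, a)) ∂μ =
      ∫ ω, qf ((augment Sg).1 ⊗ₖ P) (z ω) ∂μ := by
  rw [(hw.squareIntegrable_step hz hz2).integral_qf, hz2.integral_qf]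
  simp only [hw.momentMatrix_step hz hz2, Fintype.sum_prod_type, Matrix.kroneckerMap_apply,
    Finset.mul_sum]
  calc ∑ a, ∑ b, ∑ i, ∑ j, P a b * ((augment Sg).1 i j * momentMatrix μ z (i, a) (j, b))
      = ∑ a, ∑ i, ∑ b, ∑ j, P a b * ((augment Sg).1 i j * momentMatrix μ z (i, a) (j, b)) :=
        Finset.sum_congr rfl fun a _ => Finset.sum_comm
    _ = ∑ i, ∑ a, ∑ b, ∑ j, P a b * ((augment Sg).1 i j * momentMatrix μ z (i, a) (j, b)) :=
        Finset.sum_comm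
    _ = _ := Finset.sum_congr rfl fun i _ => Finset.sum_congr rfl fun a _ => by
      rw [Finset.sum_comm]
      exact Finset.sum_congr rfl fun j _ => Finset.sum_congr rfl fun b _ => by ring

omit hz hz2

/-- For a deterministic `v` the form is the expectation of the square of `v ⬝ᵥ (1, w)`; this is the
moment identity in state dimension one. -/
lemma augment_posSemidef : (augment Sg).1.PosSemidef := by
  refine .of_qf (augment Sg).transpose_eq fun v => ?_
  have h := hw.integrable_and_integral_step (n := 1) (k := 0) (z := fun _ c => v c.1)
    (fun c => measurable_const) (fun c => memLp_const _) 0 0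
  have h1 : qf (augment Sg).1 v =
      ∑ i, ∑ j, (augment Sg).1 i j *
        momentMatrix μ (fun (_ : Ω) (c : Fin (nw + 1) × Fin 1) => v c.1) (i, 0) (j, 0) := by
    rw [qf_eq_sum]
    simp [momentMatrix]
  rw [h1, ← h.2]
  exact integral_nonneg fun ω => mul_self_nonneg _

end IsNoise

end Noise

/-! ### Expected costs -/

namespace LQRSystem

section Dynamics

variable {nx nu nw : ℕ} (sys : LQRSystem nx nu nw) {Ω : Type*} [mΩ : MeasurableSpace Ω]
  {μ : Measure Ω} {w : ℕ → Ω → Fin nw → ℝ} {Sg : Symm nw} {u : ℕ → Ω → Fin nu → ℝ}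

/-- The stacked products `(A_i x + B_i u)_i`. -/
def stacked (x : Fin nx → ℝ) (v : Fin nu → ℝ) : Fin (nw + 1) × Fin nx → ℝ :=
  sys.bA *ᵥ x + sys.bB *ᵥ v

lemma step_eq_sum (c : Fin nw → ℝ) (x : Fin nx → ℝ) (v : Fin nu → ℝ) :
    sys.Aw c *ᵥ x + sys.Bw c *ᵥ v =
      fun a => ∑ i, extendOne c i * sys.stacked x v (i, a) := by
  have hA : ∀ i a, (sys.bA *ᵥ x) (i, a) = (sys.A i *ᵥ x) a := fun _ _ => rfl
  have hB : ∀ i a, (sys.bB *ᵥ v) (i, a) = (sys.B i *ᵥ v) a := fun _ _ => rfl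
  ext a
  simp only [stacked, Pi.add_apply, hA, hB, Fin.sum_univ_succ, Aw, Bw, Matrix.add_mulVec,
    Matrix.sum_mulVec, Matrix.smul_mulVec, Finset.sum_apply, Pi.smul_apply, smul_eq_mul, mul_add,
    Finset.sum_add_distrib, extendOne, Fin.cons_zero, Fin.cons_succ, one_mul]

omit mΩ in
lemma state_succ (x₀ : Fin nx → ℝ) (k : ℕ) :
    sys.state w u x₀ (k + 1) = fun ω a => ∑ i, extendOne (w k ω) i *
      sys.stacked (sys.state w u x₀ k ω) (u k ω) (i, a) :=
  funext fun _ => sys.step_eq_sum _ _ _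

omit mΩ in
lemma closedLoop_eq_state (K : Matrix (Fin nu) (Fin nx) ℝ) (x₀ : Fin nx → ℝ) (k : ℕ) :
    sys.closedLoop w K x₀ k =
      sys.state w (fun k ω => K *ᵥ sys.closedLoop w K x₀ k ω) x₀ k := by
  induction k with
  | zero => rfl
  | succ k ih =>
    ext1 ω
    rw [state, ← ih, closedLoop, Matrix.add_mulVec, Matrix.mulVec_mulVec]

omit mΩ in
lemma measurable_stacked_apply [MeasurableSpace Ω] {x : Ω → Fin nx → ℝ} {v : Ω → Fin nu → ℝ}
    (hx : Measurable x) (hv : Measurable v) (c : Fin (nw + 1) × Fin nx) :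
    Measurable fun ω => sys.stacked (x ω) (v ω) c := by
  simp only [stacked, Pi.add_apply, Matrix.mulVec, dotProduct]
  exact (Finset.measurable_sum _ fun i _ => ((measurable_pi_apply i).comp hx).const_mul _).add
    (Finset.measurable_sum _ fun i _ => ((measurable_pi_apply i).comp hv).const_mul _)

omit mΩ in
lemma measurable_step [MeasurableSpace Ω] {c : Ω → Fin nw → ℝ} {x : Ω → Fin nx → ℝ}
    {v : Ω → Fin nu → ℝ} (hc : Measurable c) (hx : Measurable x) (hv : Measurable v) :
    Measurable fun ω a => ∑ i, extendOne (c ω) i * sys.stacked (x ω) (v ω) (i, a) :=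
  measurable_pi_lambda _ fun a => Finset.measurable_sum _ fun i _ =>
    ((IsNoise.measurable_extendOne i).comp hc).mul
      (sys.measurable_stacked_apply hx hv (i, a))

lemma measurable_state (hu : ∀ k, Measurable[pastNoise w k] (u k)) (x₀ : Fin nx → ℝ) (k : ℕ) :
    Measurable[pastNoise w k] (sys.state w u x₀ k) := by
  induction k with
  | zero => exact @measurable_const _ _ _ (pastNoise w 0) x₀
  | succ k ih =>
    rw [state_succ]
    have hle := pastNoise_mono w k.le_succ
    exact @measurable_step _ _ _ sys _ (pastNoise w (k + 1)) _ _ _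
      (measurable_iff_comap_le.2 (comap_le_pastNoise w k)) (ih.mono hle le_rfl)
      ((hu k).mono hle le_rfl)

/-- A separate induction is needed because the feedback input is itself defined through the state.
-/
lemma measurable_closedLoop (K : Matrix (Fin nu) (Fin nx) ℝ) (x₀ : Fin nx → ℝ) (k : ℕ) :
    Measurable[pastNoise w k] (sys.closedLoop w K x₀ k) := by
  induction k with
  | zero => exact @measurable_const _ _ _ (pastNoise w 0) x₀
  | succ k ih =>
    have hle := pastNoise_mono w k.le_succ
    have hK : Measurable fun y : Fin nx → ℝ => K *ᵥ y :=
      (Matrix.mulVecLin K).continuous_of_finiteDimensional.measurable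
    rw [closedLoop_eq_state, state_succ]
    simp only [← closedLoop_eq_state]
    exact @measurable_step _ _ _ sys _ (pastNoise w (k + 1)) _ _ _
      (measurable_iff_comap_le.2 (comap_le_pastNoise w k)) (ih.mono hle le_rfl)
      (hK.comp (ih.mono hle le_rfl))

lemma admissible_feedback (K : Matrix (Fin nu) (Fin nx) ℝ) (x₀ : Fin nx → ℝ) :
    Admissible w fun k ω => K *ᵥ sys.closedLoop w K x₀ k ω := fun k =>
  (Matrix.mulVecLin K).continuous_of_finiteDimensional.measurable.comp
    (sys.measurable_closedLoop K x₀ k)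

lemma squareIntegrable_stacked {x : Ω → Fin nx → ℝ} {v : Ω → Fin nu → ℝ}
    (hx : SquareIntegrable μ x) (hv : SquareIntegrable μ v) :
    SquareIntegrable μ fun ω => sys.stacked (x ω) (v ω) :=
  (hx.mulVec _).add (hv.mulVec _)

variable [IsProbabilityMeasure μ] (hw : IsNoise μ w Sg)

include hw

lemma squareIntegrable_state (hu : ∀ k, Measurable[pastNoise w k] (u k))
    (hu2 : ∀ k, SquareIntegrable μ (u k)) (x₀ : Fin nx → ℝ) (k : ℕ) :
    SquareIntegrable μ (sys.state w u x₀ k) := by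
  induction k with
  | zero => exact fun a => memLp_const _
  | succ k ih =>
    rw [state_succ]
    exact hw.squareIntegrable_step (z := fun ω => sys.stacked (sys.state w u x₀ k ω) (u k ω))
      (fun c => @measurable_stacked_apply _ _ _ sys _ (pastNoise w k) _ _
        (sys.measurable_state hu x₀ k) (hu k) c) (sys.squareIntegrable_stacked ih (hu2 k))

lemma squareIntegrable_closedLoop (K : Matrix (Fin nu) (Fin nx) ℝ) (x₀ : Fin nx → ℝ) (k : ℕ) :
    SquareIntegrable μ (sys.closedLoop w K x₀ k) := by
  induction k with
  | zero => exact fun a => memLp_const _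
  | succ k ih =>
    rw [closedLoop_eq_state, state_succ]
    simp only [← closedLoop_eq_state]
    exact hw.squareIntegrable_step
      (z := fun ω => sys.stacked (sys.closedLoop w K x₀ k ω) (K *ᵥ sys.closedLoop w K x₀ k ω))
      (fun c => @measurable_stacked_apply _ _ _ sys _ (pastNoise w k) _ _
        (sys.measurable_closedLoop K x₀ k) (sys.admissible_feedback K x₀ k) c)
      (sys.squareIntegrable_stacked ih (ih.mulVec K))

/-- The expected stage cost telescopes up to the deviation from the optimal feedback. -/
lemma integral_stage_eq (hR : sys.R.PosDef) {P : Matrix (Fin nx) (Fin nx) ℝ} (hP : P.PosSemidef)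
    (hfix : stepValue sys.bA sys.bB sys.Q sys.R ((augment Sg).1 ⊗ₖ P) = P)
    (hu : ∀ k, Measurable[pastNoise w k] (u k)) (hu2 : ∀ k, SquareIntegrable μ (u k))
    (x₀ : Fin nx → ℝ) (k : ℕ) :
    ∫ ω, (qf sys.Q (sys.state w u x₀ k ω) + qf sys.R (u k ω)) ∂μ =
      ∫ ω, qf P (sys.state w u x₀ k ω) ∂μ - ∫ ω, qf P (sys.state w u x₀ (k + 1) ω) ∂μ +
        ∫ ω, qf (sys.R + sys.bBᵀ * ((augment Sg).1 ⊗ₖ P) * sys.bB)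
          (u k ω - stepGain sys.bA sys.bB sys.R ((augment Sg).1 ⊗ₖ P) *ᵥ
            sys.state w u x₀ k ω) ∂μ := by
  have hx2 := sys.squareIntegrable_state hw hu hu2 x₀ k
  have hz2 := sys.squareIntegrable_stacked hx2 (hu2 k)
  have hnext : ∫ ω, qf P (sys.state w u x₀ (k + 1) ω) ∂μ =
      ∫ ω, qf ((augment Sg).1 ⊗ₖ P) (sys.stacked (sys.state w u x₀ k ω) (u k ω)) ∂μ := by
    rw [state_succ]
    exact hw.integral_qf_step
      (fun c => @measurable_stacked_apply _ _ _ sys _ (pastNoise w k) _ _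
        (sys.measurable_state hu x₀ k) (hu k) c) hz2 P
  have hdev := ((hu2 k).sub (hx2.mulVec (stepGain sys.bA sys.bB sys.R
    ((augment Sg).1 ⊗ₖ P)))).integrable_qf (sys.R + sys.bBᵀ * ((augment Sg).1 ⊗ₖ P) * sys.bB)
  have hpt : ∀ ω, qf sys.Q (sys.state w u x₀ k ω) + qf sys.R (u k ω) =
      qf P (sys.state w u x₀ k ω) -
        qf ((augment Sg).1 ⊗ₖ P) (sys.stacked (sys.state w u x₀ k ω) (u k ω)) +
        qf (sys.R + sys.bBᵀ * ((augment Sg).1 ⊗ₖ P) * sys.bB)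
          (u k ω - stepGain sys.bA sys.bB sys.R ((augment Sg).1 ⊗ₖ P) *ᵥ
            sys.state w u x₀ k ω) := fun ω => by
    have h := step_completion (A := sys.bA) (B := sys.bB) (Q := sys.Q) hR
      (hw.augment_posSemidef.kronecker hP) (sys.state w u x₀ k ω) (u k ω)
    rw [hfix] at h
    rw [stacked]
    linarith
  simp only [hpt]
  rw [hnext, integral_add _ hdev, integral_sub (hx2.integrable_qf P) (hz2.integrable_qf _)]
  exact (hx2.integrable_qf P).sub (hz2.integrable_qf _)

lemma sum_integral_stage_eq (hR : sys.R.PosDef) {P : Matrix (Fin nx) (Fin nx) ℝ}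
    (hP : P.PosSemidef)
    (hfix : stepValue sys.bA sys.bB sys.Q sys.R ((augment Sg).1 ⊗ₖ P) = P)
    (hu : ∀ k, Measurable[pastNoise w k] (u k)) (hu2 : ∀ k, SquareIntegrable μ (u k))
    (x₀ : Fin nx → ℝ) (N : ℕ) :
    ∑ k ∈ Finset.range N, ∫ ω, (qf sys.Q (sys.state w u x₀ k ω) + qf sys.R (u k ω)) ∂μ =
      qf P x₀ - ∫ ω, qf P (sys.state w u x₀ N ω) ∂μ +
        ∑ k ∈ Finset.range N, ∫ ω, qf (sys.R + sys.bBᵀ * ((augment Sg).1 ⊗ₖ P) * sys.bB)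
          (u k ω - stepGain sys.bA sys.bB sys.R ((augment Sg).1 ⊗ₖ P) *ᵥ
            sys.state w u x₀ k ω) ∂μ := by
  rw [Finset.sum_congr rfl fun k _ => sys.integral_stage_eq hw hR hP hfix hu hu2 x₀ k,
    Finset.sum_add_distrib, Finset.sum_range_sub']
  simp [state]

omit hw [IsProbabilityMeasure μ] in
lemma totalCost_eq_tsum (hQ : sys.Q.PosDef) (hR : sys.R.PosDef)
    {x : ℕ → Ω → Fin nx → ℝ} (hx2 : ∀ k, SquareIntegrable μ (x k))
    (hu2 : ∀ k, SquareIntegrable μ (u k)) :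
    sys.totalCost μ x u =
      ∑' k, ENNReal.ofReal (∫ ω, (qf sys.Q (x k ω) + qf sys.R (u k ω)) ∂μ) := by
  have hint : ∀ k, Integrable (fun ω => qf sys.Q (x k ω) + qf sys.R (u k ω)) μ := fun k =>
    ((hx2 k).integrable_qf _).add ((hu2 k).integrable_qf _)
  change ∫⁻ ω, ∑' k, ENNReal.ofReal (qf sys.Q (x k ω) + qf sys.R (u k ω)) ∂μ = _
  rw [lintegral_tsum fun k => (hint k).aemeasurable.ennreal_ofReal]
  refine tsum_congr fun k => (ofReal_integral_eq_lintegral_ofReal (hint k) ?_).symm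
  exact ae_of_all _ fun ω => add_nonneg (hQ.posSemidef.qf_nonneg _) (hR.posSemidef.qf_nonneg _)

omit [IsProbabilityMeasure μ] in
/-- Finite cost forces square integrable inputs. -/
lemma squareIntegrable_of_totalCost_ne_top (hQ : sys.Q.PosDef) (hR : sys.R.PosDef)
    {x : ℕ → Ω → Fin nx → ℝ} (hu : ∀ k, Measurable[pastNoise w k] (u k))
    (hfin : sys.totalCost μ x u ≠ ∞) (k : ℕ) : SquareIntegrable μ (u k) := fun a => by
  obtain ⟨c, hc, -, hcR⟩ := exists_pos_mul_le_qf hR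
  have hmeas : Measurable fun ω => u k ω a :=
    (measurable_pi_apply a).comp ((hu k).mono (hw.pastNoise_le k) le_rfl)
  refine (memLp_two_iff_integrable_sq hmeas.aestronglyMeasurable).2
    ⟨(hmeas.pow_const 2).aestronglyMeasurable, ?_⟩
  rw [hasFiniteIntegral_iff_ofReal (ae_of_all _ fun ω => sq_nonneg _)]
  have hle : ∀ ω, ENNReal.ofReal (u k ω a ^ 2) ≤ ENNReal.ofReal c⁻¹ *
      ∑' j, ENNReal.ofReal (qf sys.Q (x j ω) + qf sys.R (u j ω)) := fun ω => by
    have h1 : u k ω a ^ 2 ≤ enorm₂ (u k ω) ^ 2 := by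
      rw [enorm₂_sq, dotProduct, sq]
      exact Finset.single_le_sum (f := fun i => u k ω i * u k ω i)
        (fun i _ => mul_self_nonneg _) (Finset.mem_univ a)
    have h2 : u k ω a ^ 2 ≤ c⁻¹ * (qf sys.Q (x k ω) + qf sys.R (u k ω)) := by
      rw [inv_mul_eq_div, le_div_iff₀ hc]
      nlinarith [hcR (u k ω), hQ.posSemidef.qf_nonneg (x k ω)]
    refine (ENNReal.ofReal_le_ofReal h2).trans ?_
    rw [ENNReal.ofReal_mul (inv_nonneg.2 hc.le)]
    exact mul_le_mul_right (ENNReal.le_tsum (f := fun j =>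
      ENNReal.ofReal (qf sys.Q (x j ω) + qf sys.R (u j ω))) k) _
  refine (lintegral_mono hle).trans_lt ?_
  rw [lintegral_const_mul' _ _ ENNReal.ofReal_ne_top]
  exact ENNReal.mul_lt_top ENNReal.ofReal_lt_top (lt_top_iff_ne_top.2 hfin)

/-- No admissible input process beats `x₀ᵀ P x₀`. -/
lemma le_totalCost (hQ : sys.Q.PosDef) (hR : sys.R.PosDef) {P : Matrix (Fin nx) (Fin nx) ℝ}
    (hP : P.PosSemidef)
    (hfix : stepValue sys.bA sys.bB sys.Q sys.R ((augment Sg).1 ⊗ₖ P) = P)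
    (hu : Admissible w u) (x₀ : Fin nx → ℝ) :
    ENNReal.ofReal (qf P x₀) ≤ sys.totalCost μ (sys.state w u x₀) u := by
  rcases eq_or_ne (sys.totalCost μ (sys.state w u x₀) u) ∞ with htop | hfin
  · rw [htop]; exact le_top
  have hu' : ∀ k, Measurable[pastNoise w k] (u k) := hu
  have hu2 := sys.squareIntegrable_of_totalCost_ne_top hw hQ hR hu' hfin
  have hx2 := sys.squareIntegrable_state hw hu' hu2 x₀
  obtain ⟨q, hq, -, hqP⟩ := exists_pos_mul_qf_le hQ P
  rw [sys.totalCost_eq_tsum hQ hR hx2 hu2] at hfin ⊢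
  set J : ℕ → ℝ := fun k =>
    ∫ ω, (qf sys.Q (sys.state w u x₀ k ω) + qf sys.R (u k ω)) ∂μ with hJ
  have hJ0 : ∀ k, 0 ≤ J k := fun k => integral_nonneg fun ω =>
    add_nonneg (hQ.posSemidef.qf_nonneg _) (hR.posSemidef.qf_nonneg _)
  have hsum : Summable J :=
    (ENNReal.summable_toReal hfin).congr fun k => ENNReal.toReal_ofReal (hJ0 k)
  rw [← ENNReal.ofReal_tsum_of_nonneg hJ0 hsum]
  refine ENNReal.ofReal_le_ofReal ?_
  -- Drop the nonnegative deviations; the terminal term is at most `q⁻¹` times the stage cost at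
  -- time `N`, which tends to zero because the stage costs are summable.
  have hN : ∀ N, qf P x₀ ≤ ∑' k, J k + q⁻¹ * J N := fun N => by
    have h1 := sys.sum_integral_stage_eq hw hR hP hfix hu' hu2 x₀ N
    have h2 : 0 ≤ ∑ k ∈ Finset.range N,
        ∫ ω, qf (sys.R + sys.bBᵀ * ((augment Sg).1 ⊗ₖ P) * sys.bB)
          (u k ω - stepGain sys.bA sys.bB sys.R ((augment Sg).1 ⊗ₖ P) *ᵥ
            sys.state w u x₀ k ω) ∂μ :=
      Finset.sum_nonneg fun k _ => integral_nonneg fun ω =>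
        (posDef_add_congr hR (hw.augment_posSemidef.kronecker hP)).posSemidef.qf_nonneg _
    have h3 : ∫ ω, qf P (sys.state w u x₀ N ω) ∂μ ≤ q⁻¹ * J N := by
      rw [← integral_const_mul]
      refine integral_mono ((hx2 N).integrable_qf P)
        ((((hx2 N).integrable_qf _).add ((hu2 N).integrable_qf _)).const_mul _) fun ω => ?_
      change qf P (sys.state w u x₀ N ω) ≤ q⁻¹ * (_ + _)
      rw [inv_mul_eq_div, le_div_iff₀ hq, mul_comm]
      exact (hqP _).trans (le_add_of_nonneg_right (hR.posSemidef.qf_nonneg _))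
    have h4 := hsum.sum_le_tsum (Finset.range N) fun k _ => hJ0 k
    linarith
  have hlim : Tendsto (fun N => ∑' k, J k + q⁻¹ * J N) atTop (𝓝 (∑' k, J k)) := by
    simpa using (hsum.tendsto_atTop_zero.const_mul q⁻¹).const_add (∑' k, J k)
  exact ge_of_tendsto' hlim hN

omit hw [IsProbabilityMeasure μ] in
lemma momentMatrix_transpose {n : ℕ} (f : Ω → Fin n → ℝ) :
    (momentMatrix μ f)ᵀ = momentMatrix μ f := by
  ext a b
  simp only [momentMatrix, Matrix.transpose_apply, Matrix.of_apply, mul_comm]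

/-- The second moments of the closed loop evolve by the adjoint closed-loop operator. -/
lemma momentMatrix_closedLoop_succ (K : Matrix (Fin nu) (Fin nx) ℝ) (x₀ : Fin nx → ℝ) (k : ℕ) :
    momentMatrix μ (sys.closedLoop w K x₀ (k + 1)) =
      (kronCongr (augment Sg) (blockTranspose (sys.bA + sys.bB * K))
        (Symm.mk' (momentMatrix μ (sys.closedLoop w K x₀ k)) (momentMatrix_transpose _))).1 := by
  have hx2 := sys.squareIntegrable_closedLoop hw K x₀ k
  have hstack : ∀ ω, sys.stacked (sys.closedLoop w K x₀ k ω) (K *ᵥ sys.closedLoop w K x₀ k ω) =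
      (sys.bA + sys.bB * K) *ᵥ sys.closedLoop w K x₀ k ω := fun ω => by
    rw [stacked, Matrix.add_mulVec, Matrix.mulVec_mulVec]
  have hmom : ∀ c d, momentMatrix μ
      (fun ω => (sys.bA + sys.bB * K) *ᵥ sys.closedLoop w K x₀ k ω) c d =
      ∑ a, ∑ b, momentMatrix μ (sys.closedLoop w K x₀ k) a b *
        (sys.bA + sys.bB * K) c a * (sys.bA + sys.bB * K) d b := fun c d => by
    have h := hx2.integral_qf (Matrix.vecMulVec ((sys.bA + sys.bB * K) c)
      ((sys.bA + sys.bB * K) d))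
    have h1 : ∀ ω, qf (Matrix.vecMulVec ((sys.bA + sys.bB * K) c) ((sys.bA + sys.bB * K) d))
        (sys.closedLoop w K x₀ k ω) =
        ((sys.bA + sys.bB * K) *ᵥ sys.closedLoop w K x₀ k ω) c *
          ((sys.bA + sys.bB * K) *ᵥ sys.closedLoop w K x₀ k ω) d := fun ω =>
      qf_vecMulVec _ _ _
    simp only [h1] at h
    rw [momentMatrix, Matrix.of_apply, h]
    refine Finset.sum_congr rfl fun a _ => Finset.sum_congr rfl fun b _ => ?_
    rw [Matrix.vecMulVec_apply]
    ring
  ext a b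
  rw [closedLoop_eq_state, state_succ]
  simp only [← closedLoop_eq_state]
  rw [hw.momentMatrix_step
      (z := fun ω => sys.stacked (sys.closedLoop w K x₀ k ω) (K *ᵥ sys.closedLoop w K x₀ k ω))
      (fun c => @measurable_stacked_apply _ _ _ sys _ (pastNoise w k) _ _
        (sys.measurable_closedLoop K x₀ k) (sys.admissible_feedback K x₀ k) c)
      (sys.squareIntegrable_stacked hx2 (hx2.mulVec K)), kronCongr_apply_apply]
  simp only [hstack, hmom, blockTranspose, Matrix.of_apply, Symm.coe_mk', Finset.mul_sum,
    mul_assoc]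

end Dynamics

end LQRSystem

/-! ### The empirical controller -/

namespace LQRSystem

/-- `(η - κ s - √…) / (2 σ)` is a nonnegative root of `σ ε² - (η - κ s) ε + s a`. -/
lemma smallRoot_spec {a κ σ η s : ℝ} (ha : 0 ≤ a) (hκ : 0 ≤ κ) (hσ : 0 < σ) (hη : 0 ≤ η)
    (hs : 0 ≤ s) (haκ : κ = 0 → a = 0)
    (hsmall : s * κ ^ 2 ≤ 2 * a * σ + κ * η - 2 * √(a * σ * (a * σ + κ * η))) :
    0 ≤ (η - κ * s - √((η - κ * s) ^ 2 - 4 * a * σ * s)) / (2 * σ) ∧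
    s * (a + κ * ((η - κ * s - √((η - κ * s) ^ 2 - 4 * a * σ * s)) / (2 * σ))) +
      σ * ((η - κ * s - √((η - κ * s) ^ 2 - 4 * a * σ * s)) / (2 * σ)) ^ 2 =
      η * ((η - κ * s - √((η - κ * s) ^ 2 - 4 * a * σ * s)) / (2 * σ)) := by
  have hd : 0 ≤ η - κ * s ∧ 0 ≤ (η - κ * s) ^ 2 - 4 * a * σ * s := by
    rcases hκ.eq_or_lt with h0 | h0
    · rw [← h0, haκ h0.symm]
      constructor <;> nlinarith [sq_nonneg η]
    · set p := a * σ with hp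
      have hp0 : 0 ≤ p := by positivity
      have hq0 : 0 ≤ p * (p + κ * η) := by positivity
      set r := √(p * (p + κ * η)) with hr
      have hr0 : 0 ≤ r := Real.sqrt_nonneg _
      have hr2 : r ^ 2 = p * (p + κ * η) := Real.sq_sqrt hq0
      have hκη : 0 ≤ κ * η := by positivity
      -- Since `p ≤ r`, the smallness assumption already yields `κ² s ≤ κ η`, hence `0 ≤ η - κ s`.
      have hpr : p ≤ r := Real.le_sqrt_of_sq_le (by nlinarith [mul_nonneg hp0 hκη])
      have h1 : κ * (κ * s) ≤ κ * η := by nlinarith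
      refine ⟨by linarith [le_of_mul_le_mul_left h1 h0], ?_⟩
      have h2 : 2 * r ≤ κ * η + 2 * p - s * κ ^ 2 := by linarith
      have h3 : (2 * r) ^ 2 ≤ (κ * η + 2 * p - s * κ ^ 2) ^ 2 :=
        pow_le_pow_left₀ (by linarith) h2 2
      -- Scaled by `κ²`, the discriminant is a difference of squares, and it is nonnegative by
      -- squaring the smallness assumption.
      have h4 : 0 ≤ κ ^ 2 * ((η - κ * s) ^ 2 - 4 * a * σ * s) := by
        have : κ ^ 2 * ((η - κ * s) ^ 2 - 4 * a * σ * s) =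
            (κ * η + 2 * p - s * κ ^ 2) ^ 2 - 4 * (p * (p + κ * η)) := by rw [hp]; ring
        rw [this, ← hr2]
        linarith
      exact nonneg_of_mul_nonneg_right h4 (by positivity)
  obtain ⟨hd0, hdisc⟩ := hd
  set d := η - κ * s with hd
  set D := √(d ^ 2 - 4 * a * σ * s) with hD
  have hD2 : D ^ 2 = d ^ 2 - 4 * a * σ * s := Real.sq_sqrt hdisc
  have hDd : D ≤ d := Real.sqrt_le_iff.2 ⟨hd0, by
    have : 0 ≤ 4 * a * σ * s := by positivity
    linarith⟩
  refine ⟨div_nonneg (by linarith) (by linarith), ?_⟩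
  have hη' : η = d + κ * s := by rw [hd]; ring
  rw [hη']
  field_simp
  nlinarith

/-- The stability condition in polynomial form. -/
lemma two_mul_add_lt_of_mul_lt {b κ η ε : ℝ} (hb : 0 ≤ b) (hκ : 0 ≤ κ) (hε : 0 ≤ ε)
    (hη : 0 ≤ η) (h : ε * (b + √(b ^ 2 + κ * η)) < η) : 2 * b * ε + κ * ε ^ 2 < η := by
  set r := √(b ^ 2 + κ * η) with hr
  have hκη : 0 ≤ κ * η := by positivity
  have hr2 : r ^ 2 = b ^ 2 + κ * η := Real.sq_sqrt (by positivity)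
  have hr0 : 0 ≤ r := Real.sqrt_nonneg _
  have hbr : b ≤ r := Real.le_sqrt_of_sq_le (by linarith)
  rcases (add_nonneg hb hr0).eq_or_lt with h0 | h0
  · have hb0 : b = 0 := by linarith
    have hr00 : r = 0 := by linarith
    have hη0 : 0 < η := by rwa [← h0, mul_zero] at h
    have hκ0 : κ = 0 := by
      rw [hr00, hb0] at hr2
      have : κ * η = 0 := by linarith
      exact (mul_eq_zero.1 this).resolve_right hη0.ne'
    rw [hb0, hκ0]
    linarith
  -- Here `(r - b)(r + b) = κ η`; multiplying `h` by `κ` and cancelling `b + r` gives the claim.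
  -- Then `(2 b + κ ε) ε ≤ (b + r) ε < η`.
  · have h1 : κ * ε ≤ r - b := by
      refine le_of_mul_le_mul_left ?_ h0
      nlinarith [mul_le_mul_of_nonneg_left h.le hκ]
    nlinarith [mul_le_mul_of_nonneg_right h1 hε]

variable {nx nu nw : ℕ} (sys : LQRSystem nx nu nw)

lemma IsRiccatiSolution.stepValue_eq {sys : LQRSystem nx nu nw} {S : Symm (nw + 1)} {P : Symm nx}
    (h : sys.IsRiccatiSolution S P) :
    stepValue sys.bA sys.bB sys.Q sys.R (S.1 ⊗ₖ P.1) = P.1 := by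
  have h2 : P.1 - sys.Q - sys.bAᵀ * (S.1 ⊗ₖ P.1) * sys.bA +
      (sys.bBᵀ * (S.1 ⊗ₖ P.1) * sys.bA)ᵀ * (sys.R + sys.bBᵀ * (S.1 ⊗ₖ P.1) * sys.bB)⁻¹ *
        (sys.bBᵀ * (S.1 ⊗ₖ P.1) * sys.bA) = 0 := h.2
  rw [stepValue, eq_comm, ← sub_eq_zero, ← h2]
  abel

lemma gain_eq (S : Symm (nw + 1)) (P : Symm nx) :
    sys.gain S P = stepGain sys.bA sys.bB sys.R (S.1 ⊗ₖ P.1) := rfl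

variable {S : Symm (nw + 1)} {P : Symm nx}

/-- The closed loop under the optimal gain contracts `P`. -/
lemma exists_contraction (hQ : sys.Q.PosDef) (hR : sys.R.PosDef) (hS : S.1.PosSemidef)
    (hP : sys.IsRiccatiSolution S P) :
    ∃ c r : ℝ, 0 < c ∧ 0 ≤ r ∧ r < 1 ∧ (∀ v, c * enorm₂ v ^ 2 ≤ qf P.1 v) ∧
      ∀ v, qf (kronCongr S (sys.bL S P) P).1 v ≤ r * qf P.1 v := by
  obtain ⟨c, hc, -, hcQ⟩ := exists_pos_mul_le_qf hQ
  obtain ⟨q, hq, hq1, hqP⟩ := exists_pos_mul_qf_le hQ P.1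
  have h := fun v => qf_riccati_closedLoop hR hS hP.1 hP.stepValue_eq v
  refine ⟨c, 1 - q, hc, by linarith, by linarith, fun v => ?_, fun v => ?_⟩
  · rw [h v]
    linarith [hcQ v, hR.posSemidef.qf_nonneg (stepGain sys.bA sys.bB sys.R (S.1 ⊗ₖ P.1) *ᵥ v),
      (hS.kronecker hP.1).qf_nonneg
        ((sys.bA + sys.bB * stepGain sys.bA sys.bB sys.R (S.1 ⊗ₖ P.1)) *ᵥ v)]
  · rw [qf_kronCongr, bL, gain_eq]
    linarith [h v, hqP v,
      hR.posSemidef.qf_nonneg (stepGain sys.bA sys.bB sys.R (S.1 ⊗ₖ P.1) *ᵥ v)]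

lemma lyap_isInvertible (hQ : sys.Q.PosDef) (hR : sys.R.PosDef) (hS : S.1.PosSemidef)
    (hP : sys.IsRiccatiSolution S P) : (sys.lyap S P).IsInvertible := by
  obtain ⟨c, r, hc, hr, hr1, hcP, hrP⟩ := sys.exists_contraction hQ hR hS hP
  exact isInvertible_id_sub (fun X Y h v => qf_kronCongr_mono hS _ h v) hc hcP hr hr1 hrP

lemma nonneg_of_lyap_nonneg (hQ : sys.Q.PosDef) (hR : sys.R.PosDef) (hS : S.1.PosSemidef)
    (hP : sys.IsRiccatiSolution S P) (X : Symm nx)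
    (hX : ∀ v, 0 ≤ qf (X - kronCongr S (sys.bL S P) X).1 v) (v : Fin nx → ℝ) :
    0 ≤ qf X.1 v := by
  obtain ⟨c, r, hc, hr, hr1, hcP, hrP⟩ := sys.exists_contraction hQ hR hS hP
  exact nonneg_of_id_sub_nonneg (fun X Y h v => qf_kronCongr_mono hS _ h v) hc hcP hr hr1 hrP hX v

/-- If `𝐋 = 0`, stationarity forces the gain and hence `𝐀` to vanish; if `𝐁 R⁻¹ 𝐁ᵀ = 0`,
definiteness of `R⁻¹` forces `𝐁 = 0`. Either way every `H` vanishes. -/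
lemma gain_eq_zero_of_kappaS_eq_zero (hR : sys.R.PosDef) (hS : S.1.PosSemidef) (hS0 : S ≠ 0)
    (hP : P.1.PosSemidef) (h : sys.kappaS S P = 0) (T : Symm (nw + 1)) (X : Symm nx) :
    sys.gain T X = 0 := by
  have hcases : sys.bL S P = 0 ∨ sys.bB * sys.R⁻¹ * sys.bBᵀ = 0 := by
    simpa [kappaS, hS0] using h
  suffices sys.bA = 0 ∨ sys.bB = 0 by
    rcases this with h | h <;> simp [gain, H, h]
  rcases hcases with hL | hB
  · left
    have h1 := stepGain_stationary (A := sys.bA) (B := sys.bB) hR (hS.kronecker hP)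
    rw [← gain_eq, ← bL, hL, Matrix.mul_zero, add_zero] at h1
    have hdet := (Matrix.isUnit_iff_isUnit_det _).1 hR.isUnit
    have h2 : sys.gain S P = 0 := by
      rw [← Matrix.nonsing_inv_mul_cancel_left _ (sys.gain S P) hdet, h1, Matrix.mul_zero]
    rw [bL, h2, Matrix.mul_zero, add_zero] at hL
    exact hL
  · right
    have h1 : ∀ z, sys.bBᵀ *ᵥ z = 0 := fun z => by
      by_contra hz
      have h2 := hR.inv.dotProduct_mulVec_pos hz
      have h3 : qf (sys.bB * sys.R⁻¹ * sys.bBᵀ) z = 0 := by rw [hB]; simp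
      have h4 := qf_congr sys.R⁻¹ sys.bBᵀ z
      rw [Matrix.transpose_transpose, h3] at h4
      rw [star_trivial, ← qf, ← h4] at h2
      exact lt_irrefl _ h2
    have h2 : sys.bBᵀ = 0 := by
      ext i j
      have := congrFun (h1 (Pi.single j 1)) i
      simpa using this
    simpa using congrArg Matrix.transpose h2

/-- The gain of the perturbed problem is within `epsK` of the optimal one. -/
lemma norm_gain_sub_le (hQ : sys.Q.PosDef) (hR : sys.R.PosDef) (hS : S.1.PosSemidef) (hS0 : S ≠ 0)
    {Δ : Symm (nw + 1)} {lb ub : ℝ} (hlb : -1 ≤ lb) (hlb0 : lb ≤ 0) (hub : 0 ≤ ub)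
    (hl : (Δ.1 - lb • S.1).PosSemidef) (hu : (ub • S.1 - Δ.1).PosSemidef)
    {P' : Symm nx} (hP : sys.IsRiccatiSolution S P) (hP' : sys.IsRiccatiSolution (S + Δ) P')
    (hsmall : max |lb| |ub| * sys.kappaA S ^ 2 ≤
      2 * sys.etaA S P * sys.kappaS S P + sys.kappaA S * sys.etaLyap S P -
        2 * √(sys.etaA S P * sys.kappaS S P *
          (sys.etaA S P * sys.kappaS S P + sys.kappaA S * sys.etaLyap S P))) :
    ‖sys.gain (S + Δ) P' - sys.gain S P‖ ≤ sys.epsK S P (max |lb| |ub|) := by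
  set s := max |lb| |ub| with hs
  have hs0 : 0 ≤ s := le_max_of_le_left (abs_nonneg lb)
  have hκS0 : 0 ≤ sys.kappaS S P := by unfold kappaS; positivity
  rcases hκS0.eq_or_lt with h0 | hκS
  -- When `kappaS = 0`, division by zero makes `epsP` zero. Both gains vanish, so nonnegativity of
  -- the bound is enough.
  · rw [sys.gain_eq_zero_of_kappaS_eq_zero hR hS hS0 hP.1 h0.symm,
      sys.gain_eq_zero_of_kappaS_eq_zero hR hS hS0 hP.1 h0.symm, sub_zero, norm_zero]
    have hμ : 0 ≤ sys.muR := sInf_spectrum_nonneg hR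
    have hε : sys.epsP S P s = 0 := by simp [epsP, ← h0]
    have hηK : 0 ≤ sys.etaK S P := by
      have : 0 ≤ sys.etaB S P := norm_nonneg _
      unfold etaK etaAB
      positivity
    rw [epsK, hε, mul_zero, zero_mul, zero_add]
    exact mul_nonneg (one_div_nonneg.2 hμ) (mul_nonneg hs0 hηK)
  · have hnu : Nonempty (Fin nu) := by
      by_contra hne
      rw [not_nonempty_iff] at hne
      have hB : sys.bB = 0 := by ext i j; exact hne.elim j
      rw [kappaS, hB] at hκS
      simp at hκS
    have hμ : 0 < sys.muR := sInf_spectrum_pos hR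
    have hA0 : 0 ≤ sys.etaA S P := norm_nonneg _
    have hκA : 0 ≤ sys.kappaA S := ContinuousLinearMap.opNorm_nonneg _
    have hη : 0 ≤ sys.etaLyap S P := inv_nonneg.2 (ContinuousLinearMap.opNorm_nonneg _)
    have haκ : sys.kappaA S = 0 → sys.etaA S P = 0 := fun h => by
      refine le_antisymm (((sys.F S).le_opNorm P).trans_eq ?_) hA0
      rw [← kappaA, h, zero_mul]
    have hinv := sys.lyap_isInvertible hQ hR hS hP
    obtain ⟨hε, hquad⟩ := smallRoot_spec hA0 hκA hκS hη hs0 haκ hsmall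
    have hY : (sys.lyap S P).inverse 1 -
        kronCongr S (sys.bL S P) ((sys.lyap S P).inverse 1) = 1 :=
      hinv.self_apply_inverse 1
    have hXP : ‖P' - P‖ ≤ sys.epsP S P s :=
      norm_riccati_sub_le hQ hR hS hlb hlb0 hub hl hu hP.1 hP'.1 hP.stepValue_eq
        hP'.stepValue_eq rfl hY
        (sys.nonneg_of_lyap_nonneg hQ hR hS hP _ fun v => by
          rw [hY, Symm.qf_one]; positivity)
        hη (inv_norm_inverse_mul_le _) hε hquad.le
    have h := norm_stepGain_sub_le (A := sys.bA) (B := sys.bB) hR hS hlb hl hu hP.1 hP'.1 hXP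
    rw [epsK, one_div, inv_mul_eq_div, le_div_iff₀' hμ]
    exact h

/-- A matrix that certifies mean-square stability of the perturbed closed loop. -/
lemma exists_adjoint_certificate (hQ : sys.Q.PosDef) (hR : sys.R.PosDef) (hS : S.1.PosSemidef)
    (hP : sys.IsRiccatiSolution S P) (hη : 0 < sys.etaLyapAdj S P)
    {K : Matrix (Fin nu) (Fin nx) ℝ} {ε : ℝ} (hK : ‖K - sys.gain S P‖ ≤ ε) :
    ∃ Y : Symm nx, (∀ v, enorm₂ v ^ 2 ≤ qf Y.1 v) ∧
      (∀ v, sys.etaLyapAdj S P * qf Y.1 v ≤ enorm₂ v ^ 2) ∧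
      ∀ v, sys.etaLyapAdj S P *
          qf (kronCongr S (blockTranspose (sys.bA + sys.bB * K)) Y).1 v ≤
        sys.etaLyapAdj S P * qf Y.1 v - (sys.etaLyapAdj S P -
          (2 * sys.etaLBAdj S P * ε + sys.kappaBAdj S * ε ^ 2)) * enorm₂ v ^ 2 := by
  have hε : 0 ≤ ε := (norm_nonneg _).trans hK
  have hinv : (sys.lyapAdj S P).IsInvertible := isInvertible_of_inverse_norm_pos hη
  set Y := (sys.lyapAdj S P).inverse 1 with hYdef
  have hY : Y - kronCongr S (blockTranspose (sys.bL S P)) Y = 1 := hinv.self_apply_inverse 1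
  have hYn : sys.etaLyapAdj S P * ‖Y‖ ≤ 1 := inv_norm_inverse_mul_le _
  have hY0 : ∀ v, 0 ≤ qf Y.1 v :=
    nonneg_of_adjoint_lyapunov (sys.lyap_isInvertible hQ hR hS hP)
      (sys.nonneg_of_lyap_nonneg hQ hR hS hP) hY
  have hstep : ∀ v, qf Y.1 v -
      qf (kronCongr S (blockTranspose (sys.bL S P)) Y).1 v = enorm₂ v ^ 2 := fun v => by
    rw [← qf_sub, ← Symm.coe_sub, hY, Symm.qf_one]
  have hLY0 : ∀ v, 0 ≤ qf (kronCongr S (blockTranspose (sys.bL S P)) Y).1 v := fun v => by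
    rw [qf_kronCongr]
    exact (hS.kronecker (Symm.posSemidef hY0)).qf_nonneg _
  have hκ : 0 ≤ sys.kappaBAdj S := ContinuousLinearMap.opNorm_nonneg _
  have hb : 0 ≤ sys.etaLBAdj S P := by unfold etaLBAdj; positivity
  refine ⟨Y, fun v => by linarith [hstep v, hLY0 v], fun v => ?_, fun v => ?_⟩
  · have h1 := mul_le_mul_of_nonneg_left (abs_le.1 (Y.abs_qf_le v)).2 hη.le
    have h2 := mul_le_mul_of_nonneg_right hYn (sq_nonneg (enorm₂ v))
    linarith
  · have h1 := qf_adjoint_perturb_le S (sys.bL S P) sys.bB (K - sys.gain S P) hK Y v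
    have h2 : sys.bL S P + sys.bB * (K - sys.gain S P) = sys.bA + sys.bB * K := by
      rw [bL, Matrix.mul_sub]; abel
    rw [h2] at h1
    have h3 := mul_le_mul_of_nonneg_left h1 hη.le
    have hπ : 0 ≤ 2 * sys.etaLBAdj S P * ε + sys.kappaBAdj S * ε ^ 2 := by positivity
    have h4 := mul_le_mul_of_nonneg_right hYn (mul_nonneg hπ (sq_nonneg (enorm₂ v)))
    have h5 := hstep v
    change _ ≤ sys.etaLyapAdj S P * (_ + (2 * sys.etaLBAdj S P * ε + sys.kappaBAdj S * ε ^ 2) *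
      ‖Y‖ * enorm₂ v ^ 2) at h3
    nlinarith

/-! ### Stability and cost of the perturbed closed loop -/

section ClosedLoop

variable {Ω : Type*} [mΩ : MeasurableSpace Ω] {μ : Measure Ω} [IsProbabilityMeasure μ]
  {w : ℕ → Ω → Fin nw → ℝ} {Sg : Symm nw} {K : Matrix (Fin nu) (Fin nx) ℝ}

/-- The second moment `E [x_k x_kᵀ]` of the closed loop. -/
noncomputable def closedLoopMoment (μ : Measure Ω) (w : ℕ → Ω → Fin nw → ℝ)
    (K : Matrix (Fin nu) (Fin nx) ℝ) (x₀ : Fin nx → ℝ) (k : ℕ) : Symm nx :=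
  Symm.mk' (momentMatrix μ (sys.closedLoop w K x₀ k)) (momentMatrix_transpose _)

lemma closedLoopMoment_zero (x₀ : Fin nx → ℝ) :
    (sys.closedLoopMoment μ w K x₀ 0).1 = Matrix.vecMulVec x₀ x₀ := by
  ext a b
  simp [closedLoopMoment, momentMatrix, closedLoop, Matrix.vecMulVec_apply]

variable (hw : IsNoise μ w Sg) {Y : Symm nx} {η π : ℝ} (hη : 0 < η) (hπ : π < η)
  (hY1 : ∀ v, enorm₂ v ^ 2 ≤ qf Y.1 v) (hY2 : ∀ v, η * qf Y.1 v ≤ enorm₂ v ^ 2)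
  (hY3 : ∀ v, η * qf (kronCongr (augment Sg) (blockTranspose (sys.bA + sys.bB * K)) Y).1 v ≤
    η * qf Y.1 v - (η - π) * enorm₂ v ^ 2)

include hw hη hπ hY1 hY2 hY3

lemma expMeanSquareStable_of_certificate : sys.ExpMeanSquareStable μ w K := by
  have hmono := fun X Y h v => qf_kronCongr_mono (X := X) (Y := Y) hw.augment_posSemidef
    (blockTranspose (sys.bA + sys.bB * K)) h v
  -- The value `1 / 2` only keeps the rate positive; likewise the `+ 1` in the constant covers `nx =
  -- 0`.
  have hr0 : (0 : ℝ) < max (1 - (η - π)) (1 / 2) := lt_max_of_lt_right (by norm_num)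
  refine ⟨nx / η + 1, max (1 - (η - π)) (1 / 2), by positivity, hr0,
    max_lt (by linarith) (by norm_num), fun x₀ k => ?_⟩
  set r := max (1 - (η - π)) (1 / 2) with hr
  have hY0 : ∀ v, 0 ≤ qf Y.1 v := fun v => (sq_nonneg _).trans (hY1 v)
  have hΛY : ∀ v, qf (kronCongr (augment Sg) (blockTranspose (sys.bA + sys.bB * K)) Y).1 v ≤
      r * qf Y.1 v := fun v => by
    have h1 := mul_le_mul_of_nonneg_left (hY2 v) (by linarith : 0 ≤ η - π)
    have h2 : 1 - (η - π) ≤ r := le_max_left _ _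
    refine (le_of_mul_le_mul_left (?_ : η * _ ≤ η * ((1 - (η - π)) * qf Y.1 v)) hη).trans
      (mul_le_mul_of_nonneg_right h2 (hY0 v))
    linarith [hY3 v]
  have hM := qf_moment_le hmono (M := sys.closedLoopMoment μ w K x₀)
    (fun k => Subtype.ext (sys.momentMatrix_closedLoop_succ hw K x₀ k)) (Y := Y)
    (a := enorm₂ x₀ ^ 2) hr0.le (sq_nonneg _) (fun v => by
      rw [closedLoopMoment_zero]
      exact (qf_vecMulVec_le x₀ v).trans (mul_le_mul_of_nonneg_left (hY1 v) (sq_nonneg _)))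
    hΛY k
  have hx2 := sys.squareIntegrable_closedLoop hw K x₀ k
  have hint := hx2.integrable_qf (1 : Matrix (Fin nx) (Fin nx) ℝ)
  have hval := hx2.integral_qf (1 : Matrix (Fin nx) (Fin nx) ℝ)
  simp only [_root_.qf_one, ← enorm₂_sq] at hint hval
  change ∫⁻ ω, ENNReal.ofReal (enorm₂ (sys.closedLoop w K x₀ k ω) ^ 2) ∂μ ≤
    ENNReal.ofReal ((nx / η + 1) * r ^ k * enorm₂ x₀ ^ 2)
  rw [← ofReal_integral_eq_lintegral_ofReal hint (ae_of_all _ fun ω => sq_nonneg _), hval]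
  refine ENNReal.ofReal_le_ofReal ?_
  have hdiag : ∀ a, momentMatrix μ (sys.closedLoop w K x₀ k) a a ≤
      enorm₂ x₀ ^ 2 * r ^ k * η⁻¹ := fun a => by
    have h1 := hM (Pi.single a 1)
    have h2 := hY2 (Pi.single a 1)
    have h3 : enorm₂ (Pi.single a (1 : ℝ)) ^ 2 = 1 := by rw [enorm₂_sq]; simp
    have h4 : qf Y.1 (Pi.single a 1) ≤ η⁻¹ := by
      rw [h3] at h2
      rw [inv_eq_one_div, le_div_iff₀' hη]
      exact h2
    have h5 : qf (sys.closedLoopMoment μ w K x₀ k).1 (Pi.single a 1) =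
        momentMatrix μ (sys.closedLoop w K x₀ k) a a := by
      simp [qf, closedLoopMoment]
    rw [← h5]
    exact h1.trans (mul_le_mul_of_nonneg_left h4 (by positivity))
  calc ∑ a, ∑ b, (1 : Matrix (Fin nx) (Fin nx) ℝ) a b *
        momentMatrix μ (sys.closedLoop w K x₀ k) a b
      = ∑ a, momentMatrix μ (sys.closedLoop w K x₀ k) a a := by
        simp [Matrix.one_apply]
    _ ≤ ∑ _a : Fin nx, enorm₂ x₀ ^ 2 * r ^ k * η⁻¹ := Finset.sum_le_sum fun a _ => hdiag a
    _ = nx / η * r ^ k * enorm₂ x₀ ^ 2 := by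
        rw [Finset.sum_const, Finset.card_univ, Fintype.card_fin, nsmul_eq_mul, div_eq_mul_inv]
        ring
    _ ≤ (nx / η + 1) * r ^ k * enorm₂ x₀ ^ 2 := by
        have : 0 ≤ r ^ k * enorm₂ x₀ ^ 2 := by positivity
        nlinarith

/-- The initial moment is at most `|x₀|² · 1`, and the certificate loses `(1 - π/η) · 1` per step,
so a multiple of `Y` dominates all partial sums. `η Y ≤ 1` turns this into a norm bound. -/
lemma norm_sum_closedLoopMoment_le (x₀ : Fin nx → ℝ) (N : ℕ) :
    ‖∑ k ∈ Finset.range N, sys.closedLoopMoment μ w K x₀ k‖ ≤ enorm₂ x₀ ^ 2 / (η - π) := by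
  have hmono := fun X Y h v => qf_kronCongr_mono (X := X) (Y := Y) hw.augment_posSemidef
    (blockTranspose (sys.bA + sys.bB * K)) h v
  have hπη : 0 < η - π := by linarith
  have hY0 : ∀ v, 0 ≤ qf Y.1 v := fun v => (sq_nonneg _).trans (hY1 v)
  have hM := qf_moment_sum_le hmono (M := sys.closedLoopMoment μ w K x₀)
    (fun k => Subtype.ext (sys.momentMatrix_closedLoop_succ hw K x₀ k)) (Y := Y)
    (a := enorm₂ x₀ ^ 2 * η) (c := η - π) (fun v => by
      rw [closedLoopMoment_zero]
      have h1 := mul_le_mul_of_nonneg_left (qf_vecMulVec_le x₀ v) hπη.le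
      have h2 := mul_le_mul_of_nonneg_left (hY3 v) (sq_nonneg (enorm₂ x₀))
      linarith)
    (fun v => mul_nonneg (mul_nonneg (sq_nonneg _) hη.le) (hY0 v)) N
  have hpos : ∀ k v, 0 ≤ qf (sys.closedLoopMoment μ w K x₀ k).1 v := fun k v => by
    have h1 := (sys.squareIntegrable_closedLoop hw K x₀ k).integral_qf (Matrix.vecMulVec v v)
    have h2 : qf (sys.closedLoopMoment μ w K x₀ k).1 v =
        ∫ ω, qf (Matrix.vecMulVec v v) (sys.closedLoop w K x₀ k ω) ∂μ := by
      rw [h1, qf_eq_sum]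
      refine Finset.sum_congr rfl fun a _ => Finset.sum_congr rfl fun b _ => ?_
      rw [Matrix.vecMulVec_apply, closedLoopMoment, Symm.coe_mk', mul_comm]
    rw [h2]
    exact integral_nonneg fun ω => by
      change 0 ≤ qf _ _
      rw [qf_vecMulVec]
      exact mul_self_nonneg _
  have hsum0 : ∀ v, 0 ≤ qf (∑ k ∈ Finset.range N, sys.closedLoopMoment μ w K x₀ k).1 v := by
    clear hM
    intro v
    induction N with
    | zero => simp
    | succ N ih =>
      rw [Finset.sum_range_succ, Symm.coe_add, qf_add]
      exact add_nonneg ih (hpos N v)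
  refine Symm.norm_le_of_abs_qf (by positivity) fun v => ?_
  rw [abs_of_nonneg (hsum0 v), div_mul_eq_mul_div, le_div_iff₀' hπη]
  refine (hM v).trans ?_
  have := mul_le_mul_of_nonneg_left (hY2 v) (sq_nonneg (enorm₂ x₀))
  linarith

omit hη hπ hY1 hY2 hY3 in
/-- The excess cost of a feedback, expressed through the summed second moments. -/
lemma sum_integral_deviation_eq (C : Matrix (Fin nx) (Fin nx) ℝ) (x₀ : Fin nx → ℝ) (N : ℕ) :
    ∑ k ∈ Finset.range N, ∫ ω, qf C (sys.closedLoop w K x₀ k ω) ∂μ =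
      (C * (∑ k ∈ Finset.range N, sys.closedLoopMoment μ w K x₀ k).1).trace := by
  induction N with
  | zero => simp
  | succ N ih =>
    rw [Finset.sum_range_succ, Finset.sum_range_succ, ih, Symm.coe_add, Matrix.mul_add,
      Matrix.trace_add, (sys.squareIntegrable_closedLoop hw K x₀ N).integral_qf]
    congr 1
    simp only [Matrix.trace, Matrix.diag_apply, Matrix.mul_apply]
    refine Finset.sum_congr rfl fun a _ => Finset.sum_congr rfl fun b _ => ?_
    rw [closedLoopMoment, Symm.coe_mk', ← Matrix.transpose_apply (momentMatrix μ _) b a,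
      momentMatrix_transpose]

/-- The cost of a feedback near the optimal one. -/
lemma feedbackCost_le (hQ : sys.Q.PosDef) (hR : sys.R.PosDef)
    (hP : sys.IsRiccatiSolution (augment Sg) P) (x₀ : Fin nx → ℝ) :
    sys.feedbackCost μ w K x₀ ≤ ENNReal.ofReal (qf P.1 x₀ + (min nx nu : ℕ) *
      (‖K - sys.gain (augment Sg) P‖ ^ 2 * sys.etaBR (augment Sg) P *
        (enorm₂ x₀ ^ 2 / (η - π)))) := by
  set u : ℕ → Ω → Fin nu → ℝ := fun k ω => K *ᵥ sys.closedLoop w K x₀ k ω with hu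
  have hstate : sys.closedLoop w K x₀ = sys.state w u x₀ :=
    funext fun k => sys.closedLoop_eq_state K x₀ k
  have hadm : ∀ k, Measurable[pastNoise w k] (u k) := sys.admissible_feedback K x₀
  have hx2 := sys.squareIntegrable_closedLoop hw K x₀
  have hu2 : ∀ k, SquareIntegrable μ (u k) := fun k => (hx2 k).mulVec K
  have hcost : sys.feedbackCost μ w K x₀ = sys.totalCost μ (sys.state w u x₀) u := by
    rw [feedbackCost, ← hstate]
  rw [hcost, sys.totalCost_eq_tsum hQ hR (fun k => hstate ▸ hx2 k) hu2]
  -- Partial sums suffice: the terminal term enters with a negative sign and is dropped, so no limit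
  -- is needed.
  refine ENNReal.tsum_le_of_sum_range_le fun N => ?_
  rw [← ENNReal.ofReal_sum_of_nonneg fun k _ => integral_nonneg fun ω =>
    add_nonneg (hQ.posSemidef.qf_nonneg _) (hR.posSemidef.qf_nonneg _)]
  refine ENNReal.ofReal_le_ofReal ?_
  rw [sys.sum_integral_stage_eq hw hR hP.1 hP.stepValue_eq hadm hu2 x₀ N, ← gain_eq, ← hstate]
  set D := K - sys.gain (augment Sg) P with hD
  set E := sys.R + sys.bBᵀ * ((augment Sg).1 ⊗ₖ P.1) * sys.bB with hE
  have hdev : ∀ k ω, qf E (u k ω - sys.gain (augment Sg) P *ᵥ sys.closedLoop w K x₀ k ω) =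
      qf (Dᵀ * E * D) (sys.closedLoop w K x₀ k ω) := fun k ω => by
    rw [qf_congr, hD, Matrix.sub_mulVec]
  simp only [hdev]
  rw [sys.sum_integral_deviation_eq hw]
  have h1 : 0 ≤ ∫ ω, qf P.1 (sys.closedLoop w K x₀ N ω) ∂μ :=
    integral_nonneg fun ω => hP.1.qf_nonneg _
  have h2 := trace_congr_mul_le E D (∑ k ∈ Finset.range N, sys.closedLoopMoment μ w K x₀ k).1
  have h3 := sys.norm_sum_closedLoopMoment_le hw hη hπ hY1 hY2 hY3 x₀ N
  have h4 : ‖E‖ = sys.etaBR (augment Sg) P := by rw [hE, add_comm]; rfl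
  have h5 : (min nx nu : ℕ) * (‖D‖ ^ 2 * ‖E‖ *
        ‖(∑ k ∈ Finset.range N, sys.closedLoopMoment μ w K x₀ k).1‖) ≤
      (min nx nu : ℕ) * (‖D‖ ^ 2 * ‖E‖ * (enorm₂ x₀ ^ 2 / (η - π))) := by
    refine mul_le_mul_of_nonneg_left (mul_le_mul_of_nonneg_left ?_ (by positivity))
      (Nat.cast_nonneg _)
    rw [Symm.norm_coe]
    exact h3
  rw [← h4]
  linarith

end ClosedLoop

lemma ExpMeanSquareStable.meanSquareStable {sys : LQRSystem nx nu nw} {Ω : Type*}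
    [MeasurableSpace Ω] {μ : Measure Ω} {w : ℕ → Ω → Fin nw → ℝ} {K : Matrix (Fin nu) (Fin nx) ℝ}
    (h : sys.ExpMeanSquareStable μ w K) : sys.MeanSquareStable μ w K := fun x₀ => by
  obtain ⟨c, r, -, hr0, hr1, h⟩ := h
  have hlim : Tendsto (fun k : ℕ => ENNReal.ofReal (c * r ^ k * ‖WithLp.toLp 2 x₀‖ ^ 2)) atTop
      (𝓝 0) := by
    rw [← ENNReal.ofReal_zero]
    refine (ENNReal.continuous_ofReal.tendsto 0).comp ?_
    have := ((tendsto_pow_atTop_nhds_zero_of_lt_one hr0.le hr1).const_mul c).mul_const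
      (‖WithLp.toLp 2 x₀‖ ^ 2)
    simpa using this
  exact tendsto_of_tendsto_of_tendsto_of_le_of_le tendsto_const_nhds hlim (fun _ => zero_le)
    (h x₀)

end LQRSystem

theorem theorem3 {nx nu nw : ℕ} (sys : LQRSystem nx nu nw)
    (hQ : sys.Q.PosDef) (hR : sys.R.PosDef)
    {Ω : Type*} [MeasurableSpace Ω] (μ : Measure Ω) [IsProbabilityMeasure μ]
    (w : ℕ → Ω → Fin nw → ℝ) (Sg : Symm nw) (hw : IsNoise μ w Sg)
    (S₀ : Symm (nw + 1)) (hS₀ : S₀ = augment Sg)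
    -- the estimate `S₀ + Δ` of `S₀`
    (Δ : Symm (nw + 1)) (lb ub : ℝ) (hlb : -1 ≤ lb) (hlb' : lb ≤ 0) (hub : 0 ≤ ub)
    (hΔ_lower : (Δ.1 - lb • S₀.1).PosSemidef)
    (hΔ_upper : (ub • S₀.1 - Δ.1).PosSemidef)
    (s : ℝ) (hs : s = max |lb| |ub|)
    -- the Riccati solutions for `S₀` and for its estimate
    (P Phat : Symm nx) (hP : sys.IsRiccatiSolution S₀ P)
    (hPhat : sys.IsRiccatiSolution (S₀ + Δ) Phat)
    -- the conditions under which `epsP`, and so `epsK`, is a perturbation bound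
    (hs_small : s * sys.kappaA S₀ ^ 2 ≤
      2 * sys.etaA S₀ P * sys.kappaS S₀ P + sys.kappaA S₀ * sys.etaLyap S₀ P -
        2 * √(sys.etaA S₀ P * sys.kappaS S₀ P *
          (sys.etaA S₀ P * sys.kappaS S₀ P + sys.kappaA S₀ * sys.etaLyap S₀ P)))
    (hepsP : sys.epsP S₀ P s < LQRSystem.muP P)
    -- the stability condition
    (hstab : sys.epsK S₀ P s *
      (sys.etaLBAdj S₀ P +
        √(sys.etaLBAdj S₀ P ^ 2 + sys.kappaBAdj S₀ * sys.etaLyapAdj S₀ P)) <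
      sys.etaLyapAdj S₀ P) :
    sys.MeanSquareStable μ w (sys.gain (S₀ + Δ) Phat) ∧
    sys.ExpMeanSquareStable μ w (sys.gain (S₀ + Δ) Phat) ∧
    ∀ x₀ : Fin nx → ℝ,
      sys.optimalCost μ w x₀ ≠ ∞ ∧
      sys.feedbackCost μ w (sys.gain (S₀ + Δ) Phat) x₀ ≠ ∞ ∧
      (sys.feedbackCost μ w (sys.gain (S₀ + Δ) Phat) x₀).toReal -
          (sys.optimalCost μ w x₀).toReal ≤
        (min nx nu : ℕ) * sys.epsK S₀ P s ^ 2 * sys.etaBR S₀ P * ‖WithLp.toLp 2 x₀‖ ^ 2 *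
          (1 / sys.etaLyapAdj S₀ P) *
          (1 + (2 * sys.etaLBAdj S₀ P * sys.epsK S₀ P s +
                sys.kappaBAdj S₀ * sys.epsK S₀ P s ^ 2) /
              (sys.etaLyapAdj S₀ P - 2 * sys.etaLBAdj S₀ P * sys.epsK S₀ P s -
                sys.kappaBAdj S₀ * sys.epsK S₀ P s ^ 2)) := by
  subst hs hS₀
  have hS := hw.augment_posSemidef
  have hS0 : augment Sg ≠ 0 := fun h => by
    have h1 : (augment Sg).1 0 0 = 1 := rfl
    rw [h] at h1
    exact zero_ne_one h1
  set K := sys.gain (augment Sg + Δ) Phat with hK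
  set ε := sys.epsK (augment Sg) P (max |lb| |ub|) with hε
  set η := sys.etaLyapAdj (augment Sg) P with hη
  set b := sys.etaLBAdj (augment Sg) P with hb
  set κ := sys.kappaBAdj (augment Sg) with hκ
  have hD : ‖K - sys.gain (augment Sg) P‖ ≤ ε :=
    sys.norm_gain_sub_le hQ hR hS hS0 hlb hlb' hub hΔ_lower hΔ_upper hP hPhat hs_small
  have hε0 : 0 ≤ ε := (norm_nonneg _).trans hD
  have hb0 : 0 ≤ b := by rw [hb, LQRSystem.etaLBAdj]; positivity
  have hκ0 : 0 ≤ κ := ContinuousLinearMap.opNorm_nonneg _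
  -- Strictness of the stability condition, whose left side is nonnegative, makes `η` positive and
  -- so the adjoint Lyapunov operator invertible.
  have hη0 : 0 < η := lt_of_le_of_lt (by positivity) hstab
  have hπ : 2 * b * ε + κ * ε ^ 2 < η :=
    LQRSystem.two_mul_add_lt_of_mul_lt hb0 hκ0 hε0 hη0.le hstab
  obtain ⟨Y, hY1, hY2, hY3⟩ := sys.exists_adjoint_certificate hQ hR hS hP hη0 hD
  have hexp : sys.ExpMeanSquareStable μ w K :=
    sys.expMeanSquareStable_of_certificate hw hη0 hπ hY1 hY2 hY3
  refine ⟨hexp.meanSquareStable, hexp, fun x₀ => ?_⟩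
  have hub := sys.feedbackCost_le hw hη0 hπ hY1 hY2 hY3 hQ hR hP x₀
  have hlow : ENNReal.ofReal (qf P.1 x₀) ≤ sys.optimalCost μ w x₀ :=
    le_iInf₂ fun u hu => sys.le_totalCost hw hQ hR hP.1 hP.stepValue_eq hu x₀
  have hopt : sys.optimalCost μ w x₀ ≤ sys.feedbackCost μ w K x₀ := by
    refine (iInf₂_le _ (sys.admissible_feedback K x₀)).trans_eq ?_
    rw [LQRSystem.feedbackCost]
    congr 1
    exact (funext fun k => sys.closedLoop_eq_state K x₀ k).symm
  have hfin : sys.feedbackCost μ w K x₀ ≠ ∞ := ne_top_of_le_ne_top ENNReal.ofReal_ne_top hub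
  have hfin' : sys.optimalCost μ w x₀ ≠ ∞ := ne_top_of_le_ne_top hfin hopt
  refine ⟨hfin', hfin, ?_⟩
  have hP0 := hP.1.qf_nonneg x₀
  have hBR : 0 ≤ sys.etaBR (augment Sg) P := norm_nonneg _
  have hgap : 0 < η - (2 * b * ε + κ * ε ^ 2) := by linarith
  have h1 := (ENNReal.ofReal_le_iff_le_toReal hfin').1 hlow
  have h2 := ENNReal.toReal_mono ENNReal.ofReal_ne_top hub
  rw [ENNReal.toReal_ofReal (by positivity)] at h2
  -- With `π = 2 b ε + κ ε²`, the bracket in the stated bound is just `η / (η - π)`.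
  have h3 : 1 / η * (1 + (2 * b * ε + κ * ε ^ 2) / (η - 2 * b * ε - κ * ε ^ 2)) =
      1 / (η - (2 * b * ε + κ * ε ^ 2)) := by
    rw [sub_sub, one_add_div hgap.ne', sub_add_cancel, ← mul_div_assoc, one_div_mul_cancel hη0.ne']
  rw [mul_assoc _ (1 / η), h3]
  have h4 : (‖K - sys.gain (augment Sg) P‖ ^ 2 * sys.etaBR (augment Sg) P *
        (enorm₂ x₀ ^ 2 / (η - (2 * b * ε + κ * ε ^ 2)))) ≤
      ε ^ 2 * sys.etaBR (augment Sg) P *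
        (enorm₂ x₀ ^ 2 / (η - (2 * b * ε + κ * ε ^ 2))) := by
    have := pow_le_pow_left₀ (norm_nonneg _) hD 2
    gcongr
  have h5 := mul_le_mul_of_nonneg_left h4 (Nat.cast_nonneg (α := ℝ) (min nx nu))
  refine (sub_le_sub h2 h1).trans ?_
  rw [show ‖WithLp.toLp 2 x₀‖ = enorm₂ x₀ from rfl]
  calc _ ≤ _ := by linarith
    _ ≤ _ := h5
    _ = _ := by ring
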